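/- **Theorem 1.3 (real Lewis–Sternberg theorem).** Equip $\mathbf R^{2n}$, with coordinates $\rho=(x,\xi)$, with the standard symplectic form $\sigma=\sum_j d\xi_j\wedge dx_j$, and let $H_p=(\partial_\xi p,-\partial_x p)$ denote the Hamilton vector field of a function $p$. Let $\kappa$ be a smooth canonical transformation from a neighborhood of $0$ in $\mathbf R^{2n}$ to a neighborhood of $0$, with $\kappa(0)=0$, and assume that $A=d\kappa(0)$ has no negative eigenvalues. Let the distinct eigenvalues of $A$ (on $\mathbf C^{2n}$) be $1$ (possibly with multiplicity $0$) and $\lambda_j,\lambda_j^{-1}$, $1\le j\le r$, where the $\lambda_j$ are distinct and $|\lambda_j|>1$, or $|\lambda_j|=1$ and $0<\arg\lambda_j<\pi$. Choose $\mu_j\in\mathbf C$ with $e^{\mu_j}=\lambda_j$ such that $\mu_i=\overline{\mu_j}$ whenever $\lambda_i=\overline{\lambda_j}$, and assume that for all $k_1,\dots,k_r\in\mathbf Z$ $$\sum_j k_j\mu_j\in 2\pi i\,\mathbf Z\ \Longrightarrow\ \sum_j k_j\mu_j=0 .\tag{1.32}$$ Then there is exactly one real $2n\times 2n$ matrix $B=\log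 A$ which, on the generalized eigenspace of $A$ for each eigenvalue $\lambda$, where $A=\lambda+N$ with $N$ nilpotent, acts as $\mu(\lambda)+\sum_{k\ge1}\frac{(-1)^{k+1}}{k}(\lambda^{-1}N)^k$, where $\mu(1)=0$, $\mu(\lambda_j)=\mu_j$ and $\mu(\lambda_j^{-1})=-\mu_j$. Put $p_0(\rho)=\tfrac12\sigma(\rho,B\rho)$. Then there is a real-valued $C^\infty$ function $p$ on a neighborhood of $0$ in $\mathbf R^{2n}$ such that, as $\rho\to0$, $p(\rho)=p_0(\rho)+\mathcal O(\rho^3)$ and $$\kappa(\rho)=\exp H_p(\rho)+\mathcal O(\rho^\infty),$$ where $\exp H_p$ is the time-one map of the flow of $H_p$, defined near $0$. Moreover, for this $p_0$, $p$ is unique modulo $\mathcal O(\rho^\infty)$: if $p$ and $\widetilde p$ both have these properties, then $p-\widetilde p=\mathcal O(\rho^\infty)$. -/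

import Mathlib

open scoped ContDiff Topology

namespace LewisSternberg

/-- The phase space `ℝ^{2n}`, with points `ρ = (x, ξ)`; the coordinate `x_j` is `ρ (Sum.inl j)` and
`ξ_j` is `ρ (Sum.inr j)`. (It carries the sup norm; all norms on it are equivalent.) -/
abbrev PhaseSpace (n : ℕ) : Type := Fin n ⊕ Fin n → ℝ

/-- The standard symplectic form `σ = ∑ dξ_j ∧ dx_j`. -/
def sympForm {n : ℕ} (u v : PhaseSpace n) : ℝ :=
  ∑ j : Fin n, (u (Sum.inr j) * v (Sum.inl j) - u (Sum.inl j) * v (Sum.inr j))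

/-- The Hamilton vector field `H_p = (∂p/∂ξ, -∂p/∂x)`, that is, `dp(t) = σ(t, H_p)`. -/
noncomputable def hamiltonField {n : ℕ} (p : PhaseSpace n → ℝ) (ρ : PhaseSpace n) : PhaseSpace n :=
  Sum.elim
    (fun j => fderiv ℝ p ρ (Pi.single (Sum.inr j) 1))
    (fun j => -fderiv ℝ p ρ (Pi.single (Sum.inl j) 1))

/-- `f = O(ρ^∞)` as `ρ → 0`. -/
def VanishesToInfiniteOrder {n : ℕ} {F : Type*} [NormedAddCommGroup F]
    (f : PhaseSpace n → F) : Prop :=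
  ∀ N : ℕ, f =O[𝓝 0] (fun ρ => ‖ρ‖ ^ N)

/-- `κ` is (the germ at `0` of) a smooth canonical transformation fixing `0`: on some open
neighbourhood of `0` it is smooth and its differential preserves the symplectic form. -/
def IsCanonicalGerm {n : ℕ} (κ : PhaseSpace n → PhaseSpace n) : Prop :=
  κ 0 = 0 ∧ ∃ U : Set (PhaseSpace n), IsOpen U ∧ 0 ∈ U ∧ ContDiffOn ℝ ∞ κ U ∧
    ∀ ρ ∈ U, ∀ u v : PhaseSpace n, sympForm (fderiv ℝ κ ρ u) (fderiv ℝ κ ρ v) = sympForm u v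

/-- `Φ` represents the germ at `0` of `exp H_p`, the time-one map of the Hamilton flow of a
function `p` on the open set `U`: for `ρ` close to `0`, there is an integral curve
`γ : [0, 1] → U` of `H_p` from `ρ` to `Φ ρ`. -/
def IsExpHamilton {n : ℕ} (p : PhaseSpace n → ℝ) (U : Set (PhaseSpace n))
    (Φ : PhaseSpace n → PhaseSpace n) : Prop :=
  ∀ᶠ ρ in 𝓝 (0 : PhaseSpace n), ∃ γ : ℝ → PhaseSpace n, γ 0 = ρ ∧ γ 1 = Φ ρ ∧
    ∀ t ∈ Set.Icc (0 : ℝ) 1, γ t ∈ U ∧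
      HasDerivWithinAt γ (hamiltonField p (γ t)) (Set.Icc 0 1) t

/-- The matrix of the differential `dκ(0)`. -/
noncomputable def linearization {n : ℕ} (κ : PhaseSpace n → PhaseSpace n) :
    Matrix (Fin n ⊕ Fin n) (Fin n ⊕ Fin n) ℝ :=
  LinearMap.toMatrix' (fderiv ℝ κ 0 : PhaseSpace n →ₗ[ℝ] PhaseSpace n)

/-- The action of a real `2n × 2n` matrix on `ℂ^{2n}`. -/
noncomputable def complexAction {n : ℕ} (A : Matrix (Fin n ⊕ Fin n) (Fin n ⊕ Fin n) ℝ) :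
    Module.End ℂ (Fin n ⊕ Fin n → ℂ) :=
  Matrix.toLin' (A.map (fun a => (a : ℂ)))

/-- On the generalized eigenspace `E_z` of `A`, where `A = z + N` with `N` nilpotent, `B` equals
`m + log (1 + z⁻¹ N)`, where `log (1 + M) = M - M² / 2 + M³ / 3 - …`. The sum is finite, since
`N ^ (2n) = 0` on `E_z`. -/
def IsLogOnEigenspace {n : ℕ} (A B : Matrix (Fin n ⊕ Fin n) (Fin n ⊕ Fin n) ℝ) (z m : ℂ) : Prop :=
  ∀ v ∈ (complexAction A).maxGenEigenspace z,
    complexAction B v = m • v +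
      ∑ k ∈ Finset.Icc 1 (2 * n), ((-1 : ℂ) ^ (k + 1) / (k : ℂ)) •
        ((z⁻¹ • (complexAction A - algebraMap ℂ _ z)) ^ k) v

/-- `B = log A`, where `A` has the distinct eigenvalues `1` (possibly absent) and `lam j`,
`(lam j)⁻¹`, and where the logarithms of these are chosen to be `0`, `μ j` and `- μ j`. -/
def IsLogarithm {n r : ℕ} (A : Matrix (Fin n ⊕ Fin n) (Fin n ⊕ Fin n) ℝ) (lam μ : Fin r → ℂ)
    (B : Matrix (Fin n ⊕ Fin n) (Fin n ⊕ Fin n) ℝ) : Prop :=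
  IsLogOnEigenspace A B 1 0 ∧
    ∀ j, IsLogOnEigenspace A B (lam j) (μ j) ∧ IsLogOnEigenspace A B (lam j)⁻¹ (-μ j)

/-- The quadratic form `b(ρ) = ½ σ(ρ, Bρ)`. -/
noncomputable def quadForm {n : ℕ} (B : Matrix (Fin n ⊕ Fin n) (Fin n ⊕ Fin n) ℝ)
    (ρ : PhaseSpace n) : ℝ :=
  (1 / 2) * sympForm ρ (B.mulVec ρ)

/-- `p` is a smooth real-valued function near `0` with `p = p₀ + O(ρ³)` and
`κ = exp H_p + O(ρ^∞)`. -/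
def IsHamiltonianLog {n : ℕ} (κ : PhaseSpace n → PhaseSpace n) (p₀ p : PhaseSpace n → ℝ) : Prop :=
  ∃ U : Set (PhaseSpace n), IsOpen U ∧ 0 ∈ U ∧ ContDiffOn ℝ ∞ p U ∧
    (fun ρ => p ρ - p₀ ρ) =O[𝓝 0] (fun ρ => ‖ρ‖ ^ 3) ∧
    ∃ Φ : PhaseSpace n → PhaseSpace n, IsExpHamilton p U Φ ∧
      VanishesToInfiniteOrder (fun ρ => κ ρ - Φ ρ)

end LewisSternberg

/-!
The theorem is reduced to a formal problem about Taylor series, which is solved degree by degree.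

*The linear part.* On the generalized eigenspace of `A` for `z`, the matrix `B` is a polynomial in
`A`, so by the Chinese remainder theorem `B` is globally a polynomial in `A`; it is real because the
logarithms of conjugate eigenvalues are conjugate (`exists_isLogarithm`). Its flow `e ^ (t B)` is
`A` at time one (`flow_one_eq`).

*Absence of resonances.* All eigenvalues of `B` lie in the group `Γ` generated by the `μ j`, and the
arithmetic condition says that `0` is the only element of `Γ` in `2 π i ℤ`. If all the eigenvalues
of a real operator `T` lie in `Γ`, then a solution of `u' = T u` with `u 1 = u 0` satisfies `T (u 0)
= 0` (`map_eq_zero_of_periodic`). For the curve `e ^ (t Bᵀ) J e ^ (t B)` this shows that `B` is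
infinitesimally symplectic (`transpose_mul_add_mul_eq_zero`), that is, that `p₀` has the linear
Hamilton field `B`. The derivation `{p₀, ·}` acts on homogeneous polynomials of a given degree with
eigenvalues in `Γ`, hence `s ↦ ∫ e ^ (t {p₀, ·}) s dt` over `[0, 1]` is bijective there
(`exists_bijective_poisson_integral`).

*The formal problem.* The formal flow of a polynomial `p` modulo terms of order `N` is a curve of
polynomials (`IsJetFlow`), which preserves the Poisson bracket. Adding to `p` a homogeneous
polynomial `s` of degree `m + 1` changes the components of the time-one map, in order `m`, by the
brackets of `∫ e ^ (t {p₀, ·}) s dt` with the components of `A` (`IsJetFlow.variation`). If `p`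
generates `κ` modulo order `m`, the error of order `m` consists of such brackets, because `κ` is
canonical; so exactly one `s` removes it (`GeneratesJet.exists_succ`, `GeneratesJet.sub_mem`).

*The analytic problem.* The jets of the time-one map of the flow of a smooth `p` are given by the
formal flow of its Taylor polynomials (`IsExpHamilton.isBigO_sub_eval`). Hence uniqueness is formal,
and for existence it is enough to realize the formal solution by a smooth function, with Borel's
theorem (`exists_smooth_of_homogeneous`).
-/

/-! ### Polynomials filtered by their order of vanishing at the origin -/

namespace LewisSternberg

open MvPolynomial

section Order

variable {ι : Type*}

/-- The polynomials all of whose monomials have degree at least `N`: those that vanish to order `N`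
at the origin. -/
noncomputable abbrev vanishingIdeal (ι : Type*) (N : ℕ) : Ideal (MvPolynomial ι ℝ) :=
  idealOfVars ι ℝ ^ N

theorem mem_vanishingIdeal_iff {N : ℕ} {f : MvPolynomial ι ℝ} :
    f ∈ vanishingIdeal ι N ↔ ∀ m : ι →₀ ℕ, m.degree < N → coeff m f = 0 :=
  mem_pow_idealOfVars_iff' N f

theorem vanishingIdeal_mono {M N : ℕ} (h : M ≤ N) : vanishingIdeal ι N ≤ vanishingIdeal ι M :=
  Ideal.pow_le_pow_right h

theorem mem_vanishingIdeal_zero (f : MvPolynomial ι ℝ) : f ∈ vanishingIdeal ι 0 := by simp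

theorem mul_mem_vanishingIdeal {a b : ℕ} {f g : MvPolynomial ι ℝ} (hf : f ∈ vanishingIdeal ι a)
    (hg : g ∈ vanishingIdeal ι b) : f * g ∈ vanishingIdeal ι (a + b) := by
  rw [vanishingIdeal, pow_add]; exact Ideal.mul_mem_mul hf hg

theorem X_mem_vanishingIdeal (i : ι) : (X i : MvPolynomial ι ℝ) ∈ vanishingIdeal ι 1 := by
  rw [vanishingIdeal, pow_one]; exact Ideal.subset_span ⟨i, rfl⟩

theorem _root_.MvPolynomial.IsHomogeneous.mem_vanishingIdeal {d : ℕ} {f : MvPolynomial ι ℝ}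
    (hf : f.IsHomogeneous d) : f ∈ vanishingIdeal ι d :=
  mem_vanishingIdeal_iff.2 fun _ hm => hf.coeff_eq_zero hm.ne

theorem _root_.MvPolynomial.IsHomogeneous.eq_zero_of_mem {d N : ℕ} {f : MvPolynomial ι ℝ}
    (hf : f.IsHomogeneous d) (h : f ∈ vanishingIdeal ι N) (hN : d < N) : f = 0 := by
  ext m
  by_cases hm : m.degree = d
  · simpa using mem_vanishingIdeal_iff.1 h m (by omega)
  · simpa using hf.coeff_eq_zero hm

theorem sub_homogeneousComponent_mem {N : ℕ} {f : MvPolynomial ι ℝ}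
    (hf : f ∈ vanishingIdeal ι N) : f - homogeneousComponent N f ∈ vanishingIdeal ι (N + 1) := by
  refine mem_vanishingIdeal_iff.2 fun m hm => ?_
  rw [coeff_sub, coeff_homogeneousComponent]
  split_ifs with h
  · simp
  · rw [mem_vanishingIdeal_iff.1 hf m (by omega), sub_zero]

theorem pderiv_mem_vanishingIdeal {N : ℕ} {f : MvPolynomial ι ℝ}
    (hf : f ∈ vanishingIdeal ι N) (i : ι) : pderiv i f ∈ vanishingIdeal ι (N - 1) := by
  classical
  refine mem_vanishingIdeal_iff.2 fun m hm => ?_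
  rw [coeff_pderiv, mem_vanishingIdeal_iff.1 hf _ (by simp; omega), zero_mul]

/-- The Taylor polynomial of `f` at the origin of degree less than `N`. -/
noncomputable def trunc (N : ℕ) : MvPolynomial ι ℝ →ₗ[ℝ] MvPolynomial ι ℝ :=
  ∑ d ∈ Finset.range N, homogeneousComponent d

theorem coeff_trunc (N : ℕ) (f : MvPolynomial ι ℝ) (m : ι →₀ ℕ) :
    coeff m (trunc N f) = if m.degree < N then coeff m f else 0 := by
  simp [trunc, LinearMap.sum_apply, coeff_sum, coeff_homogeneousComponent]

theorem sub_trunc_mem (N : ℕ) (f : MvPolynomial ι ℝ) : f - trunc N f ∈ vanishingIdeal ι N := by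
  refine mem_vanishingIdeal_iff.2 fun m hm => ?_
  rw [coeff_sub, coeff_trunc, if_pos hm, sub_self]

theorem trunc_sub_mem (N : ℕ) (f : MvPolynomial ι ℝ) : trunc N f - f ∈ vanishingIdeal ι N := by
  rw [← Ideal.neg_mem_iff, neg_sub]; exact sub_trunc_mem N f

theorem trunc_eq_zero_iff {N : ℕ} {f : MvPolynomial ι ℝ} :
    trunc N f = 0 ↔ f ∈ vanishingIdeal ι N := by
  rw [mem_vanishingIdeal_iff, MvPolynomial.ext_iff]
  refine forall_congr' fun m => ?_
  rw [coeff_trunc]; split_ifs with h <;> simp [h]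

theorem trunc_mem_restrictTotalDegree (N : ℕ) (f : MvPolynomial ι ℝ) :
    trunc N f ∈ restrictTotalDegree ι ℝ N := by
  rw [mem_restrictTotalDegree, trunc, LinearMap.sum_apply]
  exact totalDegree_finsetSum_le fun d hd =>
    (homogeneousComponent_isHomogeneous d f).totalDegree_le.trans (Finset.mem_range.1 hd).le

end Order

/-! ### Curves of polynomials -/

section Curves

variable {ι : Type*}

/-- Each coefficient of the curve of polynomials `g` is differentiable, and `g'` is the curve of
polynomials formed by the derivatives. -/
def HasPolyDeriv (g g' : ℝ → MvPolynomial ι ℝ) : Prop :=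
  ∀ (m : ι →₀ ℕ) (t : ℝ), HasDerivAt (fun s => coeff m (g s)) (coeff m (g' t)) t

theorem HasPolyDeriv.const (f : MvPolynomial ι ℝ) : HasPolyDeriv (fun _ => f) (fun _ => 0) :=
  fun m t => by simpa using hasDerivAt_const t (coeff m f)

theorem HasPolyDeriv.sub {f f' g g' : ℝ → MvPolynomial ι ℝ} (hf : HasPolyDeriv f f')
    (hg : HasPolyDeriv g g') : HasPolyDeriv (fun t => f t - g t) (fun t => f' t - g' t) :=
  fun m t => by simpa using (hf m t).fun_sub (hg m t)

theorem HasPolyDeriv.sum {κ : Type*} {s : Finset κ} {f f' : κ → ℝ → MvPolynomial ι ℝ}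
    (h : ∀ k ∈ s, HasPolyDeriv (f k) (f' k)) :
    HasPolyDeriv (fun t => ∑ k ∈ s, f k t) (fun t => ∑ k ∈ s, f' k t) :=
  fun m t => by
    simpa only [coeff_sum] using HasDerivAt.fun_sum fun k hk => h k hk m t

theorem HasPolyDeriv.mul {f f' g g' : ℝ → MvPolynomial ι ℝ} (hf : HasPolyDeriv f f')
    (hg : HasPolyDeriv g g') :
    HasPolyDeriv (fun t => f t * g t) (fun t => f' t * g t + f t * g' t) := fun m t => by
  classical
  simp only [coeff_mul, coeff_add, ← Finset.sum_add_distrib]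
  exact HasDerivAt.fun_sum fun x _ => (hf x.1 t).mul (hg x.2 t)

theorem HasPolyDeriv.pderiv {f f' : ℝ → MvPolynomial ι ℝ} (hf : HasPolyDeriv f f') (i : ι) :
    HasPolyDeriv (fun t => MvPolynomial.pderiv i (f t)) (fun t => MvPolynomial.pderiv i (f' t)) :=
  fun m t => by
    classical
    simp only [coeff_pderiv]
    exact (hf _ t).mul_const _

theorem HasPolyDeriv.trunc {f f' : ℝ → MvPolynomial ι ℝ} (hf : HasPolyDeriv f f') (N : ℕ) :
    HasPolyDeriv (fun t => LewisSternberg.trunc N (f t)) (fun t => LewisSternberg.trunc N (f' t)) :=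
  fun m t => by
    simp only [coeff_trunc]
    split_ifs
    · exact hf m t
    · exact hasDerivAt_const _ _

theorem HasPolyDeriv.smul_const {c c' : ℝ → ℝ} (hc : ∀ t, HasDerivAt c (c' t) t)
    (f : MvPolynomial ι ℝ) : HasPolyDeriv (fun t => c t • f) (fun t => c' t • f) := fun m t => by
  simpa using (hc t).mul_const (coeff m f)

end Curves

/-! ### The Poisson bracket on polynomials -/

section Poisson

variable {n : ℕ}

/-- The polynomial functions on phase space. -/
abbrev PhasePoly (n : ℕ) : Type := MvPolynomial (Fin n ⊕ Fin n) ℝ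

/-- The derivation `{p, ·}`, where
`{p, f} = ∑ (∂p/∂ξ_j ∂f/∂x_j - ∂p/∂x_j ∂f/∂ξ_j)`: the Hamilton vector field of `p`, as a
derivation. -/
noncomputable def poisson (p : PhasePoly n) : Derivation ℝ (PhasePoly n) (PhasePoly n) :=
  ∑ j : Fin n, (pderiv (Sum.inr j) p • pderiv (Sum.inl j) -
    pderiv (Sum.inl j) p • pderiv (Sum.inr j))

theorem poisson_apply (p f : PhasePoly n) : poisson p f =
    ∑ j : Fin n, (pderiv (Sum.inr j) p * pderiv (Sum.inl j) f -
      pderiv (Sum.inl j) p * pderiv (Sum.inr j) f) := by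
  have h := map_sum (Derivation.coeFnAddMonoidHom : Derivation ℝ (PhasePoly n) (PhasePoly n) →+ _)
    (fun j : Fin n => pderiv (Sum.inr j) p • pderiv (Sum.inl j) -
      pderiv (Sum.inl j) p • pderiv (Sum.inr j)) Finset.univ
  exact (congrFun h f).trans (Finset.sum_apply _ _ _)

theorem poisson_antisymm (p f : PhasePoly n) : poisson p f = -poisson f p := by
  rw [poisson_apply, poisson_apply, ← Finset.sum_neg_distrib]
  exact Finset.sum_congr rfl fun j _ => by ring

theorem poisson_add_left (p q f : PhasePoly n) :
    poisson (p + q) f = poisson p f + poisson q f := by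
  rw [poisson_antisymm, map_add, neg_add, ← poisson_antisymm, ← poisson_antisymm]

theorem poisson_sub_left (p q f : PhasePoly n) :
    poisson (p - q) f = poisson p f - poisson q f := by
  rw [poisson_antisymm, map_sub, neg_sub', ← poisson_antisymm, ← poisson_antisymm]

theorem poisson_smul_left (c : ℝ) (p f : PhasePoly n) :
    poisson (c • p) f = c • poisson p f := by
  rw [poisson_antisymm, Derivation.map_smul, ← smul_neg, ← poisson_antisymm]

theorem poisson_sum_left {κ : Type*} (s : Finset κ) (p : κ → PhasePoly n) (f : PhasePoly n) :
    poisson (∑ k ∈ s, p k) f = ∑ k ∈ s, poisson (p k) f := by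
  rw [poisson_antisymm, map_sum, ← Finset.sum_neg_distrib]
  exact Finset.sum_congr rfl fun k _ => (poisson_antisymm _ _).symm

theorem poisson_X_inl (p : PhasePoly n) (j : Fin n) :
    poisson p (X (Sum.inl j)) = pderiv (Sum.inr j) p := by
  simp [poisson_apply, pderiv_X, Pi.single_apply]

theorem poisson_X_inr (p : PhasePoly n) (j : Fin n) :
    poisson p (X (Sum.inr j)) = -pderiv (Sum.inl j) p := by
  simp [poisson_apply, pderiv_X, Pi.single_apply]

theorem pderiv_comm {ι : Type*} (i j : ι) (f : MvPolynomial ι ℝ) :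
    pderiv i (pderiv j f) = pderiv j (pderiv i f) := by
  classical
  have h : ⁅(pderiv i : Derivation ℝ (MvPolynomial ι ℝ) (MvPolynomial ι ℝ)),
      (pderiv j : Derivation ℝ (MvPolynomial ι ℝ) (MvPolynomial ι ℝ))⁆ = 0 := by
    refine derivation_ext fun k => ?_
    simp only [Derivation.commutator_apply, pderiv_X, Pi.single_apply, Derivation.coe_zero,
      Pi.zero_apply]
    split_ifs <;> simp
  have := congrArg (fun D : Derivation ℝ _ _ => D f) h
  simpa [Derivation.commutator_apply, sub_eq_zero] using this

theorem pderiv_poisson (i : Fin n ⊕ Fin n) (p f : PhasePoly n) :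
    pderiv i (poisson p f) = poisson (pderiv i p) f + poisson p (pderiv i f) := by
  simp only [poisson_apply, map_sum, map_sub, pderiv_mul, ← Finset.sum_add_distrib]
  refine Finset.sum_congr rfl fun j _ => ?_
  simp only [pderiv_comm i]; ring

/-- The Jacobi identity, in the form: `{p, ·}` is a derivation of the Poisson bracket. -/
theorem poisson_jacobi (p f g : PhasePoly n) :
    poisson p (poisson f g) = poisson (poisson p f) g + poisson f (poisson p g) := by
  have h : ⁅poisson p, poisson f⁆ = poisson (poisson p f) := by
    refine derivation_ext fun k => ?_
    rw [Derivation.commutator_apply]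
    rcases k with k | k
    · simp only [poisson_X_inl, pderiv_poisson]
      rw [poisson_antisymm f (pderiv _ p)]; ring
    · simp only [poisson_X_inr, pderiv_poisson, map_neg]
      rw [poisson_antisymm f (pderiv _ p)]; ring
  rw [← h, Derivation.commutator_apply]; ring

theorem poisson_mem_vanishingIdeal {a b c : ℕ} {f g : PhasePoly n}
    (hf : f ∈ vanishingIdeal _ a) (hg : g ∈ vanishingIdeal _ b) (h : c + 2 ≤ a + b) :
    poisson f g ∈ vanishingIdeal _ c := by
  rw [poisson_apply]
  have key : ∀ i j : Fin n ⊕ Fin n,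
      pderiv i f * pderiv j g ∈ vanishingIdeal (Fin n ⊕ Fin n) c := fun i j =>
    vanishingIdeal_mono (by omega)
      (mul_mem_vanishingIdeal (pderiv_mem_vanishingIdeal hf i) (pderiv_mem_vanishingIdeal hg j))
  exact Ideal.sum_mem _ fun j _ => Ideal.sub_mem _ (key _ _) (key _ _)

theorem poisson_isHomogeneous {a b : ℕ} {f g : PhasePoly n} (hf : f.IsHomogeneous (a + 1))
    (hg : g.IsHomogeneous (b + 1)) : (poisson f g).IsHomogeneous (a + b) := by
  rw [poisson_apply]
  exact IsHomogeneous.sum _ _ _ fun j _ =>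
    (IsHomogeneous.mul (hf.pderiv) (hg.pderiv)).sub (IsHomogeneous.mul (hf.pderiv) (hg.pderiv))

theorem HasPolyDeriv.poisson {f f' g g' : ℝ → PhasePoly n} (hf : HasPolyDeriv f f')
    (hg : HasPolyDeriv g g') :
    HasPolyDeriv (fun t => LewisSternberg.poisson (f t) (g t))
      (fun t => LewisSternberg.poisson (f' t) (g t) + LewisSternberg.poisson (f t) (g' t)) := by
  simp only [poisson_apply, ← Finset.sum_add_distrib]
  refine HasPolyDeriv.sum fun j _ => ?_
  have := ((hf.pderiv (Sum.inr j)).mul (hg.pderiv (Sum.inl j))).sub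
    ((hf.pderiv (Sum.inl j)).mul (hg.pderiv (Sum.inr j)))
  convert this using 2
  ring

end Poisson

end LewisSternberg

/-! ### Linear differential equations and resonances -/

namespace LewisSternberg

theorem linear_ode_eq_zero {E : Type*} [NormedAddCommGroup E] [NormedSpace ℝ E] (T : E →L[ℝ] E)
    {u : ℝ → E} (hu : ∀ t, HasDerivAt u (T (u t)) t) (h0 : u 0 = 0) (t : ℝ) : u t = 0 := by
  have h := ODE_solution_unique_univ (v := fun _ => T) (s := fun _ => Set.univ) (K := ‖T‖₊)
    (g := fun _ => 0) (t₀ := 0) (fun t => T.lipschitz.lipschitzOnWith)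
    (fun t => ⟨hu t, trivial⟩) (fun t => ⟨by simpa using hasDerivAt_const t (0 : E), trivial⟩) h0
  exact congrFun h t

section GenEigenspaces

variable {V : Type*} [AddCommGroup V] [Module ℂ V]

theorem eq_top_of_maxGenEigenspace_le [FiniteDimensional ℂ V] {f : Module.End ℂ V}
    {S : Submodule ℂ V} (h : ∀ γ, f.HasEigenvalue γ → f.maxGenEigenspace γ ≤ S) : S = ⊤ := by
  rw [eq_top_iff, ← Module.End.iSup_maxGenEigenspace_eq_top f]
  refine iSup_le fun γ => ?_
  by_cases hγ : f.HasEigenvalue γ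
  · exact h γ hγ
  · have h' : f.maxGenEigenspace γ = ⊥ := by
      by_contra hne
      exact hγ ((Module.End.hasUnifEigenvalue_iff_hasUnifEigenvalue_one (k := ⊤) (by simp)).1 hne)
    simp [h']

theorem mem_of_iSup_maxGenEigenspace_eq_top {f : Module.End ℂ V} {Γ : Set ℂ}
    (h : ⨆ γ : Γ, f.maxGenEigenspace γ = ⊤) {γ : ℂ} {v : V}
    (hv : v ∈ f.maxGenEigenspace γ) (hv0 : v ≠ 0) : γ ∈ Γ := by
  by_contra hγ
  have hdis := (Module.End.independent_maxGenEigenspace f) γ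
  have hle : ⨆ γ : Γ, f.maxGenEigenspace γ ≤ ⨆ j, ⨆ (_ : j ≠ γ), f.maxGenEigenspace j :=
    iSup_le fun a => le_iSup₂_of_le (a : ℂ) (fun h => hγ (h ▸ a.2)) le_rfl
  exact hv0 (Submodule.disjoint_def.1 hdis v hv (hle (h ▸ Submodule.mem_top)))

end GenEigenspaces

section Weak

variable {V : Type*} [AddCommGroup V] [Module ℝ V]

/-- The curve `u` in the vector space `V`, which carries no topology, has derivative `u'` when
tested against linear functionals. -/
def HasWeakDeriv (u u' : ℝ → V) : Prop :=
  ∀ (φ : V →ₗ[ℝ] ℝ) (t : ℝ), HasDerivAt (fun s => φ (u s)) (φ (u' t)) t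

theorem HasWeakDeriv.map {W : Type*} [AddCommGroup W] [Module ℝ W] {u u' : ℝ → V}
    (h : HasWeakDeriv u u') (T : V →ₗ[ℝ] W) :
    HasWeakDeriv (fun t => T (u t)) (fun t => T (u' t)) :=
  fun φ t => h (φ ∘ₗ T) t

theorem HasWeakDeriv.sub {u u' v v' : ℝ → V} (hu : HasWeakDeriv u u') (hv : HasWeakDeriv v v') :
    HasWeakDeriv (fun t => u t - v t) (fun t => u' t - v' t) := fun φ t => by
  simpa only [map_sub] using (hu φ t).fun_sub (hv φ t)

theorem HasWeakDeriv.add {u u' v v' : ℝ → V} (hu : HasWeakDeriv u u') (hv : HasWeakDeriv v v') :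
    HasWeakDeriv (fun t => u t + v t) (fun t => u' t + v' t) := fun φ t => by
  simpa only [map_add] using (hu φ t).fun_add (hv φ t)

theorem HasWeakDeriv.smul_const {c c' : ℝ → ℝ} (hc : ∀ t, HasDerivAt c (c' t) t) (x : V) :
    HasWeakDeriv (fun t => c t • x) (fun t => c' t • x) := fun φ t => by
  simpa using (hc t).mul_const (φ x)

/-- A complex eigenvector `x + i y` of a real operator spans a plane in which the flow is
explicit. -/
theorem hasWeakDeriv_of_eigenpair {T : V →ₗ[ℝ] V} {a b : ℝ} {x y : V}
    (hx : T x = a • x - b • y) (hy : T y = b • x + a • y) :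
    HasWeakDeriv (fun t => (Real.exp (a * t) * Real.cos (b * t)) • x -
        (Real.exp (a * t) * Real.sin (b * t)) • y)
      (fun t => T ((Real.exp (a * t) * Real.cos (b * t)) • x -
        (Real.exp (a * t) * Real.sin (b * t)) • y)) := by
  have hl : ∀ c t : ℝ, HasDerivAt (fun t => c * t) c t := fun c t => by
    simpa using (hasDerivAt_id t).const_mul c
  have h := (HasWeakDeriv.smul_const (fun t => (hl a t).exp.fun_mul (hl b t).cos) x).sub
    (HasWeakDeriv.smul_const (fun t => (hl a t).exp.fun_mul (hl b t).sin) y)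
  convert h using 2 with t
  rw [map_sub, map_smul, map_smul, hx, hy]
  module

variable [Module.Finite ℝ V]

theorem exists_linear_flow (T : V →ₗ[ℝ] V) : ∃ E : ℝ → V →ₗ[ℝ] V, E 0 = LinearMap.id ∧
    ∀ v, HasWeakDeriv (fun t => E t v) (fun t => T (E t v)) := by
  let e := (Module.finBasis ℝ V).equivFun
  let T' : (Fin (Module.finrank ℝ V) → ℝ) →L[ℝ] (Fin (Module.finrank ℝ V) → ℝ) :=
    LinearMap.toContinuousLinearMap (e.toLinearMap ∘ₗ T ∘ₗ e.symm.toLinearMap)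
  refine ⟨fun t => e.symm.toLinearMap ∘ₗ (NormedSpace.exp (t • T')).toLinearMap ∘ₗ e.toLinearMap,
    ?_, fun v φ t => ?_⟩
  · ext v; simp
  · let ψ := LinearMap.toContinuousLinearMap (φ ∘ₗ e.symm.toLinearMap)
    have h := (hasDerivAt_exp_smul_const' (𝕂 := ℝ) T' t).clm_apply (hasDerivAt_const t (e v))
    have h2 := ψ.hasFDerivAt.comp_hasDerivAt t h
    simpa [ψ, T', Function.comp_def] using h2

theorem HasWeakDeriv.eq_zero {T : V →ₗ[ℝ] V} {u : ℝ → V}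
    (hu : HasWeakDeriv u (fun t => T (u t))) (h0 : u 0 = 0) (t : ℝ) : u t = 0 := by
  let e := (Module.finBasis ℝ V).equivFun
  let T' : (Fin (Module.finrank ℝ V) → ℝ) →L[ℝ] (Fin (Module.finrank ℝ V) → ℝ) :=
    LinearMap.toContinuousLinearMap (e.toLinearMap ∘ₗ T ∘ₗ e.symm.toLinearMap)
  have h := linear_ode_eq_zero T' (u := fun t => e (u t)) (fun t => hasDerivAt_pi.2 fun i => by
    simpa [T'] using hu (LinearMap.proj i ∘ₗ e.toLinearMap) t) (by simp [h0]) t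
  simpa using h

theorem HasWeakDeriv.eq_of_eq {T : V →ₗ[ℝ] V} {u v : ℝ → V}
    (hu : HasWeakDeriv u (fun t => T (u t))) (hv : HasWeakDeriv v (fun t => T (v t)))
    (h0 : u 0 = v 0) (t : ℝ) : u t = v t := by
  have h := HasWeakDeriv.eq_zero (T := T) (u := fun t => u t - v t)
    (by simpa only [map_sub] using hu.sub hv) (sub_eq_zero.2 h0) t
  exact sub_eq_zero.1 h

/-- If `e ^ γ = 1` holds for no nonzero complex eigenvalue `γ` of `T`, then the solutions of
`u' = T u` with `u 1 = u 0` are constant. -/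
theorem map_eq_zero_of_periodic {T : V →ₗ[ℝ] V}
    (hT : ∀ (a b : ℝ) (x y : V), (x ≠ 0 ∨ y ≠ 0) → T x = a • x - b • y → T y = b • x + a • y →
      Complex.exp (a + b * Complex.I) = 1 → a = 0 ∧ b = 0)
    {u : ℝ → V} (hu : HasWeakDeriv u (fun t => T (u t))) (h1 : u 1 = u 0) : T (u 0) = 0 := by
  obtain ⟨E, hE0, hE⟩ := exists_linear_flow T
  have huE : ∀ (v : ℝ → V), HasWeakDeriv v (fun t => T (v t)) → ∀ t, v t = E t (v 0) :=
    fun v hv => hv.eq_of_eq (hE (v 0)) (by simp [hE0])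
  let W : Submodule ℝ V := LinearMap.ker (E 1 - LinearMap.id)
  have hWmem : ∀ w, w ∈ W ↔ E 1 w = w := fun w => by simp [W, sub_eq_zero]
  have hW : ∀ w ∈ W, T w ∈ W := fun w hw => by
    rw [hWmem] at hw ⊢
    have h := huE (fun t => T (E t w)) ((hE w).map T) 1
    simp only [hE0, LinearMap.id_apply, hw] at h
    exact h.symm
  let TW : W →ₗ[ℝ] W := T.restrict hW
  -- On the space of fixed vectors of the time-one map, `T` is locally nilpotent, since its only
  -- complex eigenvalue there is zero.
  have hnil : ∀ w : W, ∃ k : ℕ, (TW ^ k) w = 0 := by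
    let b := Module.finBasis ℝ W
    let M := LinearMap.toMatrix b b TW
    let f : Module.End ℂ (Fin (Module.finrank ℝ W) → ℂ) := Matrix.toLin' (M.map Complex.ofReal)
    have hrepr : ∀ c : Fin (Module.finrank ℝ W) → ℝ,
        TW (b.equivFun.symm c) = b.equivFun.symm (M.mulVec c) := fun c => by
      have := LinearMap.toMatrix_mulVec_repr b b TW (b.equivFun.symm c)
      apply b.equivFun.injective
      rw [LinearEquiv.apply_symm_apply, ← Module.Basis.equivFun_apply, LinearEquiv.apply_symm_apply]
        at *
      ext i
      rw [Module.Basis.equivFun_apply, ← this]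
    have heig : ∀ γ : ℂ, f.HasEigenvalue γ → γ = 0 := fun γ hγ => by
      obtain ⟨c, hc⟩ := hγ.exists_hasEigenvector
      have hfc : ∀ i, ∑ j, (M i j : ℂ) * c j = γ * c i := fun i => by
        have := congrFun hc.apply_eq_smul i
        simpa [f, Matrix.mulVec, dotProduct] using this
      let x := b.equivFun.symm (fun j => (c j).re)
      let y := b.equivFun.symm (fun j => (c j).im)
      have hx : TW x = γ.re • x - γ.im • y := by
        rw [hrepr, ← map_smul, ← map_smul, ← map_sub]
        congr 1; ext i
        have := congrArg Complex.re (hfc i)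
        simpa [Matrix.mulVec, dotProduct] using this
      have hy : TW y = γ.im • x + γ.re • y := by
        rw [hrepr, ← map_smul, ← map_smul, ← map_add]
        congr 1; ext i
        have := congrArg Complex.im (hfc i)
        simp [Matrix.mulVec, dotProduct] at this ⊢
        linarith
      have hxV : T (x : V) = γ.re • (x : V) - γ.im • (y : V) := by
        simpa [TW] using congrArg Subtype.val hx
      have hyV : T (y : V) = γ.im • (x : V) + γ.re • (y : V) := by
        simpa [TW] using congrArg Subtype.val hy
      have hne : (x : V) ≠ 0 ∨ (y : V) ≠ 0 := by
        by_contra! h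
        refine hc.2 (funext fun j => Complex.ext ?_ ?_)
        · have : x = 0 := Subtype.ext h.1
          simpa using congrFun (b.equivFun.symm.map_eq_zero_iff.1 this) j
        · have : y = 0 := Subtype.ext h.2
          simpa using congrFun (b.equivFun.symm.map_eq_zero_iff.1 this) j
      have e1 := huE _ (hasWeakDeriv_of_eigenpair hxV hyV) 1
      have e2 := huE _ (hasWeakDeriv_of_eigenpair (a := γ.re) (b := -γ.im) (x := (y : V))
        (y := (x : V)) (by rw [hyV]; module) (by rw [hxV]; module)) 1
      simp only [mul_one, mul_zero, Real.exp_zero, Real.cos_zero, Real.sin_zero, one_smul,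
        zero_smul, sub_zero, Real.cos_neg, Real.sin_neg] at e1 e2
      rw [(hWmem _).1 x.2] at e1
      rw [(hWmem _).1 y.2] at e2
      set p := Real.exp γ.re * Real.cos γ.im with hp
      set q := Real.exp γ.re * Real.sin γ.im with hq
      have hpq : (p - 1) ^ 2 + q ^ 2 = 0 := by
        have k1 : (p - 1) • (x : V) - q • (y : V) = 0 := by
          rw [← sub_eq_zero] at e1; rw [← e1]; module
        have k2 : (p - 1) • (y : V) + q • (x : V) = 0 := by
          rw [← sub_eq_zero] at e2; rw [← e2, hq]; module
        rcases hne with h | h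
        · refine (smul_eq_zero.1 ?_).resolve_right h
          calc ((p - 1) ^ 2 + q ^ 2) • (x : V)
              = (p - 1) • ((p - 1) • (x : V) - q • (y : V)) +
                q • ((p - 1) • (y : V) + q • (x : V)) := by module
            _ = 0 := by rw [k1, k2]; simp
        · refine (smul_eq_zero.1 ?_).resolve_right h
          calc ((p - 1) ^ 2 + q ^ 2) • (y : V)
              = (p - 1) • ((p - 1) • (y : V) + q • (x : V)) -
                q • ((p - 1) • (x : V) - q • (y : V)) := by module
            _ = 0 := by rw [k1, k2]; simp
      have hp1 : p = 1 := by nlinarith [sq_nonneg (p - 1), sq_nonneg q]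
      have hq0 : q = 0 := by nlinarith [sq_nonneg (p - 1), sq_nonneg q]
      have := hT γ.re γ.im x y hne hxV hyV (by
        apply Complex.ext
        · simp [Complex.exp_re, ← hp, hp1]
        · simp [Complex.exp_im, ← hq, hq0])
      exact Complex.ext this.1 this.2
    have htop : f.maxGenEigenspace 0 = ⊤ :=
      eq_top_of_maxGenEigenspace_le fun γ h => by rw [heig γ h]
    intro w
    obtain ⟨k, hk⟩ := (Module.End.mem_maxGenEigenspace f 0 _).1
      (htop ▸ Submodule.mem_top : (fun j => ((b.equivFun w j : ℝ) : ℂ)) ∈ f.maxGenEigenspace 0)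
    refine ⟨k, ?_⟩
    have hpow : ∀ (k : ℕ) (c : Fin (Module.finrank ℝ W) → ℝ),
        (f ^ k) (fun j => (c j : ℂ)) =
          fun j => ((b.equivFun ((TW ^ k) (b.equivFun.symm c)) j : ℝ) : ℂ) := by
      intro k
      induction k with
      | zero => intro c; simp only [pow_zero, Module.End.one_apply, LinearEquiv.apply_symm_apply]
      | succ k ih =>
        intro c
        rw [pow_succ, Module.End.mul_apply, pow_succ, Module.End.mul_apply, hrepr, ← ih]
        congr 1
        ext i
        simp [f, Matrix.mulVec, dotProduct]
    rw [zero_smul, sub_zero, hpow, LinearEquiv.symm_apply_apply] at hk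
    apply b.equivFun.injective
    ext j
    simpa using congrFun hk j
  -- A Jordan block of length two would make the flow grow linearly.
  have hker : ∀ w ∈ W, T (T w) = 0 → T w = 0 := fun w hw h => by
    have := huE (fun t => t • T w + (1 : ℝ) • w) (by
      convert (HasWeakDeriv.smul_const (c := fun t => t) (fun t => hasDerivAt_id' t) (T w)).add
        (HasWeakDeriv.smul_const (fun t => hasDerivAt_const t (1 : ℝ)) w) using 2 with t
      rw [map_add, map_smul, map_smul, h]; simp) 1
    simpa [(hWmem w).1 hw] using this
  have hfin : ∀ k : ℕ, ∀ w : W, (TW ^ k) w = 0 → TW w = 0 := by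
    intro k
    induction k with
    | zero => intro w hw; rw [pow_zero, Module.End.one_apply] at hw; rw [hw, map_zero]
    | succ k ih =>
      intro w hw
      have h := ih (TW w) (by rwa [← Module.End.mul_apply, ← pow_succ])
      exact Subtype.ext (hker w w.2 (congrArg Subtype.val h))
  have hu0 : u 0 ∈ W := by rw [hWmem, ← huE u hu 1, h1]
  obtain ⟨k, hk⟩ := hnil ⟨u 0, hu0⟩
  exact congrArg Subtype.val (hfin k _ hk)

end Weak

end LewisSternberg

/-! ### Formal Hamilton flows -/

namespace LewisSternberg

open MvPolynomial

section Curves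

variable {ι : Type*}

theorem linear_apply_eq_sum [Finite ι] {N : ℕ} {f : MvPolynomial ι ℝ}
    (hf : f ∈ restrictTotalDegree ι ℝ N) (ψ : MvPolynomial ι ℝ →ₗ[ℝ] ℝ) :
    ψ f = ∑ m ∈ (Finsupp.finite_of_degree_le (σ := ι) N).toFinset,
      coeff m f * ψ (monomial m 1) := by
  have h : f.support ⊆ (Finsupp.finite_of_degree_le (σ := ι) N).toFinset := fun m hm => by
    rw [mem_restrictTotalDegree] at hf
    rw [Set.Finite.mem_toFinset]
    exact (le_totalDegree hm).trans hf
  conv_lhs => rw [f.as_sum]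
  rw [map_sum, Finset.sum_subset h]
  · refine Finset.sum_congr rfl fun m _ => ?_
    rw [← smul_eq_mul, ← map_smul, smul_monomial, smul_eq_mul, mul_one]
  · intro m _ hm
    rw [notMem_support_iff.1 hm]; simp

theorem HasPolyDeriv.linear [Finite ι] {N : ℕ} {f f' : ℝ → MvPolynomial ι ℝ}
    (h : HasPolyDeriv f f') (hf : ∀ t, f t ∈ restrictTotalDegree ι ℝ N)
    (hf' : ∀ t, f' t ∈ restrictTotalDegree ι ℝ N) (ψ : MvPolynomial ι ℝ →ₗ[ℝ] ℝ) (t : ℝ) :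
    HasDerivAt (fun s => ψ (f s)) (ψ (f' t)) t := by
  simp only [fun t => linear_apply_eq_sum (hf t), fun t => linear_apply_eq_sum (hf' t)]
  exact HasDerivAt.fun_sum fun m _ => (h m t).mul_const _

/-- Curves in a space of polynomials of bounded degree are differentiable as soon as their
coefficients are. -/
theorem HasPolyDeriv.hasWeakDeriv [Finite ι] {N : ℕ} {V : Submodule ℝ (MvPolynomial ι ℝ)}
    (hV : V ≤ restrictTotalDegree ι ℝ N) {u u' : ℝ → V}
    (h : HasPolyDeriv (fun t => (u t : MvPolynomial ι ℝ)) (fun t => (u' t : MvPolynomial ι ℝ))) :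
    HasWeakDeriv u u' := fun φ t => by
  obtain ⟨ψ, hψ⟩ := LinearMap.exists_extend φ
  subst hψ
  exact h.linear (fun t => hV (u t).2) (fun t => hV (u' t).2) ψ t

theorem HasWeakDeriv.hasPolyDeriv {V : Submodule ℝ (MvPolynomial ι ℝ)} {u u' : ℝ → V}
    (h : HasWeakDeriv u u') :
    HasPolyDeriv (fun t => (u t : MvPolynomial ι ℝ)) (fun t => (u' t : MvPolynomial ι ℝ)) :=
  fun m t => h (lcoeff ℝ m ∘ₗ V.subtype) t

end Curves

section LinForm

variable {ι : Type*} [Fintype ι]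

/-- The linear form `∑ c k x_k`. -/
noncomputable def linForm (c : ι → ℝ) : MvPolynomial ι ℝ := ∑ k, c k • X k

theorem linForm_isHomogeneous (c : ι → ℝ) : (linForm c).IsHomogeneous 1 :=
  IsHomogeneous.sum _ _ _ fun k _ => by
    rw [MvPolynomial.smul_eq_C_mul]; exact isHomogeneous_C_mul_X _ _

theorem linForm_single [DecidableEq ι] (i : ι) : linForm (Pi.single i 1) = X i := by
  simp [linForm, Pi.single_apply]

theorem HasPolyDeriv.linForm {c c' : ℝ → ι → ℝ} (h : ∀ k t, HasDerivAt (fun t => c t k) (c' t k) t) :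
    HasPolyDeriv (fun t => linForm (c t)) (fun t => linForm (c' t)) :=
  HasPolyDeriv.sum fun k _ => HasPolyDeriv.smul_const (h k) _

end LinForm

section JetFlow

variable {n : ℕ}

/-- `F` is the curve `e ^ (t {p, ·}) f` in the space of polynomials modulo those that vanish to
order `N` at the origin; the curve is represented by polynomials of bounded degree. -/
structure IsJetFlow (p : PhasePoly n) (N : ℕ) (f : PhasePoly n) (F : ℝ → PhasePoly n) : Prop where
  init : F 0 = f
  bounded : ∃ D, ∀ t, F t ∈ restrictTotalDegree (Fin n ⊕ Fin n) ℝ D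
  deriv : HasPolyDeriv F (fun t => trunc N (poisson p (F t)))

theorem exists_isJetFlow (p : PhasePoly n) (N : ℕ) (f : PhasePoly n) :
    ∃ F, IsJetFlow p N f F := by
  set D := max N f.totalDegree with hD
  let V := restrictTotalDegree (Fin n ⊕ Fin n) ℝ D
  have hle : restrictTotalDegree (Fin n ⊕ Fin n) ℝ N ≤ V := fun g hg => by
    rw [mem_restrictTotalDegree] at hg ⊢
    exact hg.trans (le_max_left _ _)
  let T : V →ₗ[ℝ] V := LinearMap.codRestrict V
    (trunc N ∘ₗ (poisson p : PhasePoly n →ₗ[ℝ] PhasePoly n) ∘ₗ V.subtype)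
    fun v => hle (trunc_mem_restrictTotalDegree N _)
  obtain ⟨E, hE0, hE⟩ := exists_linear_flow T
  let v : V := ⟨f, by rw [mem_restrictTotalDegree]; exact le_max_right _ _⟩
  refine ⟨fun t => (E t v : PhasePoly n), by simp [hE0, v], ⟨D, fun t => (E t v).2⟩, ?_⟩
  exact (hE v).hasPolyDeriv

/-- Uniqueness for the linear equation `D' = {p, D}` modulo polynomials vanishing to order `N`. -/
theorem mem_vanishingIdeal_of_hasPolyDeriv {p : PhasePoly n} (hp : p ∈ vanishingIdeal _ 2) {N : ℕ}
    {D D' : ℝ → PhasePoly n} (hD : HasPolyDeriv D D')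
    (h : ∀ t, D' t - poisson p (D t) ∈ vanishingIdeal _ N) (h0 : D 0 ∈ vanishingIdeal _ N) (t : ℝ) :
    D t ∈ vanishingIdeal _ N := by
  let V := restrictTotalDegree (Fin n ⊕ Fin n) ℝ N
  let T : V →ₗ[ℝ] V := LinearMap.codRestrict V
    (trunc N ∘ₗ (poisson p : PhasePoly n →ₗ[ℝ] PhasePoly n) ∘ₗ V.subtype)
    fun v => trunc_mem_restrictTotalDegree N _
  let u : ℝ → V := fun t => ⟨trunc N (D t), trunc_mem_restrictTotalDegree N _⟩
  have hT : ∀ t, (T (u t) : PhasePoly n) = trunc N (D' t) := fun t => by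
    change trunc N (poisson p (trunc N (D t))) = _
    rw [← sub_eq_zero, ← map_sub, trunc_eq_zero_iff]
    have h1 : poisson p (D t - trunc N (D t)) ∈ vanishingIdeal _ N :=
      poisson_mem_vanishingIdeal hp (sub_trunc_mem N (D t)) (by omega)
    have := Ideal.neg_mem_iff _ |>.2 (Ideal.add_mem _ (h t) h1)
    rw [map_sub] at this
    convert this using 1
    ring
  have hu : HasWeakDeriv u (fun t => T (u t)) := by
    refine HasPolyDeriv.hasWeakDeriv (N := N) le_rfl ?_
    simp only [hT]
    exact hD.trunc N
  have := hu.eq_zero (Subtype.ext (trunc_eq_zero_iff.2 h0)) t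
  exact trunc_eq_zero_iff.1 (congrArg Subtype.val this)

theorem IsJetFlow.mem_vanishingIdeal_one {p : PhasePoly n} (hp : p ∈ vanishingIdeal _ 2) {N : ℕ}
    (hN : 1 ≤ N) {i : Fin n ⊕ Fin n} {F : ℝ → PhasePoly n} (h : IsJetFlow p N (X i) F) (t : ℝ) :
    F t ∈ vanishingIdeal _ 1 :=
  mem_vanishingIdeal_of_hasPolyDeriv hp h.deriv
    (fun t => vanishingIdeal_mono hN (trunc_sub_mem _ _))
    (by rw [h.init]; exact X_mem_vanishingIdeal i) t

/-- Formal Hamilton flows preserve the Poisson bracket; this is the Jacobi identity. -/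
theorem IsJetFlow.poisson_sub_mem {p : PhasePoly n} (hp : p ∈ vanishingIdeal _ 2) {N : ℕ}
    (hN : 1 ≤ N) {i j : Fin n ⊕ Fin n} {F G : ℝ → PhasePoly n} (hF : IsJetFlow p N (X i) F)
    (hG : IsJetFlow p N (X j) G) (t : ℝ) :
    poisson (F t) (G t) - poisson (X i) (X j) ∈ vanishingIdeal _ (N - 1) := by
  have hconst : poisson p (poisson (X i) (X j)) = 0 := by
    rcases j with j | j
    · rw [poisson_X_inl, pderiv_X, Pi.single_apply]; split_ifs <;> simp
    · rw [poisson_X_inr, pderiv_X, Pi.single_apply]; split_ifs <;> simp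
  refine mem_vanishingIdeal_of_hasPolyDeriv hp
    ((hF.deriv.poisson hG.deriv).sub (HasPolyDeriv.const _)) (fun t => ?_) ?_ t
  · have h1 : poisson (trunc N (poisson p (F t)) - poisson p (F t)) (G t) ∈
        vanishingIdeal _ (N - 1) :=
      poisson_mem_vanishingIdeal (trunc_sub_mem _ _) (hG.mem_vanishingIdeal_one hp hN t) (by omega)
    have h2 : poisson (F t) (trunc N (poisson p (G t)) - poisson p (G t)) ∈
        vanishingIdeal _ (N - 1) :=
      poisson_mem_vanishingIdeal (hF.mem_vanishingIdeal_one hp hN t) (trunc_sub_mem _ _) (by omega)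
    convert Ideal.add_mem _ h1 h2 using 1
    rw [map_sub, hconst, poisson_jacobi, poisson_sub_left, map_sub]
    ring
  · simp [hF.init, hG.init]

end JetFlow

section Variation

variable {n : ℕ} {p₀ : PhasePoly n} {B : Matrix (Fin n ⊕ Fin n) (Fin n ⊕ Fin n) ℝ}

theorem poisson_linForm (hB : ∀ i, poisson p₀ (X i) = linForm (B i)) (c : Fin n ⊕ Fin n → ℝ) :
    poisson p₀ (linForm c) = linForm (Matrix.vecMul c B) := by
  simp only [linForm, map_sum, Derivation.map_smul, hB, Matrix.vecMul, dotProduct,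
    Finset.smul_sum, Finset.sum_smul, smul_smul]
  exact Finset.sum_comm

variable {C : ℝ → Matrix (Fin n ⊕ Fin n) (Fin n ⊕ Fin n) ℝ}

theorem hasPolyDeriv_linForm_row (hB : ∀ i, poisson p₀ (X i) = linForm (B i))
    (hC : ∀ i k t, HasDerivAt (fun t => C t i k) ((C t * B) i k) t) (i : Fin n ⊕ Fin n) :
    HasPolyDeriv (fun t => linForm (C t i)) (fun t => poisson p₀ (linForm (C t i))) := by
  simp only [poisson_linForm hB]
  exact HasPolyDeriv.linForm fun k t => hC i k t

theorem IsJetFlow.sub_linForm_mem (hp₀ : p₀.IsHomogeneous 2)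
    (hB : ∀ i, poisson p₀ (X i) = linForm (B i)) (hC0 : C 0 = 1)
    (hC : ∀ i k t, HasDerivAt (fun t => C t i k) ((C t * B) i k) t)
    {p : PhasePoly n} (hp : p - p₀ ∈ vanishingIdeal _ 3) {N : ℕ} (hN : 2 ≤ N)
    {i : Fin n ⊕ Fin n} {F : ℝ → PhasePoly n} (hF : IsJetFlow p N (X i) F) (t : ℝ) :
    F t - linForm (C t i) ∈ vanishingIdeal _ 2 := by
  have hp2 : p ∈ vanishingIdeal _ 2 := by
    simpa using Ideal.add_mem _ (vanishingIdeal_mono (by omega) hp) hp₀.mem_vanishingIdeal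
  refine mem_vanishingIdeal_of_hasPolyDeriv hp2
    (hF.deriv.sub (hasPolyDeriv_linForm_row hB hC i)) (fun t => ?_) ?_ t
  · have h1 := vanishingIdeal_mono hN (trunc_sub_mem N (poisson p (F t)))
    have h2 : poisson (p - p₀) (linForm (C t i)) ∈ vanishingIdeal _ 2 :=
      poisson_mem_vanishingIdeal hp (linForm_isHomogeneous _).mem_vanishingIdeal (by omega)
    convert Ideal.add_mem _ h1 h2 using 1
    rw [map_sub, poisson_sub_left]; ring
  · have : C 0 i = Pi.single i 1 := by
      rw [hC0]; ext k; rw [Matrix.one_apply, Pi.single_apply]; simp only [eq_comm]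
    simp [hF.init, this, linForm_single]

/-- First variation of the formal flow: if `q = p + s` up to order `m + 2`, where `s` is
homogeneous of degree `m + 1`, then the time-one maps differ, in degree `m`, by the Hamilton field
of `Q 1 = ∫₀¹ e ^ (t {p₀, ·}) s dt`. -/
theorem IsJetFlow.variation (hp₀ : p₀.IsHomogeneous 2)
    (hB : ∀ i, poisson p₀ (X i) = linForm (B i)) (hC0 : C 0 = 1)
    (hC : ∀ i k t, HasDerivAt (fun t => C t i k) ((C t * B) i k) t)
    {p q s : PhasePoly n} {m : ℕ} (hm : 2 ≤ m) (hp : p - p₀ ∈ vanishingIdeal _ 3)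
    (hs : s.IsHomogeneous (m + 1)) (hq : q - p - s ∈ vanishingIdeal _ (m + 2))
    {Q : ℝ → PhasePoly n} (hQ : HasPolyDeriv Q (fun t => poisson p₀ (Q t) + s)) (hQ0 : Q 0 = 0)
    (hQh : ∀ t, (Q t).IsHomogeneous (m + 1)) {N : ℕ} (hN : m + 1 ≤ N)
    {i : Fin n ⊕ Fin n} {F G : ℝ → PhasePoly n} (hF : IsJetFlow p N (X i) F)
    (hG : IsJetFlow q N (X i) G) (t : ℝ) :
    G t - F t - poisson (Q t) (linForm (C t i)) ∈ vanishingIdeal _ (m + 1) := by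
  have hp2 : p ∈ vanishingIdeal _ 2 := by
    simpa using Ideal.add_mem _ (vanishingIdeal_mono (by omega) hp) hp₀.mem_vanishingIdeal
  have hq3 : q - p₀ ∈ vanishingIdeal _ 3 := by
    have := Ideal.add_mem _ (Ideal.add_mem _ (vanishingIdeal_mono (by omega) hq)
      (vanishingIdeal_mono (by omega) hs.mem_vanishingIdeal)) hp
    convert this using 1; ring
  have hq2 : q ∈ vanishingIdeal _ 2 := by
    simpa using Ideal.add_mem _ (vanishingIdeal_mono (by omega) hq3) hp₀.mem_vanishingIdeal
  refine mem_vanishingIdeal_of_hasPolyDeriv hp2 ((hG.deriv.sub hF.deriv).sub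
    (hQ.poisson (hasPolyDeriv_linForm_row hB hC i))) (fun t => ?_) ?_ t
  · set Y := linForm (C t i)
    have hY : Y ∈ vanishingIdeal _ 1 := (linForm_isHomogeneous _).mem_vanishingIdeal
    have h1 := vanishingIdeal_mono hN (trunc_sub_mem N (poisson q (G t)))
    have h2 := vanishingIdeal_mono hN (trunc_sub_mem N (poisson p (F t)))
    have h3 : poisson (q - p - s) (G t) ∈ vanishingIdeal _ (m + 1) :=
      poisson_mem_vanishingIdeal hq
        (hG.mem_vanishingIdeal_one hq2 (by omega) t) (by omega)
    have h4 : poisson s (G t - Y) ∈ vanishingIdeal _ (m + 1) :=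
      poisson_mem_vanishingIdeal hs.mem_vanishingIdeal
        (hG.sub_linForm_mem hp₀ hB hC0 hC hq3 (by omega) t) (by omega)
    have h5 : poisson (p - p₀) (poisson (Q t) Y) ∈ vanishingIdeal _ (m + 1) :=
      poisson_mem_vanishingIdeal (b := m) hp
        (poisson_mem_vanishingIdeal (hQh t).mem_vanishingIdeal hY (by omega)) (by omega)
    convert Ideal.add_mem _ (Ideal.add_mem _ (Ideal.add_mem _ (Ideal.sub_mem _ h1 h2) h3) h4) h5
      using 1
    simp only [map_sub, poisson_sub_left, poisson_add_left, poisson_jacobi p₀]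
    ring
  · simp [hF.init, hG.init, hQ0, poisson]

end Variation

end LewisSternberg

/-! ### Nonresonance on polynomials -/

namespace LewisSternberg

open MvPolynomial

/-- Without resonances, the operator `s ↦ ∫₀¹ e ^ (t L) s dt` is invertible. The integral is the
value at time one of the solution of `Q' = L Q + s` with `Q 0 = 0`. -/
theorem exists_bijective_integral {V : Type*} [AddCommGroup V] [Module ℝ V] [Module.Finite ℝ V]
    (L : V →ₗ[ℝ] V)
    (hL : ∀ (a b : ℝ) (x y : V), (x ≠ 0 ∨ y ≠ 0) → L x = a • x - b • y → L y = b • x + a • y →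
      Complex.exp (a + b * Complex.I) = 1 → a = 0 ∧ b = 0) :
    ∃ T : V →ₗ[ℝ] V, Function.Bijective T ∧ ∀ s, ∃ Q : ℝ → V,
      HasWeakDeriv Q (fun t => L (Q t) + s) ∧ Q 0 = 0 ∧ Q 1 = T s := by
  let M : V × V →ₗ[ℝ] V × V := (L.coprod LinearMap.id).prod 0
  obtain ⟨E, hE0, hE⟩ := exists_linear_flow M
  have hsnd : ∀ s t, (E t (0, s)).2 = s := fun s => by
    refine HasWeakDeriv.eq_of_eq (T := 0) (v := fun _ => s) ((hE (0, s)).map (LinearMap.snd ℝ V V))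
      (fun φ t => ?_) (by simp [hE0])
    simpa using hasDerivAt_const t (φ s)
  have hQ : ∀ s, HasWeakDeriv (fun t => (E t (0, s)).1) (fun t => L (E t (0, s)).1 + s) :=
    fun s => by
      have := (hE (0, s)).map (LinearMap.fst ℝ V V)
      simpa [M, hsnd] using this
  let T : V →ₗ[ℝ] V := LinearMap.fst ℝ V V ∘ₗ E 1 ∘ₗ LinearMap.inr ℝ V V
  have hinj : Function.Injective T := by
    rw [← LinearMap.ker_eq_bot, LinearMap.ker_eq_bot']
    intro s hs
    have hs1 : (E 1 (0, s)).1 = 0 := hs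
    -- `Q' = L Q + s` solves the homogeneous equation and is equal to `s` at times `0` and `1`.
    have hLs : L s = 0 := by
      have h := map_eq_zero_of_periodic hL (u := fun t => L (E t (0, s)).1 + s) (by
        have h1 := ((hQ s).map L).add (HasWeakDeriv.smul_const (fun t => hasDerivAt_const t (1 : ℝ)) s)
        simpa using h1) (by simp [hs1, hE0])
      simpa [hE0] using h
    have h := HasWeakDeriv.eq_of_eq (T := M) (u := fun t => (t • s, s)) (v := fun t => E t (0, s))
      (by
        have h1 := (HasWeakDeriv.smul_const (c := fun t => t) (fun t => hasDerivAt_id' t)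
          ((s, 0) : V × V)).add
          (HasWeakDeriv.smul_const (fun t => hasDerivAt_const t (1 : ℝ)) ((0, s) : V × V))
        simpa [M, hLs] using h1) (hE (0, s)) (by simp [hE0]) 1
    simpa [hs1] using congrArg Prod.fst h
  exact ⟨T, ⟨hinj, LinearMap.injective_iff_surjective.1 hinj⟩, fun s =>
    ⟨fun t => (E t (0, s)).1, hQ s, by simp [hE0], rfl⟩⟩

section GenEigen

variable {ι : Type*}

/-- Products of generalized eigenvectors of a derivation are generalized eigenvectors for the sum
of the eigenvalues. -/
theorem mul_mem_maxGenEigenspace {R : Type*} [CommRing R] [Algebra ℂ R] (D : Derivation ℂ R R)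
    {a b : ℂ} {f g : R} (hf : f ∈ Module.End.maxGenEigenspace (D : R →ₗ[ℂ] R) a)
    (hg : g ∈ Module.End.maxGenEigenspace (D : R →ₗ[ℂ] R) b) :
    f * g ∈ Module.End.maxGenEigenspace (D : R →ₗ[ℂ] R) (a + b) := by
  simp only [Module.End.mem_maxGenEigenspace] at hf hg
  obtain ⟨i, hi⟩ := hf
  obtain ⟨j, hj⟩ := hg
  obtain ⟨N, hN⟩ : ∃ N, i + j = N := ⟨_, rfl⟩
  induction N generalizing i j f g with
  | zero =>
    obtain ⟨rfl, rfl⟩ : i = 0 ∧ j = 0 := by omega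
    have : f = 0 := by simpa using hi
    simp [this]
  | succ N ih =>
    set T : Module.End ℂ R := (D : R →ₗ[ℂ] R) - (a + b) • (1 : Module.End ℂ R) with hT
    have hstep : T (f * g) ∈ Module.End.maxGenEigenspace (D : R →ₗ[ℂ] R) (a + b) := by
      have e : T (f * g) = ((D : R →ₗ[ℂ] R) - a • (1 : Module.End ℂ R)) f * g +
          f * ((D : R →ₗ[ℂ] R) - b • (1 : Module.End ℂ R)) g := by
        simp only [hT, LinearMap.sub_apply, LinearMap.smul_apply, Module.End.one_apply,
          Derivation.coeFn_coe, Derivation.leibniz, smul_eq_mul]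
        simp only [Algebra.smul_def, map_add]
        ring
      rw [e]
      refine Submodule.add_mem _ ?_ ?_
      · rcases i with _ | i
        · have : f = 0 := by simpa using hi
          simp [this]
        · exact ih i (by rwa [pow_succ] at hi) j hj (by omega)
      · rcases j with _ | j
        · have : g = 0 := by simpa using hj
          simp [this]
        · exact ih i hi j (by rwa [pow_succ] at hj) (by omega)
    obtain ⟨k, hk⟩ := (Module.End.mem_maxGenEigenspace _ _ _).1 hstep
    refine (Module.End.mem_maxGenEigenspace _ _ _).2 ⟨k + 1, ?_⟩
    rw [pow_succ]; exact hk

variable [Fintype ι] [DecidableEq ι]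

/-- The derivation of the complex polynomials that extends the linear substitution with
matrix `B`. -/
noncomputable def linearDerivation (B : Matrix ι ι ℝ) :
    Derivation ℂ (MvPolynomial ι ℂ) (MvPolynomial ι ℂ) :=
  mkDerivation ℂ fun i => ∑ k, (B i k : ℂ) • X k

/-- The eigenvalues of a linear vector field on polynomials are sums of eigenvalues of its
matrix. -/
theorem eigenvalue_linearDerivation_mem {B : Matrix ι ι ℝ} {Γ : AddSubgroup ℂ}
    (hΓ : ∀ γ, Module.End.HasEigenvalue (Matrix.toLin' (B.map Complex.ofReal).transpose) γ → γ ∈ Γ)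
    {f : MvPolynomial ι ℂ} (hf : f ≠ 0) {γ : ℂ} (h : linearDerivation B f = γ • f) : γ ∈ Γ := by
  set D : Module.End ℂ (MvPolynomial ι ℂ) := (linearDerivation B).toLinearMap with hD
  have hDa : ∀ g, D g = linearDerivation B g := fun g => rfl
  let S : Submodule ℂ (MvPolynomial ι ℂ) := ⨆ γ : Γ, D.maxGenEigenspace γ
  have hmem : ∀ γ ∈ Γ, D.maxGenEigenspace γ ≤ S := fun γ hγ =>
    le_iSup (fun γ : Γ => D.maxGenEigenspace γ) ⟨γ, hγ⟩
  have hmul : ∀ f ∈ S, ∀ g ∈ S, f * g ∈ S := fun f hf g hg => by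
    refine Submodule.iSup_induction _ (motive := fun f => f * g ∈ S) hf (fun a f hf => ?_)
      (by simp) (fun x y hx hy => by rw [add_mul]; exact S.add_mem hx hy)
    refine Submodule.iSup_induction _ (motive := fun g => f * g ∈ S) hg (fun b g hg => ?_)
      (by simp) (fun x y hx hy => by rw [mul_add]; exact S.add_mem hx hy)
    exact hmem _ (Γ.add_mem a.2 b.2) (mul_mem_maxGenEigenspace _ hf hg)
  have hone : (1 : MvPolynomial ι ℂ) ∈ S := hmem 0 Γ.zero_mem
    ((Module.End.mem_maxGenEigenspace _ _ _).2 ⟨1, by simp [hDa]⟩)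
  let T : Module.End ℂ (ι → ℂ) := Matrix.toLin' (B.map Complex.ofReal).transpose
  let l : (ι → ℂ) →ₗ[ℂ] MvPolynomial ι ℂ := Fintype.linearCombination ℂ (X : ι → MvPolynomial ι ℂ)
  have hl : ∀ c, D (l c) = l (T c) := fun c => by
    simp only [hDa, l, Fintype.linearCombination_apply, map_sum, Derivation.map_smul,
      linearDerivation, mkDerivation_X, T, Matrix.toLin'_apply, Matrix.mulVec, dotProduct,
      Finset.smul_sum, Finset.sum_smul, smul_smul, Matrix.transpose_apply, Matrix.map_apply]
    rw [Finset.sum_comm]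
    exact Finset.sum_congr rfl fun k _ => Finset.sum_congr rfl fun j _ => by rw [mul_comm]
  have hlpow : ∀ (γ : ℂ) (k : ℕ) c, ((D - γ • 1) ^ k) (l c) = l (((T - γ • 1) ^ k) c) := by
    intro γ k
    induction k with
    | zero => intro c; simp
    | succ k ih =>
      intro c
      rw [pow_succ, Module.End.mul_apply, pow_succ, Module.End.mul_apply, ← ih]
      simp [hl]
  have hlS : ∀ c, l c ∈ S := fun c => by
    have h : S.comap l = ⊤ := eq_top_of_maxGenEigenspace_le (f := T) fun γ hγ c hc => by
      obtain ⟨k, hk⟩ := (Module.End.mem_maxGenEigenspace _ _ _).1 hc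
      refine hmem γ (hΓ γ hγ) ((Module.End.mem_maxGenEigenspace _ _ _).2 ⟨k, ?_⟩)
      rw [hlpow, hk, map_zero]
    exact Submodule.mem_comap.1 (h ▸ Submodule.mem_top)
  have htop : ∀ f, f ∈ S := fun f => by
    induction f using MvPolynomial.induction_on with
    | C a => rw [← mul_one (C a), ← MvPolynomial.smul_eq_C_mul]; exact S.smul_mem _ hone
    | add p q hp hq => exact S.add_mem hp hq
    | mul_X p i hp =>
      refine hmul _ hp _ ?_
      simpa [l, Fintype.linearCombination_apply, Pi.single_apply] using hlS (Pi.single i 1)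
  refine mem_of_iSup_maxGenEigenspace_eq_top (f := D) (Γ := Γ) (eq_top_iff.2 fun g _ => htop g)
    ((Module.End.mem_maxGenEigenspace _ _ _).2 ⟨1, ?_⟩) hf
  simp [hDa, h]

end GenEigen

section Homogeneous

variable {n : ℕ} {p₀ : PhasePoly n} {B : Matrix (Fin n ⊕ Fin n) (Fin n ⊕ Fin n) ℝ}

theorem linearDerivation_map (hB : ∀ i, poisson p₀ (X i) = linForm (B i)) (f : PhasePoly n) :
    linearDerivation B (map Complex.ofRealHom f) = map Complex.ofRealHom (poisson p₀ f) := by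
  induction f using MvPolynomial.induction_on with
  | C a => simp
  | add p q hp hq => simp [hp, hq]
  | mul_X p i hp =>
    have : linearDerivation B (X i) = map Complex.ofRealHom (linForm (B i)) := by
      simp [linearDerivation, linForm, mkDerivation_X, MvPolynomial.smul_eq_C_mul]
    simp [Derivation.leibniz, hp, hB, this]

/-- Without resonances, every homogeneous polynomial `q` of degree `m + 1` is
`∫₀¹ e ^ (t {p₀, ·}) s dt` for exactly one homogeneous `s`. -/
theorem exists_bijective_poisson_integral (hp₀ : p₀.IsHomogeneous 2)
    (hB : ∀ i, poisson p₀ (X i) = linForm (B i)) {Γ : AddSubgroup ℂ}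
    (hΓ : ∀ γ, Module.End.HasEigenvalue (Matrix.toLin' (B.map Complex.ofReal).transpose) γ → γ ∈ Γ)
    (hexp : ∀ γ ∈ Γ, Complex.exp γ = 1 → γ = 0) (m : ℕ) :
    ∃ T : homogeneousSubmodule (Fin n ⊕ Fin n) ℝ (m + 1) →ₗ[ℝ]
        homogeneousSubmodule (Fin n ⊕ Fin n) ℝ (m + 1),
      Function.Bijective T ∧
        ∀ s : homogeneousSubmodule (Fin n ⊕ Fin n) ℝ (m + 1), ∃ Q : ℝ → PhasePoly n,
        HasPolyDeriv Q (fun t => poisson p₀ (Q t) + (s : PhasePoly n)) ∧ Q 0 = 0 ∧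
        (∀ t, (Q t).IsHomogeneous (m + 1)) ∧ Q 1 = T s := by
  let V := homogeneousSubmodule (Fin n ⊕ Fin n) ℝ (m + 1)
  have : Module.Finite ℝ V := Module.Finite.iff_fg.2 (homogeneousSubmodule_fg _ _ _)
  let L : V →ₗ[ℝ] V := ((poisson p₀ : PhasePoly n →ₗ[ℝ] PhasePoly n).restrict fun f hf => by
    rw [mem_homogeneousSubmodule] at hf ⊢
    rw [add_comm m 1]
    exact poisson_isHomogeneous hp₀ hf)
  have hLa : ∀ f : V, (L f : PhasePoly n) = poisson p₀ f := fun f => rfl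
  obtain ⟨T, hT, h⟩ := exists_bijective_integral L fun a b x y hxy hx hy hab => by
    set γ : ℂ := a + b * Complex.I with hγ
    let f : MvPolynomial (Fin n ⊕ Fin n) ℂ :=
      map Complex.ofRealHom (x : PhasePoly n) + Complex.I • map Complex.ofRealHom (y : PhasePoly n)
    have hfc : ∀ k, coeff k f = ((coeff k (x : PhasePoly n) : ℝ) : ℂ) +
        Complex.I * ((coeff k (y : PhasePoly n) : ℝ) : ℂ) := fun k => by simp [f, coeff_map]
    have hf : f ≠ 0 := fun h0 => by
      have hk : ∀ k, coeff k (x : PhasePoly n) = 0 ∧ coeff k (y : PhasePoly n) = 0 := fun k => by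
        have := hfc k
        rw [h0, coeff_zero] at this
        exact ⟨by simpa using (congrArg Complex.re this).symm,
          by simpa using (congrArg Complex.im this).symm⟩
      rcases hxy with h | h
      · exact h (Subtype.ext (MvPolynomial.ext _ _ fun k => (hk k).1))
      · exact h (Subtype.ext (MvPolynomial.ext _ _ fun k => (hk k).2))
    have hDf : linearDerivation B f = γ • f := by
      have hx' : poisson p₀ x = a • (x : PhasePoly n) - b • (y : PhasePoly n) := by
        rw [← hLa, hx]; rfl
      have hy' : poisson p₀ y = b • (x : PhasePoly n) + a • (y : PhasePoly n) := by
        rw [← hLa, hy]; rfl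
      simp only [f, map_add, Derivation.map_smul, linearDerivation_map hB, hx', hy', map_sub]
      simp only [MvPolynomial.smul_eq_C_mul, map_add, map_mul, map_C, Complex.ofRealHom_eq_coe, hγ]
      have hI : (C Complex.I : MvPolynomial (Fin n ⊕ Fin n) ℂ) * C Complex.I = -1 := by
        rw [← map_mul, Complex.I_mul_I]; simp
      linear_combination (-(C (b : ℂ)) * map Complex.ofRealHom (y : PhasePoly n)) * hI
    have h0 := hexp γ (eigenvalue_linearDerivation_mem hΓ hf hDf) hab
    exact ⟨by simpa [hγ] using congrArg Complex.re h0, by simpa [hγ] using congrArg Complex.im h0⟩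
  refine ⟨T, hT, fun s => ?_⟩
  obtain ⟨Q, hQ, hQ0, hQ1⟩ := h s
  exact ⟨fun t => Q t, hQ.hasPolyDeriv, by simp [hQ0], fun t => (Q t).2, by simp [hQ1]⟩

end Homogeneous

end LewisSternberg

/-! ### The logarithm of the linearization -/

namespace LewisSternberg

section TruncatedLog

open Polynomial

/-- The Taylor polynomial of `log (1 + X)` of degree `N`. -/
noncomputable def truncLog (N : ℕ) : ℂ[X] :=
  ∑ k ∈ Finset.Icc 1 N, C ((-1 : ℂ) ^ (k + 1) / (k : ℂ)) * X ^ k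

/-- The Taylor polynomial of `exp X` of degree less than `M`. -/
noncomputable def truncExp (M : ℕ) : ℂ[X] :=
  ∑ j ∈ Finset.range M, C ((j.factorial : ℂ)⁻¹) * X ^ j

theorem derivative_truncExp (M : ℕ) : derivative (truncExp (M + 1)) = truncExp M := by
  rw [truncExp, Finset.sum_range_succ', derivative_add, derivative_sum, truncExp]
  simp only [derivative_C_mul, derivative_X_pow, pow_zero, mul_one, derivative_C, add_zero,
    Nat.add_sub_cancel]
  refine Finset.sum_congr rfl fun j _ => ?_
  rw [← mul_assoc, ← C_mul, Nat.factorial_succ]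
  congr 2
  push_cast
  have : (j.factorial : ℂ) ≠ 0 := by exact_mod_cast j.factorial_ne_zero
  have : (j + 1 : ℂ) ≠ 0 := by exact_mod_cast j.succ_ne_zero
  field_simp

theorem one_add_X_mul_derivative_truncLog (N : ℕ) :
    (1 + X) * derivative (truncLog N) = 1 - (-X : ℂ[X]) ^ N := by
  induction N with
  | zero => simp [truncLog]
  | succ N ih =>
    have h : truncLog (N + 1) = truncLog N + C ((-1 : ℂ) ^ (N + 2) / ((N + 1 : ℕ) : ℂ)) * X ^ (N + 1) := by
      rw [truncLog, truncLog, Finset.sum_Icc_succ_top (by omega)]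
    have h2 : derivative (C ((-1 : ℂ) ^ (N + 2) / ((N + 1 : ℕ) : ℂ)) * X ^ (N + 1)) =
        (-X : ℂ[X]) ^ N := by
      rw [derivative_C_mul, derivative_X_pow, ← mul_assoc, ← C_mul, Nat.add_sub_cancel]
      have : ((N + 1 : ℕ) : ℂ) ≠ 0 := by exact_mod_cast N.succ_ne_zero
      rw [div_mul_cancel₀ _ this, pow_add, neg_pow (X : ℂ[X]) N]
      simp
    rw [h, derivative_add, mul_add, ih, h2]
    ring

theorem X_dvd_truncLog (N : ℕ) : (X : ℂ[X]) ∣ truncLog N :=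
  Finset.dvd_sum fun k hk => Dvd.dvd.mul_left (dvd_pow_self _ (by
    have := (Finset.mem_Icc.1 hk).1; omega)) _

/-- `exp (log (1 + X)) = 1 + X`, for truncated series. Both sides solve `(1 + X) f' = f`. -/
theorem X_pow_dvd_truncExp_comp_truncLog (N : ℕ) :
    (X : ℂ[X]) ^ N ∣ (truncExp (N + 1)).comp (truncLog N) - (1 + X) := by
  set f := (truncExp (N + 1)).comp (truncLog N) with hf
  obtain ⟨a, ha⟩ := X_dvd_truncLog N
  have hexp : truncExp N = truncExp (N + 1) - C ((N.factorial : ℂ)⁻¹) * X ^ N := by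
    rw [truncExp, truncExp, Finset.sum_range_succ]; ring
  have hode : ∃ g, (1 + X) * derivative f = f + X ^ N * g := by
    refine ⟨-(C ((N.factorial : ℂ)⁻¹) * a ^ N) * (1 - (-X) ^ N) - f * (-1) ^ N, ?_⟩
    have hcomp : (truncExp N).comp (truncLog N) =
        f - C ((N.factorial : ℂ)⁻¹) * (X ^ N * a ^ N) := by
      rw [hexp, sub_comp, mul_comp, C_comp, X_pow_comp, ← mul_pow, ← ha]
    have e := one_add_X_mul_derivative_truncLog N
    rw [neg_pow (X : ℂ[X]) N] at e ⊢
    rw [hf, derivative_comp, derivative_truncExp, hcomp, ← hf]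
    linear_combination (f - C ((N.factorial : ℂ)⁻¹) * (X ^ N * a ^ N)) * e
  obtain ⟨g, hg⟩ := hode
  have h0 : f.coeff 0 = 1 := by
    rw [coeff_zero_eq_eval_zero, hf, eval_comp, ha]
    simp only [eval_mul, eval_X, zero_mul, truncExp, eval_finsetSum, eval_C, eval_pow]
    rw [Finset.sum_range_succ']
    simp
  have hrec : ∀ k < N, ((k : ℂ) + 1) * f.coeff (k + 1) = (1 - k) * f.coeff k := fun k hk => by
    have h := congrArg (fun q => q.coeff k) hg
    simp only [coeff_add, add_mul, one_mul, coeff_X_pow_mul', if_neg (by omega : ¬ N ≤ k),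
      add_zero, coeff_derivative] at h
    rcases k with _ | k
    · simp at h ⊢; exact h
    · rw [coeff_X_mul, coeff_derivative] at h
      push_cast at h ⊢
      linear_combination h
  have h1 : ∀ k, k < N → f.coeff (k + 1) = if k = 0 then 1 else 0 := by
    intro k
    induction k with
    | zero => intro hk; simpa [h0] using hrec 0 hk
    | succ k ih =>
      intro hk
      have h := hrec (k + 1) hk
      have hne : ((k + 1 : ℕ) : ℂ) + 1 ≠ 0 := by exact_mod_cast (k + 1).succ_ne_zero
      rw [ih (by omega)] at h
      rw [if_neg k.succ_ne_zero]
      refine (mul_eq_zero.1 (h.trans ?_)).resolve_left hne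
      split_ifs with hk0
      · simp [hk0]
      · simp
  rw [X_pow_dvd_iff]
  intro d hd
  rcases d with _ | d
  · simp [h0]
  · rw [coeff_sub, h1 d (by omega), coeff_add, coeff_one, coeff_X]
    rcases d with _ | d <;> simp

end TruncatedLog

section Flow

/-- The one-parameter group of matrices generated by `B`. -/
theorem exists_matrix_flow {ι : Type*} [Fintype ι] [DecidableEq ι] (B : Matrix ι ι ℝ) :
    ∃ C : ℝ → Matrix ι ι ℝ, C 0 = 1 ∧
      (∀ i k t, HasDerivAt (fun t => C t i k) ((C t * B) i k) t) ∧
      (∀ i k t, HasDerivAt (fun t => C t i k) ((B * C t) i k) t) := by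
  let T := LinearMap.toContinuousLinearMap (Matrix.toLin' B)
  have hT : LinearMap.toMatrix' (T : (ι → ℝ) →ₗ[ℝ] ι → ℝ) = B := by simp [T]
  have happ : ∀ (S S' : (ι → ℝ) →L[ℝ] (ι → ℝ)), LinearMap.toMatrix'
      ((S * S' : (ι → ℝ) →L[ℝ] (ι → ℝ)) : (ι → ℝ) →ₗ[ℝ] ι → ℝ) =
      LinearMap.toMatrix' (S : (ι → ℝ) →ₗ[ℝ] ι → ℝ) *
        LinearMap.toMatrix' (S' : (ι → ℝ) →ₗ[ℝ] ι → ℝ) := fun S S' =>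
    LinearMap.toMatrix'_comp _ _
  have hentry : ∀ (F : ℝ → (ι → ℝ) →L[ℝ] (ι → ℝ)) (F' : (ι → ℝ) →L[ℝ] (ι → ℝ)) (t : ℝ) (i k : ι),
      HasDerivAt F F' t → HasDerivAt
        (fun t => LinearMap.toMatrix' (F t : (ι → ℝ) →ₗ[ℝ] ι → ℝ) i k)
        (LinearMap.toMatrix' (F' : (ι → ℝ) →ₗ[ℝ] ι → ℝ) i k) t := fun F F' t i k h => by
    simp only [LinearMap.toMatrix'_apply]
    have := h.clm_apply (hasDerivAt_const t (Pi.single k (1 : ℝ)))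
    simpa using hasDerivAt_pi.1 this i
  refine ⟨fun t => LinearMap.toMatrix' (NormedSpace.exp (t • T) : (ι → ℝ) →L[ℝ] (ι → ℝ)).toLinearMap,
    ?_, fun i k t => ?_, fun i k t => ?_⟩
  · simp only [zero_smul, NormedSpace.exp_zero]; exact LinearMap.toMatrix'_id
  · have := hentry _ _ t i k (hasDerivAt_exp_smul_const (𝕂 := ℝ) T t)
    rwa [happ, hT] at this
  · have := hentry _ _ t i k (hasDerivAt_exp_smul_const' (𝕂 := ℝ) T t)
    rwa [happ, hT] at this

end Flow

section Logarithm

open Polynomial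

variable {n : ℕ} {A B : Matrix (Fin n ⊕ Fin n) (Fin n ⊕ Fin n) ℝ} {z m : ℂ}

/-- The nilpotent part `z⁻¹ (A - z)` of `A` relative to the eigenvalue `z`. -/
noncomputable def relNilpotent (A : Matrix (Fin n ⊕ Fin n) (Fin n ⊕ Fin n) ℝ) (z : ℂ) :
    Module.End ℂ (Fin n ⊕ Fin n → ℂ) :=
  z⁻¹ • (complexAction A - algebraMap ℂ _ z)

theorem isLogOnEigenspace_iff : IsLogOnEigenspace A B z m ↔
    ∀ v ∈ (complexAction A).maxGenEigenspace z,
      complexAction B v = m • v + aeval (relNilpotent A z) (truncLog (2 * n)) v := by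
  refine forall₂_congr fun v _ => ?_
  have : aeval (relNilpotent A z) (truncLog (2 * n)) v =
      ∑ k ∈ Finset.Icc 1 (2 * n), ((-1 : ℂ) ^ (k + 1) / (k : ℂ)) •
        ((z⁻¹ • (complexAction A - algebraMap ℂ _ z)) ^ k) v := by
    rw [truncLog, map_sum, LinearMap.sum_apply]
    refine Finset.sum_congr rfl fun k _ => ?_
    rw [← smul_eq_C_mul, map_smul, map_pow, aeval_X, LinearMap.smul_apply, relNilpotent]
  rw [this]

theorem mem_maxGenEigenspace_complexAction {v : Fin n ⊕ Fin n → ℂ} :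
    v ∈ (complexAction A).maxGenEigenspace z ↔
      ((complexAction A - algebraMap ℂ _ z) ^ (2 * n)) v = 0 := by
  have h := Module.End.maxGenEigenspace_eq_genEigenspace_finrank (complexAction A) z
  have hr : Module.finrank ℂ (Fin n ⊕ Fin n → ℂ) = 2 * n := by
    simp [two_mul]
  rw [h, hr, Module.End.mem_genEigenspace_nat, LinearMap.mem_ker, Algebra.algebraMap_eq_smul_one]

theorem relNilpotent_pow_apply {v : Fin n ⊕ Fin n → ℂ}
    (hv : v ∈ (complexAction A).maxGenEigenspace z) : (relNilpotent A z ^ (2 * n)) v = 0 := by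
  rw [relNilpotent, _root_.smul_pow, LinearMap.smul_apply, mem_maxGenEigenspace_complexAction.1 hv,
    smul_zero]

theorem aeval_relNilpotent_mem (q : ℂ[X]) {v : Fin n ⊕ Fin n → ℂ}
    (hv : v ∈ (complexAction A).maxGenEigenspace z) :
    aeval (relNilpotent A z) q v ∈ (complexAction A).maxGenEigenspace z := by
  have hc : Commute ((complexAction A - algebraMap ℂ _ z) ^ (2 * n))
      (aeval (relNilpotent A z) q) := by
    have h1 : Commute (complexAction A - algebraMap ℂ _ z) (relNilpotent A z) :=
      (Commute.refl _).smul_right _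
    refine Commute.pow_left ?_ _
    induction q using Polynomial.induction_on' with
    | add p q hp hq => rw [map_add]; exact hp.add_right hq
    | monomial k c =>
      rw [aeval_monomial]
      exact (Algebra.commute_algebraMap_right c _).mul_right (h1.pow_right k)
  rw [mem_maxGenEigenspace_complexAction] at hv ⊢
  rw [← Module.End.mul_apply, hc.eq, Module.End.mul_apply, hv, map_zero]

theorem aeval_truncLog_pow_apply {v : Fin n ⊕ Fin n → ℂ}
    (hv : v ∈ (complexAction A).maxGenEigenspace z) {k : ℕ} (hk : 2 * n ≤ k) :
    (aeval (relNilpotent A z) (truncLog (2 * n)) ^ k) v = 0 := by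
  obtain ⟨a, ha⟩ := X_dvd_truncLog (2 * n)
  obtain ⟨l, rfl⟩ := Nat.exists_eq_add_of_le hk
  have e : (X * a) ^ (2 * n + l) = a ^ (2 * n + l) * X ^ l * X ^ (2 * n) := by ring
  rw [← map_pow, ha, e, map_mul, map_pow _ X, aeval_X, Module.End.mul_apply,
    relNilpotent_pow_apply hv, map_zero]

end Logarithm

end LewisSternberg

/-! ### The flow generated by the logarithm -/

namespace LewisSternberg

open Polynomial

section Logarithm

variable {n : ℕ} {A B : Matrix (Fin n ⊕ Fin n) (Fin n ⊕ Fin n) ℝ} {z m : ℂ}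

theorem complexAction_injective :
    Function.Injective (complexAction : Matrix (Fin n ⊕ Fin n) (Fin n ⊕ Fin n) ℝ → _) :=
  fun M M' h => by
    have h1 := Matrix.toLin'.injective h
    ext i j
    simpa using congrFun (congrFun h1 i) j

theorem complexAction_mul (M M' : Matrix (Fin n ⊕ Fin n) (Fin n ⊕ Fin n) ℝ) :
    complexAction (M * M') = complexAction M * complexAction M' := by
  have h := Matrix.map_mul (L := M) (M := M') (f := Complex.ofRealHom)
  exact (congrArg Matrix.toLin' h).trans (Matrix.toLin'_mul _ _)

theorem complexAction_apply (M : Matrix (Fin n ⊕ Fin n) (Fin n ⊕ Fin n) ℝ)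
    (v : Fin n ⊕ Fin n → ℂ) (i : Fin n ⊕ Fin n) :
    complexAction M v i = ∑ k, (M i k : ℂ) * v k := by
  simp [complexAction, Matrix.mulVec, dotProduct]

/-- On the generalized eigenspace of `A` for `z = e ^ m`, the flow of `m + log (1 + N)` is
`e ^ (t m) ∑ t ^ j / j! (log (1 + N)) ^ j`, and it is equal to `z (1 + N) = A` at time one. -/
theorem complexAction_flow_one_apply {C : ℝ → Matrix (Fin n ⊕ Fin n) (Fin n ⊕ Fin n) ℝ}
    (hC0 : C 0 = 1) (hC : ∀ i k t, HasDerivAt (fun t => C t i k) ((B * C t) i k) t)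
    (hlog : IsLogOnEigenspace A B z m) (hexp : Complex.exp m = z) {v : Fin n ⊕ Fin n → ℂ}
    (hv : v ∈ (complexAction A).maxGenEigenspace z) :
    complexAction (C 1) v = complexAction A v := by
  rw [isLogOnEigenspace_iff] at hlog
  set Y := aeval (relNilpotent A z) (truncLog (2 * n)) with hY
  have hYmem : ∀ j, (Y ^ j) v ∈ (complexAction A).maxGenEigenspace z := fun j => by
    rw [hY, ← map_pow]; exact aeval_relNilpotent_mem _ hv
  let S : ℝ → (Fin n ⊕ Fin n → ℂ) := fun t =>
    ∑ j ∈ Finset.range (2 * n + 1), (t ^ j * (j.factorial : ℝ)⁻¹) • (Y ^ j) v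
  have hS : ∀ t, HasDerivAt S (Y (S t)) t := fun t => by
    have e1 : Y (S t) = ∑ j ∈ Finset.range (2 * n),
        (t ^ j * (j.factorial : ℝ)⁻¹) • (Y ^ (j + 1)) v := by
      simp only [S, map_sum, LinearMap.map_smul_of_tower, ← Module.End.mul_apply, ← pow_succ']
      rw [Finset.sum_range_succ, aeval_truncLog_pow_apply hv (by omega), smul_zero, add_zero]
    have e2 : S = fun t => ∑ j ∈ Finset.range (2 * n),
        (t ^ (j + 1) * ((j + 1).factorial : ℝ)⁻¹) • (Y ^ (j + 1)) v + v := by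
      funext t; simp only [S]; rw [Finset.sum_range_succ']; simp
    rw [e1, e2]
    refine HasDerivAt.add_const _ (HasDerivAt.fun_sum fun j _ => HasDerivAt.smul_const ?_ _)
    have := (hasDerivAt_pow (j + 1) t).mul_const (((j + 1).factorial : ℝ)⁻¹)
    convert this using 1
    rw [Nat.factorial_succ]
    have : (j.factorial : ℝ) ≠ 0 := by exact_mod_cast j.factorial_ne_zero
    have : (j + 1 : ℝ) ≠ 0 := by positivity
    push_cast
    field_simp
  have hSmem : ∀ t, S t ∈ (complexAction A).maxGenEigenspace z := fun t =>
    Submodule.sum_mem _ fun j _ => Submodule.smul_of_tower_mem _ _ (hYmem j)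
  let c : ℝ → (Fin n ⊕ Fin n → ℂ) := fun t => Complex.exp (t * m) • S t
  have hc : ∀ t, HasDerivAt c (complexAction B (c t)) t := fun t => by
    have he : HasDerivAt (fun t : ℝ => Complex.exp (t * m)) (Complex.exp (t * m) * m) t := by
      have := ((hasDerivAt_id t).ofReal_comp.mul_const m).cexp
      simpa using this
    have e : complexAction B (c t) =
        Complex.exp (t * m) • Y (S t) + (Complex.exp (t * m) * m) • S t := by
      change complexAction B (Complex.exp (t * m) • S t) = _
      rw [map_smul, hlog _ (hSmem t)]
      module
    rw [e]
    exact he.fun_smul (hS t)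
  let T : (Fin n ⊕ Fin n → ℂ) →L[ℝ] (Fin n ⊕ Fin n → ℂ) :=
    (LinearMap.toContinuousLinearMap (complexAction B)).restrictScalars ℝ
  have hu : ∀ t, HasDerivAt (fun t => complexAction (C t) v)
      (complexAction B (complexAction (C t) v)) t := fun t => by
    refine hasDerivAt_pi.2 fun i => ?_
    rw [← Module.End.mul_apply, ← complexAction_mul]
    simp only [complexAction_apply]
    exact HasDerivAt.fun_sum fun k _ => (hC i k t).ofReal_comp.mul_const _
  have h := linear_ode_eq_zero T (u := fun t => complexAction (C t) v - c t) (fun t => by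
    convert (hu t).fun_sub (hc t) using 1
    exact map_sub (complexAction B) _ _) (by
      have hS0 : S 0 = v := by simp only [S]; rw [Finset.sum_range_succ']; simp
      have h1 : complexAction (C 0) v = v := by
        ext i
        rw [complexAction_apply, hC0, Finset.sum_eq_single i]
        · simp
        · intro k _ hk; simp [Matrix.one_apply_ne hk.symm]
        · simp
      simp [c, hS0, h1]) 1
  rw [sub_eq_zero] at h
  rw [h]
  have hS1 : S 1 = aeval Y (truncExp (2 * n + 1)) v := by
    simp only [S, truncExp, map_sum, LinearMap.sum_apply, one_pow, one_mul]
    refine Finset.sum_congr rfl fun j _ => ?_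
    rw [← smul_eq_C_mul, map_smul, map_pow, aeval_X, LinearMap.smul_apply]
    ext i; simp
  obtain ⟨g, hg⟩ := X_pow_dvd_truncExp_comp_truncLog (2 * n)
  have hS1' : S 1 = v + relNilpotent A z v := by
    rw [hS1, hY, ← aeval_comp, sub_eq_iff_eq_add.1 hg, mul_comm, map_add, map_mul, map_pow, aeval_X,
      LinearMap.add_apply, Module.End.mul_apply, relNilpotent_pow_apply hv]
    simp
  have hz : z ≠ 0 := hexp ▸ Complex.exp_ne_zero m
  simp only [c, hS1', Complex.ofReal_one, one_mul, hexp, relNilpotent, LinearMap.smul_apply,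
    LinearMap.sub_apply, Module.algebraMap_end_apply, smul_add, smul_smul, mul_inv_cancel₀ hz]
  module

/-- On the generalized eigenspace of `A` for `z`, the operator `B - m` is nilpotent. -/
theorem maxGenEigenspace_le_of_isLogOnEigenspace (hlog : IsLogOnEigenspace A B z m) :
    (complexAction A).maxGenEigenspace z ≤ (complexAction B).maxGenEigenspace m := fun v hv => by
  rw [isLogOnEigenspace_iff] at hlog
  set Y := aeval (relNilpotent A z) (truncLog (2 * n)) with hY
  refine (Module.End.mem_maxGenEigenspace _ _ _).2 ⟨2 * n, ?_⟩
  have h : ∀ k, ((complexAction B - m • 1) ^ k) v = (Y ^ k) v := fun k => by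
    induction k with
    | zero => simp
    | succ k ih =>
      have hmem : (Y ^ k) v ∈ (complexAction A).maxGenEigenspace z := by
        rw [hY, ← map_pow]; exact aeval_relNilpotent_mem _ hv
      rw [pow_succ', Module.End.mul_apply, ih, LinearMap.sub_apply, hlog _ hmem, pow_succ',
        Module.End.mul_apply]
      simp
  rw [h, aeval_truncLog_pow_apply hv le_rfl]

end Logarithm

section LogValues

variable {n r : ℕ} {A B : Matrix (Fin n ⊕ Fin n) (Fin n ⊕ Fin n) ℝ} {lam μ : Fin r → ℂ}

/-- The graph of the branch of the logarithm on the spectrum: `0` at `1`, `μ j` at `lam j` and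
`-μ j` at `(lam j)⁻¹`. -/
def IsLogValue (lam μ : Fin r → ℂ) (z w : ℂ) : Prop :=
  (z = 1 ∧ w = 0) ∨ ∃ j, (z = lam j ∧ w = μ j) ∨ (z = (lam j)⁻¹ ∧ w = -μ j)

theorem isLogarithm_iff :
    IsLogarithm A lam μ B ↔ ∀ z w, IsLogValue lam μ z w → IsLogOnEigenspace A B z w := by
  constructor
  · rintro ⟨h1, h⟩ z w (⟨rfl, rfl⟩ | ⟨j, ⟨rfl, rfl⟩ | ⟨rfl, rfl⟩⟩)
    exacts [h1, (h j).1, (h j).2]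
  · exact fun h => ⟨h _ _ (Or.inl ⟨rfl, rfl⟩), fun j => ⟨h _ _ (Or.inr ⟨j, Or.inl ⟨rfl, rfl⟩⟩),
      h _ _ (Or.inr ⟨j, Or.inr ⟨rfl, rfl⟩⟩)⟩⟩

theorem IsLogValue.exp_eq (hexp : ∀ j, Complex.exp (μ j) = lam j) {z w : ℂ}
    (h : IsLogValue lam μ z w) : Complex.exp w = z := by
  rcases h with ⟨rfl, rfl⟩ | ⟨j, ⟨rfl, rfl⟩ | ⟨rfl, rfl⟩⟩
  · exact Complex.exp_zero
  · exact hexp j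
  · rw [Complex.exp_neg, hexp]

theorem IsLogValue.mem_closure {z w : ℂ} (h : IsLogValue lam μ z w) :
    w ∈ AddSubgroup.closure (Set.range μ) := by
  rcases h with ⟨rfl, rfl⟩ | ⟨j, ⟨rfl, rfl⟩ | ⟨rfl, rfl⟩⟩
  · exact zero_mem _
  · exact AddSubgroup.subset_closure ⟨j, rfl⟩
  · exact neg_mem (AddSubgroup.subset_closure ⟨j, rfl⟩)

/-- The arithmetic condition in multiplicative form. -/
theorem eq_zero_of_mem_closure_of_exp_eq_one
    (hres : ∀ k : Fin r → ℤ,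
      (∃ m : ℤ, ∑ j, (k j : ℂ) * μ j = 2 * (Real.pi : ℂ) * Complex.I * (m : ℂ)) →
        ∑ j, (k j : ℂ) * μ j = 0) {γ : ℂ} (h : γ ∈ AddSubgroup.closure (Set.range μ))
    (hγ : Complex.exp γ = 1) : γ = 0 := by
  obtain ⟨k, rfl⟩ : ∃ k : Fin r → ℤ, ∑ j, (k j : ℂ) * μ j = γ := by
    clear hγ
    induction h using AddSubgroup.closure_induction with
    | mem x hx =>
      obtain ⟨j, rfl⟩ := hx
      exact ⟨Pi.single j 1, by simp [Pi.single_apply, ite_mul]⟩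
    | zero => exact ⟨0, by simp⟩
    | add x y _ _ hx hy =>
      obtain ⟨k, hk⟩ := hx
      obtain ⟨l, hl⟩ := hy
      exact ⟨k + l, by simp [add_mul, Finset.sum_add_distrib, hk, hl]⟩
    | neg x _ hx =>
      obtain ⟨k, hk⟩ := hx
      exact ⟨-k, by simp [hk]⟩
  obtain ⟨m, hm⟩ := Complex.exp_eq_one_iff.1 hγ
  exact hres k ⟨m, by rw [hm]; ring⟩

/-- `e ^ B = A`. -/
theorem flow_one_eq {C : ℝ → Matrix (Fin n ⊕ Fin n) (Fin n ⊕ Fin n) ℝ}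
    (hC0 : C 0 = 1) (hC : ∀ i k t, HasDerivAt (fun t => C t i k) ((B * C t) i k) t)
    (hexp : ∀ j, Complex.exp (μ j) = lam j)
    (hspec : ∀ z, (complexAction A).HasEigenvalue z → ∃ w, IsLogValue lam μ z w)
    (hB : IsLogarithm A lam μ B) : C 1 = A := by
  rw [isLogarithm_iff] at hB
  have h : LinearMap.ker (complexAction (C 1) - complexAction A) = ⊤ :=
    eq_top_of_maxGenEigenspace_le (f := complexAction A) fun z hz v hv => by
      obtain ⟨w, hw⟩ := hspec z hz
      rw [LinearMap.mem_ker, LinearMap.sub_apply,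
        complexAction_flow_one_apply hC0 hC (hB z w hw) (hw.exp_eq hexp) hv, sub_self]
  exact complexAction_injective (sub_eq_zero.1 (LinearMap.ker_eq_top.1 h))

theorem iSup_maxGenEigenspace_log_eq_top
    (hspec : ∀ z, (complexAction A).HasEigenvalue z → ∃ w, IsLogValue lam μ z w)
    (hB : IsLogarithm A lam μ B) :
    ⨆ γ : (AddSubgroup.closure (Set.range μ) : Set ℂ), (complexAction B).maxGenEigenspace γ = ⊤ := by
  rw [isLogarithm_iff] at hB
  refine eq_top_of_maxGenEigenspace_le (f := complexAction A) fun z hz => ?_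
  obtain ⟨w, hw⟩ := hspec z hz
  exact (maxGenEigenspace_le_of_isLogOnEigenspace (hB z w hw)).trans
    (le_iSup (fun γ : (AddSubgroup.closure (Set.range μ) : Set ℂ) =>
      (complexAction B).maxGenEigenspace γ) ⟨w, hw.mem_closure⟩)

/-- The eigenvalues of `B`, equivalently those of its transpose, are integral combinations of the
`μ j`. -/
theorem hasEigenvalue_transpose_log_mem
    (hspec : ∀ z, (complexAction A).HasEigenvalue z → ∃ w, IsLogValue lam μ z w)
    (hB : IsLogarithm A lam μ B) (γ : ℂ)
    (hγ : Module.End.HasEigenvalue (Matrix.toLin' (B.map Complex.ofReal).transpose) γ) :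
    γ ∈ AddSubgroup.closure (Set.range μ) := by
  have h : (complexAction B).HasEigenvalue γ := by
    rw [Module.End.hasEigenvalue_iff_isRoot_charpoly] at hγ ⊢
    rwa [Matrix.charpoly_toLin', Matrix.charpoly_transpose, ← Matrix.charpoly_toLin'] at hγ
  obtain ⟨v, hv⟩ := h.exists_hasEigenvector
  exact mem_of_iSup_maxGenEigenspace_eq_top (iSup_maxGenEigenspace_log_eq_top hspec hB)
    (Module.End.eigenspace_le_maxGenEigenspace hv.1) hv.2

/-- The logarithm of a symplectic matrix is infinitesimally symplectic. More generally, if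
`Aᵀ J A = J` then `Bᵀ J + J B = 0`: the curve `e ^ (t Bᵀ) J e ^ (t B)` solves a linear
equation without resonances and takes equal values at `0` and `1`. -/
theorem transpose_mul_add_mul_eq_zero (hexp : ∀ j, Complex.exp (μ j) = lam j)
    (hres : ∀ k : Fin r → ℤ,
      (∃ m : ℤ, ∑ j, (k j : ℂ) * μ j = 2 * (Real.pi : ℂ) * Complex.I * (m : ℂ)) →
        ∑ j, (k j : ℂ) * μ j = 0)
    (hspec : ∀ z, (complexAction A).HasEigenvalue z → ∃ w, IsLogValue lam μ z w)
    (hB : IsLogarithm A lam μ B) {J : Matrix (Fin n ⊕ Fin n) (Fin n ⊕ Fin n) ℝ}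
    (hJ : A.transpose * J * A = J) : B.transpose * J + J * B = 0 := by
  obtain ⟨C, hC0, hCB, hBC⟩ := exists_matrix_flow B
  have hC1 := flow_one_eq hC0 hBC hexp hspec hB
  let L : Matrix (Fin n ⊕ Fin n) (Fin n ⊕ Fin n) ℝ →ₗ[ℝ] Matrix (Fin n ⊕ Fin n) (Fin n ⊕ Fin n) ℝ :=
    LinearMap.mulLeft ℝ B.transpose + LinearMap.mulRight ℝ B
  have hL : ∀ S, L S = B.transpose * S + S * B := fun S => rfl
  have key := map_eq_zero_of_periodic (T := L) (u := fun t => (C t).transpose * J * C t) ?_ ?_ ?_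
  · simpa [hL, hC0] using key
  · intro a b X Y hXY hX hY hab
    set γ : ℂ := a + b * Complex.I with hγ
    let S : Matrix (Fin n ⊕ Fin n) (Fin n ⊕ Fin n) ℂ :=
      X.map Complex.ofReal + Complex.I • Y.map Complex.ofReal
    let b' := B.map Complex.ofReal
    have hS0 : S ≠ 0 := fun h => by
      have hk : ∀ i j, X i j = 0 ∧ Y i j = 0 := fun i j => by
        have := congrFun (congrFun h i) j
        exact ⟨by simpa [S] using congrArg Complex.re this,
          by simpa [S] using congrArg Complex.im this⟩
      rcases hXY with h | h
      · exact h (by ext i j; exact (hk i j).1)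
      · exact h (by ext i j; exact (hk i j).2)
    have hS : b'.transpose * S + S * b' = γ • S := by
      have hmap : ∀ Z : Matrix (Fin n ⊕ Fin n) (Fin n ⊕ Fin n) ℝ,
          b'.transpose * Z.map Complex.ofReal + Z.map Complex.ofReal * b' =
            (L Z).map Complex.ofReal := fun Z => by
        ext i j
        simp [hL, b', Matrix.mul_apply, -Fintype.sum_sum_type]
      have e : b'.transpose * S + S * b' =
          (L X).map Complex.ofReal + Complex.I • (L Y).map Complex.ofReal := by
        rw [← hmap, ← hmap]
        simp only [S, mul_add, add_mul, Matrix.mul_smul, Matrix.smul_mul, smul_add]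
        abel
      rw [e, hX, hY]
      ext i j
      simp only [S, hγ, Matrix.add_apply, Matrix.smul_apply, Matrix.map_apply, Matrix.sub_apply,
        smul_eq_mul, Complex.ofReal_add, Complex.ofReal_sub, Complex.ofReal_mul]
      linear_combination (-(b : ℂ) * (Y i j : ℂ)) * Complex.I_mul_I
    -- A generalized eigenvector `w` of `B` outside the kernel of `S` is mapped by `S` to a
    -- generalized eigenvector of `Bᵀ`.
    have hpow : ∀ (ν : ℂ) (k : ℕ) (w : Fin n ⊕ Fin n → ℂ),
        ((Matrix.toLin' b'.transpose - (γ - ν) • 1) ^ k) (Matrix.toLin' S w) =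
          (-1 : ℂ) ^ k • Matrix.toLin' S (((complexAction B - ν • 1) ^ k) w) := by
      intro ν k
      induction k with
      | zero => simp
      | succ k ih =>
        intro w
        have e : (Matrix.toLin' b'.transpose - (γ - ν) • 1) (Matrix.toLin' S w) =
            -Matrix.toLin' S ((complexAction B - ν • 1) w) := by
          have := congrArg (fun M => Matrix.toLin' M w) hS
          simp only [map_add, Matrix.toLin'_mul, LinearMap.add_apply, LinearMap.comp_apply,
            map_smul, LinearMap.smul_apply] at this
          simp only [LinearMap.sub_apply, LinearMap.smul_apply, Module.End.one_apply, map_sub,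
            map_smul, complexAction]
          rw [← sub_eq_zero] at this ⊢
          rw [← this]
          module
        have e2 : ((complexAction B - ν • 1) ^ (k + 1)) w =
            ((complexAction B - ν • 1) ^ k) ((complexAction B - ν • 1) w) := by
          rw [pow_succ]; rfl
        rw [pow_succ, Module.End.mul_apply, e, map_neg, ih, e2, pow_succ]
        module
    obtain ⟨ν, hν, w, hw, hSw⟩ : ∃ ν ∈ AddSubgroup.closure (Set.range μ),
        ∃ w ∈ (complexAction B).maxGenEigenspace ν, Matrix.toLin' S w ≠ 0 := by
      by_contra! hcon
      refine hS0 (Matrix.toLin'.injective ?_)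
      rw [map_zero, ← LinearMap.ker_eq_top, eq_top_iff,
        ← iSup_maxGenEigenspace_log_eq_top hspec hB]
      exact iSup_le fun γ w hw => hcon γ γ.2 w hw
    have hmem : γ - ν ∈ AddSubgroup.closure (Set.range μ) := by
      refine hasEigenvalue_transpose_log_mem hspec hB _ ?_
      refine (Module.End.hasUnifEigenvalue_iff_hasUnifEigenvalue_one (k := ⊤) (by simp)).1 ?_
      intro hbot
      obtain ⟨k, hk⟩ := (Module.End.mem_maxGenEigenspace _ _ _).1 hw
      have : Matrix.toLin' S w ∈ Module.End.maxGenEigenspace (Matrix.toLin' b'.transpose) (γ - ν) :=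
        (Module.End.mem_maxGenEigenspace _ _ _).2 ⟨k, by rw [hpow, hk, map_zero, smul_zero]⟩
      rw [Module.End.maxGenEigenspace, hbot] at this
      exact hSw ((Submodule.mem_bot _).1 this)
    have h0 := eq_zero_of_mem_closure_of_exp_eq_one hres (by simpa using add_mem hmem hν) hab
    exact ⟨by simpa [hγ] using congrArg Complex.re h0, by simpa [hγ] using congrArg Complex.im h0⟩
  · have hd : ∀ i j t, HasDerivAt (fun t => ((C t).transpose * J * C t) i j)
        ((L ((C t).transpose * J * C t)) i j) t := fun i j t => by
      have e : L ((C t).transpose * J * C t) =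
          (C t * B).transpose * J * C t + (C t).transpose * J * (C t * B) := by
        rw [hL, Matrix.transpose_mul]; simp only [Matrix.mul_assoc]
      rw [e, Matrix.add_apply]
      have e1 : ∀ X Y : Matrix (Fin n ⊕ Fin n) (Fin n ⊕ Fin n) ℝ,
          (X.transpose * J * Y) i j = ∑ k, ∑ l, X l i * J l k * Y k j := fun X Y => by
        simp only [Matrix.mul_apply, Finset.sum_mul, Matrix.transpose_apply]
      simp only [e1, ← Finset.sum_add_distrib]
      exact HasDerivAt.fun_sum fun k _ => HasDerivAt.fun_sum fun l _ =>
        ((hCB l i t).mul_const (J l k)).fun_mul (hCB k j t)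
    intro φ t
    have hφ : ∀ M : Matrix (Fin n ⊕ Fin n) (Fin n ⊕ Fin n) ℝ,
        φ M = ∑ i, ∑ j, M i j * φ (Matrix.single i j 1) := fun M => by
      conv_lhs => rw [Matrix.matrix_eq_sum_single M]
      simp only [map_sum]
      refine Finset.sum_congr rfl fun i _ => Finset.sum_congr rfl fun j _ => ?_
      rw [← smul_eq_mul, ← map_smul, Matrix.smul_single, smul_eq_mul, mul_one]
    rw [hφ]
    simp only [fun t => hφ ((C t).transpose * J * C t)]
    exact HasDerivAt.fun_sum fun i _ => HasDerivAt.fun_sum fun j _ => (hd i j t).mul_const _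
  · simp [hC0, hC1, hJ]

theorem IsLogarithm.unique
    (hspec : ∀ z, (complexAction A).HasEigenvalue z → ∃ w, IsLogValue lam μ z w)
    {B' : Matrix (Fin n ⊕ Fin n) (Fin n ⊕ Fin n) ℝ}
    (hB : IsLogarithm A lam μ B) (hB' : IsLogarithm A lam μ B') : B = B' := by
  rw [isLogarithm_iff] at hB hB'
  have h : LinearMap.ker (complexAction B - complexAction B') = ⊤ :=
    eq_top_of_maxGenEigenspace_le (f := complexAction A) fun z hz v hv => by
      obtain ⟨w, hw⟩ := hspec z hz
      rw [LinearMap.mem_ker, LinearMap.sub_apply, hB z w hw v hv, hB' z w hw v hv, sub_self]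
  exact complexAction_injective (sub_eq_zero.1 (LinearMap.ker_eq_top.1 h))

end LogValues

end LewisSternberg

/-! ### Existence of the real logarithm -/

namespace LewisSternberg

section LogExistence

variable {n r : ℕ} {A B : Matrix (Fin n ⊕ Fin n) (Fin n ⊕ Fin n) ℝ} {lam μ : Fin r → ℂ}

theorem im_pos_of_arg {z : ℂ} (h : 0 < z.arg) (h' : z.arg < Real.pi) : 0 < z.im := by
  have h0 : z ≠ 0 := by rintro rfl; simp at h
  rw [← Complex.norm_mul_sin_arg]
  exact mul_pos (norm_pos_iff.2 h0) (Real.sin_pos_of_pos_of_lt_pi h h')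

theorem inv_eq_conj_of_norm_eq_one {z : ℂ} (h : ‖z‖ = 1) : z⁻¹ = (starRingEnd ℂ) z := by
  rw [Complex.inv_def, Complex.normSq_eq_norm_sq, h]; simp

theorem norm_eq_one_of_eq_inv {lam : Fin r → ℂ}
    (hhalf : ∀ j, 1 < ‖lam j‖ ∨ (‖lam j‖ = 1 ∧ 0 < (lam j).im)) {i j : Fin r}
    (h : ‖lam i‖ = ‖(lam j)⁻¹‖) : ‖lam i‖ = 1 ∧ ‖lam j‖ = 1 := by
  rw [norm_inv] at h
  have hge : ∀ j, 1 ≤ ‖lam j‖ := fun j => (hhalf j).elim le_of_lt fun h => h.1.ge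
  have h1 : ‖lam i‖ ≤ 1 := h ▸ inv_le_one_of_one_le₀ (hge j)
  have h2 : ‖lam i‖ = 1 := le_antisymm h1 (hge i)
  rw [h2] at h
  exact ⟨h2, by rw [← inv_inv ‖lam j‖, ← h, inv_one]⟩

theorem ne_inv_of_half {lam : Fin r → ℂ}
    (hhalf : ∀ j, 1 < ‖lam j‖ ∨ (‖lam j‖ = 1 ∧ 0 < (lam j).im)) (i j : Fin r) :
    lam i ≠ (lam j)⁻¹ := fun h => by
  obtain ⟨h1, h2⟩ := norm_eq_one_of_eq_inv hhalf (congrArg norm h)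
  have hi := ((hhalf i).resolve_left (by simp [h1])).2
  have hj := ((hhalf j).resolve_left (by simp [h2])).2
  rw [inv_eq_conj_of_norm_eq_one h2] at h
  rw [h, Complex.conj_im] at hi
  linarith

theorem ne_one_of_half {lam : Fin r → ℂ}
    (hhalf : ∀ j, 1 < ‖lam j‖ ∨ (‖lam j‖ = 1 ∧ 0 < (lam j).im)) (i : Fin r) : lam i ≠ 1 :=
  fun h => ne_inv_of_half hhalf i i (by rw [h, inv_one])

theorem IsLogValue.eq (hinj : Function.Injective lam)
    (hhalf : ∀ j, 1 < ‖lam j‖ ∨ (‖lam j‖ = 1 ∧ 0 < (lam j).im)) {z w w' : ℂ}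
    (h : IsLogValue lam μ z w) (h' : IsLogValue lam μ z w') : w = w' := by
  have h1 := ne_one_of_half hhalf
  have h2 := ne_inv_of_half hhalf
  rcases h with ⟨rfl, rfl⟩ | ⟨j, ⟨rfl, rfl⟩ | ⟨rfl, rfl⟩⟩ <;>
    rcases h' with ⟨e, rfl⟩ | ⟨i, ⟨e, rfl⟩ | ⟨e, rfl⟩⟩
  · rfl
  · exact (h1 i e.symm).elim
  · exact (h1 i (inv_eq_one.1 e.symm)).elim
  · exact (h1 j e).elim
  · rw [hinj e]
  · exact (h2 j i e).elim
  · exact (h1 j (inv_eq_one.1 e)).elim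
  · exact (h2 i j e.symm).elim
  · rw [hinj (inv_injective e)]

/-- The logarithms of conjugate eigenvalues are conjugate. For an eigenvalue on the unit circle
this holds because its logarithm is purely imaginary. -/
theorem IsLogValue.conj (hinj : Function.Injective lam)
    (hhalf : ∀ j, 1 < ‖lam j‖ ∨ (‖lam j‖ = 1 ∧ 0 < (lam j).im))
    (hexp : ∀ j, Complex.exp (μ j) = lam j)
    (hconj : ∀ i j, lam i = (starRingEnd ℂ) (lam j) → μ i = (starRingEnd ℂ) (μ j))
    (hspec : ∀ z : ℂ, z ≠ 1 → ((complexAction A).HasEigenvalue z ↔ ∃ j, z = lam j ∨ z = (lam j)⁻¹))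
    {z w : ℂ} (h : IsLogValue lam μ z w) :
    IsLogValue lam μ ((starRingEnd ℂ) z) ((starRingEnd ℂ) w) := by
  have key : ∀ j, IsLogValue lam μ ((starRingEnd ℂ) (lam j)) ((starRingEnd ℂ) (μ j)) := fun j => by
    have hev := (hspec _ (ne_one_of_half hhalf j)).2 ⟨j, Or.inl rfl⟩
    have hev' : (complexAction A).HasEigenvalue ((starRingEnd ℂ) (lam j)) := by
      obtain ⟨v, hv⟩ := hev.exists_hasEigenvector
      refine Module.End.hasEigenvalue_of_hasEigenvector (x := fun i => (starRingEnd ℂ) (v i))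
        ⟨Module.End.mem_eigenspace_iff.2 ?_, fun h0 => hv.2 ?_⟩
      · ext i
        have := congrArg (starRingEnd ℂ) (congrFun hv.apply_eq_smul i)
        rw [complexAction_apply, map_sum] at this
        rw [complexAction_apply]
        simpa [-Fintype.sum_sum_type] using this
      · ext i
        simpa using congrFun h0 i
    obtain ⟨i, hi | hi⟩ := (hspec _ fun h => ne_one_of_half hhalf j (by
      simpa using congrArg (starRingEnd ℂ) h)).1 hev'
    · rw [hi, ← hconj i j hi.symm]
      exact Or.inr ⟨i, Or.inl ⟨rfl, rfl⟩⟩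
    · obtain ⟨h1, h2⟩ := norm_eq_one_of_eq_inv hhalf (i := j) (j := i) (by rw [← hi]; simp)
      have hij : j = i := hinj (by
        rw [← inv_eq_conj_of_norm_eq_one h1] at hi; exact inv_injective hi)
      subst hij
      have hre : (μ j).re = 0 := by
        rw [← hexp, Complex.norm_exp] at h1
        exact (Real.exp_eq_one_iff _).1 h1
      refine Or.inr ⟨j, Or.inr ⟨hi, ?_⟩⟩
      apply Complex.ext <;> simp [hre]
  rcases h with ⟨rfl, rfl⟩ | ⟨j, ⟨rfl, rfl⟩ | ⟨rfl, rfl⟩⟩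
  · exact Or.inl (by simp)
  · exact key j
  · rcases key j with ⟨h1, h2⟩ | ⟨i, ⟨h1, h2⟩ | ⟨h1, h2⟩⟩
    · exact Or.inl (by simp [h1, h2])
    · exact Or.inr ⟨i, Or.inr (by simp [h1, h2])⟩
    · exact Or.inr ⟨i, Or.inl (by simp [h1, h2])⟩

theorem exists_isLogValue
    (hspec : ∀ z : ℂ, z ≠ 1 → ((complexAction A).HasEigenvalue z ↔ ∃ j, z = lam j ∨ z = (lam j)⁻¹))
    {z : ℂ} (hz : (complexAction A).HasEigenvalue z) : ∃ w, IsLogValue lam μ z w := by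
  by_cases h1 : z = 1
  · exact ⟨0, Or.inl ⟨h1, rfl⟩⟩
  · obtain ⟨j, hj | hj⟩ := (hspec z h1).1 hz
    exacts [⟨μ j, Or.inr ⟨j, Or.inl ⟨hj, rfl⟩⟩⟩, ⟨-μ j, Or.inr ⟨j, Or.inr ⟨hj, rfl⟩⟩⟩]

open Polynomial in
/-- By the Chinese remainder theorem, the logarithm on the various generalized eigenspaces is given
by a single polynomial in `A`. -/
theorem exists_complex_logarithm (w : ℂ → ℂ) :
    ∃ h : ℂ[X], ∀ z, (complexAction A).HasEigenvalue z →
      ∀ v ∈ (complexAction A).maxGenEigenspace z,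
        aeval (complexAction A) h v =
          w z • v + aeval (relNilpotent A z) (truncLog (2 * n)) v := by
  have hfin : Finite {z // (complexAction A).HasEigenvalue z} :=
    (Module.End.finite_hasEigenvalue (complexAction A))
  obtain ⟨h, hh⟩ := Ideal.exists_forall_sub_mem_ideal
    (I := fun z : {z // (complexAction A).HasEigenvalue z} =>
      Ideal.span {(X - C (z : ℂ)) ^ (2 * n)})
    (fun z z' hzz' => by
      rw [Function.onFun, Ideal.isCoprime_span_singleton_iff]
      exact (isCoprime_X_sub_C_of_isUnit_sub
        (sub_ne_zero.2 fun h => hzz' (Subtype.ext h)).isUnit).pow)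
    (fun z => C (w z) + (truncLog (2 * n)).comp (C (z : ℂ)⁻¹ * (X - C (z : ℂ))))
  refine ⟨h, fun z hz v hv => ?_⟩
  obtain ⟨g, hg⟩ := Ideal.mem_span_singleton.1 (hh ⟨z, hz⟩)
  have e : aeval (complexAction A) (C z⁻¹ * (X - C z)) = relNilpotent A z := by
    rw [relNilpotent, ← smul_eq_C_mul, map_smul, map_sub, aeval_X, aeval_C]
  have h0 : aeval (complexAction A) ((X - C z) ^ (2 * n)) v = 0 := by
    rw [map_pow, map_sub, aeval_X, aeval_C]
    exact mem_maxGenEigenspace_complexAction.1 hv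
  rw [sub_eq_iff_eq_add.1 hg, mul_comm, map_add, map_mul, LinearMap.add_apply,
    Module.End.mul_apply, h0, map_zero, zero_add, map_add, aeval_comp, e, aeval_C,
    LinearMap.add_apply, Module.algebraMap_end_apply]

theorem exists_isLogarithm (hinj : Function.Injective lam)
    (hhalf : ∀ j, 1 < ‖lam j‖ ∨ (‖lam j‖ = 1 ∧ 0 < (lam j).im))
    (hexp : ∀ j, Complex.exp (μ j) = lam j)
    (hconj : ∀ i j, lam i = (starRingEnd ℂ) (lam j) → μ i = (starRingEnd ℂ) (μ j))
    (hspec : ∀ z : ℂ, z ≠ 1 → ((complexAction A).HasEigenvalue z ↔ ∃ j, z = lam j ∨ z = (lam j)⁻¹)) :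
    ∃ B, IsLogarithm A lam μ B := by
  choose! w hw using fun z hz => exists_isLogValue (μ := μ) hspec (z := z) hz
  obtain ⟨h, hh⟩ := exists_complex_logarithm (A := A) w
  have hh' : ∀ z, ∀ v ∈ (complexAction A).maxGenEigenspace z, ∀ w', IsLogValue lam μ z w' →
      Polynomial.aeval (complexAction A) h v =
        w' • v + ∑ k ∈ Finset.Icc 1 (2 * n), ((-1 : ℂ) ^ (k + 1) / (k : ℂ)) •
        ((z⁻¹ • (complexAction A - algebraMap ℂ _ z)) ^ k) v := fun z v hv w' hw' => by
    by_cases hz : (complexAction A).HasEigenvalue z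
    · rw [hh z hz v hv, hw'.eq hinj hhalf (hw z hz), truncLog, map_sum, LinearMap.sum_apply]
      congr 1
      refine Finset.sum_congr rfl fun k _ => ?_
      rw [← Polynomial.smul_eq_C_mul, map_smul, map_pow, Polynomial.aeval_X, LinearMap.smul_apply,
        relNilpotent]
    · -- the value at `1` is prescribed even if `1` is not an eigenvalue
      have h' : (complexAction A).maxGenEigenspace z = ⊥ := by
        by_contra hne
        exact hz ((Module.End.hasUnifEigenvalue_iff_hasUnifEigenvalue_one (k := ⊤) (by simp)).1 hne)
      rw [h', Submodule.mem_bot] at hv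
      simp [hv]
  set M := LinearMap.toMatrix' (Polynomial.aeval (complexAction A) h) with hM
  have hMapp : ∀ v, Matrix.toLin' M v = Polynomial.aeval (complexAction A) h v := fun v => by
    rw [hM, Matrix.toLin'_toMatrix']
  -- complex conjugation commutes with `A` and exchanges the generalized eigenspaces of conjugate
  -- eigenvalues
  let cj : (Fin n ⊕ Fin n → ℂ) → (Fin n ⊕ Fin n → ℂ) := fun v i => (starRingEnd ℂ) (v i)
  have hcj_smul : ∀ (c : ℂ) v, cj (c • v) = (starRingEnd ℂ) c • cj v := fun c v => by
    ext i; simp [cj]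
  have hcj_cj : ∀ v, cj (cj v) = v := fun v => by ext i; simp [cj]
  have hcjA : ∀ v, complexAction A (cj v) = cj (complexAction A v) := fun v => by
    ext i
    simp [cj, complexAction_apply, -Fintype.sum_sum_type]
  have hcj_add : ∀ v v', cj (v + v') = cj v + cj v' := fun v v' => by ext i; simp [cj]
  have hcj_sum : ∀ (s : Finset ℕ) (f : ℕ → Fin n ⊕ Fin n → ℂ),
      cj (∑ k ∈ s, f k) = ∑ k ∈ s, cj (f k) := fun s f => by ext i; simp [cj]
  have hpow : ∀ (c z : ℂ) (k : ℕ) v,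
      ((((starRingEnd ℂ) c) • (complexAction A - algebraMap ℂ _ ((starRingEnd ℂ) z))) ^ k) (cj v) =
        cj (((c • (complexAction A - algebraMap ℂ _ z)) ^ k) v) := fun c z k => by
    induction k with
    | zero => intro v; simp
    | succ k ih =>
      intro v
      rw [pow_succ, pow_succ, Module.End.mul_apply, Module.End.mul_apply, ← ih]
      congr 1
      ext i
      have := congrFun (hcjA v) i
      simp only [cj] at this
      simp [cj, this]
  have hcj_mem : ∀ z, ∀ v ∈ (complexAction A).maxGenEigenspace z,
      cj v ∈ (complexAction A).maxGenEigenspace ((starRingEnd ℂ) z) := fun z v hv => by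
    rw [mem_maxGenEigenspace_complexAction] at hv ⊢
    have := hpow 1 z (2 * n) v
    simp only [map_one, one_smul] at this
    rw [this, hv]
    ext i; simp [cj]
  have hreal : M.map (starRingEnd ℂ) = M := by
    refine Matrix.toLin'.injective (sub_eq_zero.1 (LinearMap.ker_eq_top.1 ?_))
    refine eq_top_of_maxGenEigenspace_le (f := complexAction A) fun z hz v hv => ?_
    have e : Matrix.toLin' (M.map (starRingEnd ℂ)) v = cj (Matrix.toLin' M (cj v)) := by
      ext i; simp [cj, Matrix.mulVec, dotProduct, -Fintype.sum_sum_type]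
    rw [LinearMap.mem_ker, LinearMap.sub_apply, e, hMapp, hMapp, hh' z v hv _ (hw z hz),
      hh' _ _ (hcj_mem z v hv) _ ((hw z hz).conj hinj hhalf hexp hconj hspec), sub_eq_zero,
      hcj_add, hcj_smul, Complex.conj_conj, hcj_cj, hcj_sum]
    congr 1
    refine Finset.sum_congr rfl fun k _ => ?_
    rw [← map_inv₀, hpow, hcj_smul, hcj_cj]
    simp
  have hMre : complexAction (M.map Complex.re) = Polynomial.aeval (complexAction A) h := by
    have : (M.map Complex.re).map (fun a : ℝ => (a : ℂ)) = M := by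
      ext i j
      have := congrFun (congrFun hreal i) j
      exact Complex.conj_eq_iff_re.1 this
    rw [complexAction, this]
    exact LinearMap.ext hMapp
  refine ⟨M.map Complex.re, isLogarithm_iff.2 fun z w' hw' v hv => ?_⟩
  rw [hMre]
  exact hh' z v hv w' hw'

end LogExistence

end LewisSternberg

/-! ### Polynomials and smooth functions near the origin -/

namespace LewisSternberg

open MvPolynomial Asymptotics Filter

section Evaluation

variable {ι : Type*}

theorem eval_smul_of_isHomogeneous [Fintype ι] {d : ℕ} {f : MvPolynomial ι ℝ} (hf : f.IsHomogeneous d)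
    (t : ℝ) (ρ : ι → ℝ) : eval (t • ρ) f = t ^ d * eval ρ f := by
  rw [eval_eq, eval_eq, Finset.mul_sum]
  refine Finset.sum_congr rfl fun m hm => ?_
  have h : m.degree = d := by
    by_contra h; exact mem_support_iff.1 hm (hf.coeff_eq_zero h)
  simp only [Pi.smul_apply, smul_eq_mul, mul_pow, Finset.prod_mul_distrib]
  rw [Finset.prod_pow_eq_pow_sum, ← h, Finsupp.degree_apply]
  ring

variable [Fintype ι]

theorem hasFDerivAt_eval (f : MvPolynomial ι ℝ) (ρ : ι → ℝ) :
    HasFDerivAt (fun ρ : ι → ℝ => eval ρ f)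
      (∑ i, eval ρ (pderiv i f) • ContinuousLinearMap.proj (R := ℝ) (φ := fun _ : ι => ℝ) i) ρ := by
  classical
  induction f using MvPolynomial.induction_on with
  | C a => simpa using hasFDerivAt_const a ρ
  | add p q hp hq =>
    simpa [add_smul, Finset.sum_add_distrib] using hp.fun_add hq
  | mul_X p i hp =>
    have h := hp.fun_mul (hasFDerivAt_apply (𝕜 := ℝ) i ρ)
    have e : ∑ j, eval ρ (pderiv j (p * X i)) •
          ContinuousLinearMap.proj (R := ℝ) (φ := fun _ : ι => ℝ) j =
        eval ρ p • ContinuousLinearMap.proj (R := ℝ) (φ := fun _ : ι => ℝ) i + ρ i •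
          ∑ j, eval ρ (pderiv j p) • ContinuousLinearMap.proj (R := ℝ) (φ := fun _ : ι => ℝ) j := by
      simp only [pderiv_mul, pderiv_X, map_add, map_mul, eval_X, add_smul, Finset.sum_add_distrib]
      rw [add_comm, Finset.smul_sum]
      congr 1
      · rw [Finset.sum_eq_single i]
        · simp
        · intro j _ hj; simp [hj.symm]
        · simp
      · exact Finset.sum_congr rfl fun j _ => by rw [mul_comm, mul_smul]
    rw [e]
    simpa only [map_mul, eval_X] using h

theorem fderiv_eval_single [DecidableEq ι] (f : MvPolynomial ι ℝ) (ρ : ι → ℝ) (i : ι) :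
    fderiv ℝ (fun ρ : ι → ℝ => eval ρ f) ρ (Pi.single i 1) = eval ρ (pderiv i f) := by
  rw [(hasFDerivAt_eval f ρ).fderiv]
  simp [Pi.single_apply]

theorem contDiff_eval (f : MvPolynomial ι ℝ) : ContDiff ℝ ∞ (fun ρ : ι → ℝ => eval ρ f) := by
  induction f using MvPolynomial.induction_on with
  | C a => simpa using contDiff_const
  | add p q hp hq => simpa using hp.add hq
  | mul_X p i hp => simpa using hp.mul (contDiff_apply ℝ ℝ i)

theorem exists_abs_eval_le {N : ℕ} {f : MvPolynomial ι ℝ} (hf : f ∈ vanishingIdeal ι N) :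
    ∃ C, 0 ≤ C ∧ ∀ ρ : ι → ℝ, ‖ρ‖ ≤ 1 → |eval ρ f| ≤ C * ‖ρ‖ ^ N := by
  refine ⟨∑ m ∈ f.support, |coeff m f|, Finset.sum_nonneg fun _ _ => abs_nonneg _,
    fun ρ hρ => ?_⟩
  rw [eval_eq', Finset.sum_mul]
  refine (Finset.abs_sum_le_sum_abs _ _).trans (Finset.sum_le_sum fun m hm => ?_)
  rw [abs_mul, Finset.abs_prod]
  refine mul_le_mul_of_nonneg_left ?_ (abs_nonneg _)
  have hN : N ≤ m.degree := not_lt.1 fun h => mem_support_iff.1 hm (mem_vanishingIdeal_iff.1 hf m h)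
  calc ∏ i, |ρ i ^ m i| ≤ ∏ i, ‖ρ‖ ^ m i := by
        refine Finset.prod_le_prod (fun _ _ => abs_nonneg _) fun i _ => ?_
        rw [abs_pow]
        exact pow_le_pow_left₀ (abs_nonneg _) (norm_le_pi_norm ρ i) _
    _ = ‖ρ‖ ^ m.degree := by rw [Finset.prod_pow_eq_pow_sum, Finsupp.degree_eq_sum]
    _ ≤ ‖ρ‖ ^ N := pow_le_pow_of_le_one (norm_nonneg _) hρ hN

theorem eventually_norm_le {E : Type*} [NormedAddCommGroup E] {δ : ℝ} (hδ : 0 < δ) :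
    ∀ᶠ ρ : E in 𝓝 0, ‖ρ‖ ≤ δ := by
  filter_upwards [Metric.closedBall_mem_nhds (0 : E) hδ] with ρ hρ
  simpa using hρ

theorem isBigO_eval {N : ℕ} {f : MvPolynomial ι ℝ} (hf : f ∈ vanishingIdeal ι N) :
    (fun ρ : ι → ℝ => eval ρ f) =O[𝓝 0] fun ρ => ‖ρ‖ ^ N := by
  obtain ⟨C, _, h⟩ := exists_abs_eval_le hf
  refine IsBigO.of_bound C ?_
  filter_upwards [eventually_norm_le one_pos] with ρ hρ
  simpa using h ρ hρ

theorem isBigO_norm_pow_of_le {E : Type*} [NormedAddCommGroup E] {M N : ℕ} (h : M ≤ N) :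
    (fun ρ : E => ‖ρ‖ ^ N) =O[𝓝 0] fun ρ => ‖ρ‖ ^ M := by
  refine IsBigO.of_bound 1 ?_
  filter_upwards [eventually_norm_le (E := E) one_pos] with ρ hρ
  simpa using pow_le_pow_of_le_one (norm_nonneg _) hρ h

theorem isLittleO_norm_pow {E : Type*} [NormedAddCommGroup E] {M N : ℕ} (h : M < N) :
    (fun ρ : E => ‖ρ‖ ^ N) =o[𝓝 0] fun ρ => ‖ρ‖ ^ M :=
  (isLittleO_pow_pow (𝕜 := ℝ) h).comp_tendsto (by simpa using continuous_norm.tendsto (0 : E))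

theorem eq_zero_of_isHomogeneous_of_isLittleO {d : ℕ} {f : MvPolynomial ι ℝ}
    (hf : f.IsHomogeneous d)
    (h : (fun ρ : ι → ℝ => eval ρ f) =o[𝓝 0] fun ρ => ‖ρ‖ ^ d) : f = 0 := by
  refine MvPolynomial.funext fun v => ?_
  rw [map_zero, ← abs_nonpos_iff]
  refine le_of_forall_pos_le_add fun ε hε => ?_
  obtain ⟨c, hc, hcε⟩ : ∃ c > 0, c * ‖v‖ ^ d ≤ ε := by
    refine ⟨ε / (‖v‖ ^ d + 1), by positivity, ?_⟩
    rw [div_mul_eq_mul_div, div_le_iff₀ (by positivity)]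
    nlinarith
  have ht : Tendsto (fun t : ℝ => t • v) (𝓝[>] 0) (𝓝 0) :=
    ((continuous_id.smul continuous_const).tendsto' (0 : ℝ) (0 : ι → ℝ) (by simp)).mono_left
      nhdsWithin_le_nhds
  obtain ⟨t, ht1, ht2⟩ := ((ht.eventually (isLittleO_iff.1 h hc)).and self_mem_nhdsWithin).exists
  have ht0 : 0 < t := ht2
  rw [eval_smul_of_isHomogeneous hf, norm_smul, Real.norm_eq_abs, abs_mul, Real.norm_eq_abs,
    Real.norm_eq_abs, abs_pow, abs_pow, abs_mul, abs_of_pos ht0, abs_norm, mul_pow] at ht1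
  have : t ^ d * |eval v f| ≤ t ^ d * (c * ‖v‖ ^ d) := by
    rw [abs_of_pos ht0] at ht1; linarith
  have := le_of_mul_le_mul_left this (by positivity)
  linarith

theorem mem_vanishingIdeal_of_isLittleO {N : ℕ} {f : MvPolynomial ι ℝ}
    (h : (fun ρ : ι → ℝ => eval ρ f) =o[𝓝 0] fun ρ => ‖ρ‖ ^ N) :
    f ∈ vanishingIdeal ι (N + 1) := by
  have key : ∀ d ≤ N + 1, f ∈ vanishingIdeal ι d := fun d => by
    induction d with
    | zero => exact fun _ => mem_vanishingIdeal_zero f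
    | succ d ih =>
      intro hd
      have hfd := ih (by omega)
      have hr := sub_homogeneousComponent_mem hfd
      have h0 : homogeneousComponent d f = 0 := by
        refine eq_zero_of_isHomogeneous_of_isLittleO (homogeneousComponent_isHomogeneous d f) ?_
        have h1 := h.trans_isBigO (isBigO_norm_pow_of_le (E := ι → ℝ) (by omega : d ≤ N))
        have h2 := (isBigO_eval hr).trans_isLittleO (isLittleO_norm_pow (E := ι → ℝ) d.lt_succ_self)
        simpa using h1.sub h2
      simpa [h0] using hr
  exact key _ le_rfl

theorem mem_vanishingIdeal_of_isBigO {N : ℕ} {f : MvPolynomial ι ℝ}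
    (h : (fun ρ : ι → ℝ => eval ρ f) =O[𝓝 0] fun ρ => ‖ρ‖ ^ N) :
    f ∈ vanishingIdeal ι N := by
  cases N with
  | zero => exact mem_vanishingIdeal_zero f
  | succ N =>
    exact mem_vanishingIdeal_of_isLittleO
      (h.trans_isLittleO (isLittleO_norm_pow (E := ι → ℝ) N.lt_succ_self))

end Evaluation

section Taylor

variable {ι : Type*} [Fintype ι]

/-- The polynomial on the diagonal of a multilinear map. -/
theorem exists_eval_eq_diagonal {k : ℕ} (M : MultilinearMap ℝ (fun _ : Fin k => ι → ℝ) ℝ) :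
    ∃ P : MvPolynomial ι ℝ, ∀ ρ, eval ρ P = M fun _ => ρ := by
  classical
  refine ⟨∑ r : Fin k → ι, C (M fun l => Pi.single (r l) 1) * ∏ l, X (r l), fun ρ => ?_⟩
  have hρ : ρ = ∑ i, ρ i • (Pi.single i 1 : ι → ℝ) := by
    ext j; simp [Finset.sum_apply, Pi.single_apply]
  conv_rhs => rw [hρ]
  rw [MultilinearMap.map_sum M (fun _ i => ρ i • (Pi.single i 1 : ι → ℝ)), map_sum]
  refine Finset.sum_congr rfl fun r _ => ?_
  rw [MultilinearMap.map_smul_univ]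
  simp [mul_comm]

/-- Taylor's formula at the origin. -/
theorem exists_taylor_polynomial {f : (ι → ℝ) → ℝ} {U : Set (ι → ℝ)} (hU : IsOpen U)
    (h0 : 0 ∈ U) (hf : ContDiffOn ℝ ∞ f U) (N : ℕ) :
    ∃ P : MvPolynomial ι ℝ, (fun ρ => f ρ - eval ρ P) =O[𝓝 0] fun ρ => ‖ρ‖ ^ N := by
  have hat : ∀ x ∈ U, ContDiffAt ℝ ∞ f x := fun x hx => hf.contDiffAt (hU.mem_nhds hx)
  choose P hP using fun k : ℕ =>
    exists_eval_eq_diagonal (iteratedFDeriv ℝ k f (0 : ι → ℝ)).toMultilinearMap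
  refine ⟨∑ k ∈ Finset.range (N + 1), C (k.factorial : ℝ)⁻¹ * P k, ?_⟩
  obtain ⟨K, hK⟩ : ∃ K : ℝ, ∀ᶠ x in 𝓝 (0 : ι → ℝ), ‖iteratedFDeriv ℝ (N + 1) f x‖ ≤ K := by
    have hc : ContinuousAt (fun x => ‖iteratedFDeriv ℝ (N + 1) f x‖) 0 :=
      ((hat 0 h0).continuousAt_iteratedFDeriv (k := N + 1)
        (by exact_mod_cast le_top)).norm
    exact ⟨_, (hc.eventually (gt_mem_nhds (lt_add_one _))).mono fun _ h => le_of_lt h⟩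
  obtain ⟨δ, hδ, hball⟩ := Metric.eventually_nhds_iff_ball.1 (hK.and (hU.mem_nhds h0))
  refine (IsBigO.of_bound ((N.factorial : ℝ)⁻¹ * K) ?_).trans
    (isBigO_norm_pow_of_le N.le_succ)
  filter_upwards [Metric.ball_mem_nhds 0 hδ] with ρ hρ
  have hseg : ∀ t ∈ Set.Icc (0 : ℝ) 1, t • ρ ∈ Metric.ball (0 : ι → ℝ) δ := fun t ht => by
    rw [mem_ball_zero_iff] at hρ ⊢
    rw [norm_smul, Real.norm_of_nonneg ht.1]
    exact (mul_le_of_le_one_left (norm_nonneg _) ht.2).trans_lt hρ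
  have h := map_add_eq_sum_add_integral_iteratedFDeriv (f := f) (x := 0) (y := ρ) (n := N)
    fun t ht => by
      rw [zero_add]
      exact (hat _ (hball _ (hseg t ht)).2).of_le (by exact_mod_cast le_top)
  simp only [zero_add] at h
  have hsum : eval ρ (∑ k ∈ Finset.range (N + 1), C (k.factorial : ℝ)⁻¹ * P k) =
      ∑ k ∈ Finset.range (N + 1), (k.factorial : ℝ)⁻¹ • iteratedFDeriv ℝ k f 0 fun _ => ρ := by
    rw [map_sum]
    exact Finset.sum_congr rfl fun k _ => by rw [map_mul, eval_C, hP, smul_eq_mul]; rfl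
  rw [hsum, h, add_sub_cancel_left, norm_smul, Real.norm_of_nonneg (by positivity), mul_assoc]
  refine mul_le_mul_of_nonneg_left ?_ (by positivity)
  rw [Real.norm_of_nonneg (by positivity : 0 ≤ ‖ρ‖ ^ (N + 1))]
  have hint := intervalIntegral.norm_integral_le_of_norm_le_const (a := (0 : ℝ)) (b := 1)
    (f := fun t => (1 - t) ^ N • iteratedFDeriv ℝ (N + 1) f (t • ρ) fun _ => ρ)
    (C := K * ‖ρ‖ ^ (N + 1)) fun t ht => by
      rw [Set.uIoc_of_le zero_le_one] at ht
      have ht' : t ∈ Set.Icc (0 : ℝ) 1 := ⟨ht.1.le, ht.2⟩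
      rw [norm_smul, Real.norm_of_nonneg (by have := ht.2; exact pow_nonneg (by linarith) _)]
      refine (mul_le_of_le_one_left (norm_nonneg _)
        (pow_le_one₀ (by linarith [ht.2]) (by linarith [ht.1]))).trans ?_
      refine ((iteratedFDeriv ℝ (N + 1) f (t • ρ)).le_opNorm _).trans ?_
      rw [Finset.prod_const, Finset.card_univ, Fintype.card_fin]
      exact mul_le_mul_of_nonneg_right (hball _ (hseg t ht')).1 (by positivity)
  simpa using hint

/-- A smooth function which vanishes to order `2 N` has a differential which vanishes to order `N`:
the increment of `f` from `x` along a vector of length `‖x‖ ^ N` is bounded by a multiple of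
`‖x‖ ^ (2 N)`, and so is its difference from the linear approximation. -/
theorem isBigO_fderiv {E : Type*} [NormedAddCommGroup E] [NormedSpace ℝ E] {f : E → ℝ} {U : Set E}
    (hU : IsOpen U) (h0 : 0 ∈ U) (hf : ContDiffOn ℝ ∞ f U) {N : ℕ}
    (hO : f =O[𝓝 0] fun ρ => ‖ρ‖ ^ (2 * N)) :
    (fun ρ => fderiv ℝ f ρ) =O[𝓝 0] fun ρ => ‖ρ‖ ^ N := by
  have hat : ContDiffAt ℝ ∞ f 0 := hf.contDiffAt (hU.mem_nhds h0)
  rcases Nat.eq_zero_or_pos N with rfl | hN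
  · have hc : ContinuousAt (fderiv ℝ f) 0 :=
      ((hat.fderiv_right (m := 1) (WithTop.coe_le_coe.2 (le_top : (1 + 1 : ℕ∞) ≤ ⊤))).continuousAt)
    simpa using hc.isBigO_one ℝ
  obtain ⟨K, t, ht, hLip⟩ :=
    (hat.fderiv_right (m := 1) (WithTop.coe_le_coe.2 (le_top : (1 + 1 : ℕ∞) ≤ ⊤))).exists_lipschitzOnWith
  obtain ⟨C, hC⟩ := isBigO_iff.1 hO
  obtain ⟨δ, hδ, hball⟩ := Metric.eventually_nhds_iff_ball.1
    ((hC.and (hU.mem_nhds h0)).and ht)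
  have hC0 : 0 ≤ |C| := abs_nonneg C
  refine IsBigO.of_bound (|C| * 2 ^ (2 * N) + |C| + K) ?_
  filter_upwards [Metric.ball_mem_nhds (0 : E) (half_pos hδ), eventually_norm_le one_pos] with x hx hx1
  rw [mem_ball_zero_iff] at hx
  rw [Real.norm_of_nonneg (by positivity : (0:ℝ) ≤ ‖x‖ ^ N)]
  have hfb : ∀ y ∈ Metric.ball (0 : E) δ, |f y| ≤ |C| * ‖y‖ ^ (2 * N) := fun y hy => by
    have h1 := (hball y hy).1.1
    rw [Real.norm_of_nonneg (by positivity : (0:ℝ) ≤ ‖y‖ ^ (2 * N)), Real.norm_eq_abs] at h1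
    exact h1.trans (mul_le_mul_of_nonneg_right (le_abs_self C) (by positivity))
  have hxb : x ∈ Metric.ball (0 : E) δ := by rw [mem_ball_zero_iff]; linarith
  -- the estimate for increments of length `‖x‖ ^ N`
  have key : ∀ v : E, ‖v‖ = ‖x‖ ^ N →
      |fderiv ℝ f x v| ≤ (|C| * 2 ^ (2 * N) + |C| + K) * ‖x‖ ^ N * ‖v‖ := fun v hv => by
    have hvx : ‖v‖ ≤ ‖x‖ := by
      rw [hv]; exact pow_le_of_le_one (norm_nonneg _) hx1 hN.ne'
    have hyx : ‖x + v‖ ≤ 2 * ‖x‖ := (norm_add_le _ _).trans (by linarith)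
    have hyb : x + v ∈ Metric.ball (0 : E) δ := by rw [mem_ball_zero_iff]; linarith
    have hseg : segment ℝ x (x + v) ⊆ Metric.ball (0 : E) δ :=
      (convex_ball (0 : E) δ).segment_subset hxb hyb
    have hT := Convex.norm_image_sub_le_of_norm_fderiv_le' (𝕜 := ℝ) (f := f)
      (s := segment ℝ x (x + v)) (φ := fderiv ℝ f x) (C := K * ‖v‖) (x := x) (y := x + v)
      (fun y hy => (hf.contDiffAt (hU.mem_nhds (hball y (hseg hy)).1.2)).differentiableAt
        (by simp)) (fun y hy => by
          have h1 := hLip.dist_le_mul y (hball y (hseg hy)).2 x (hball x hxb).2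
          rw [dist_eq_norm, dist_eq_norm] at h1
          refine h1.trans (mul_le_mul_of_nonneg_left ?_ K.2)
          have := norm_sub_le_of_mem_segment hy
          simpa using this)
      (convex_segment _ _) (left_mem_segment _ _ _) (right_mem_segment _ _ _)
    rw [add_sub_cancel_left, Real.norm_eq_abs] at hT
    have h1 := hfb x hxb
    have h2 := hfb _ hyb
    have h3 : ‖x + v‖ ^ (2 * N) ≤ 2 ^ (2 * N) * ‖x‖ ^ (2 * N) := by
      rw [← mul_pow]; exact pow_le_pow_left₀ (norm_nonneg _) hyx _
    have h4 : ‖x‖ ^ (2 * N) = ‖x‖ ^ N * ‖v‖ := by rw [hv]; ring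
    have h5 : |C| * ‖x + v‖ ^ (2 * N) ≤ |C| * 2 ^ (2 * N) * (‖x‖ ^ N * ‖v‖) := by
      rw [← h4, mul_assoc]; exact mul_le_mul_of_nonneg_left h3 hC0
    rw [h4] at h1
    have h6 : (K : ℝ) * ‖v‖ * ‖v‖ = K * (‖x‖ ^ N * ‖v‖) := by rw [hv]; ring
    rw [h6] at hT
    calc |fderiv ℝ f x v| = |(f (x + v) - f x) - (f (x + v) - f x - fderiv ℝ f x v)| := by
          congr 1; ring
      _ ≤ |f (x + v) - f x| + |f (x + v) - f x - fderiv ℝ f x v| := abs_sub _ _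
      _ ≤ (|f (x + v)| + |f x|) + |f (x + v) - f x - fderiv ℝ f x v| := by
          gcongr; exact abs_sub _ _
      _ ≤ _ := by linarith
  refine ContinuousLinearMap.opNorm_le_bound _ (by positivity) fun v => ?_
  rcases eq_or_ne x 0 with rfl | hx0
  · have hd : HasFDerivAt f (0 : E →L[ℝ] ℝ) 0 := by
      refine IsBigO.hasFDerivAt (n := 2 * N) (by simpa using hO) (by omega)
    simp [hd.fderiv]; positivity
  rcases eq_or_ne v 0 with rfl | hv0
  · simp
  have hxn : 0 < ‖x‖ := norm_pos_iff.2 hx0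
  have hvn : 0 < ‖v‖ := norm_pos_iff.2 hv0
  have h := key ((‖x‖ ^ N / ‖v‖) • v) (by
    rw [norm_smul, Real.norm_of_nonneg (by positivity), div_mul_cancel₀ _ hvn.ne'])
  rw [map_smul, smul_eq_mul, abs_mul, norm_smul, Real.norm_eq_abs,
    abs_of_pos (by positivity : 0 < ‖x‖ ^ N / ‖v‖), ← mul_assoc,
    mul_comm _ (‖x‖ ^ N / ‖v‖), mul_assoc] at h
  exact le_of_mul_le_mul_left h (by positivity)

end Taylor

end LewisSternberg

/-! ### The formal problem -/

namespace LewisSternberg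

open MvPolynomial

section Hamiltonian

variable {n : ℕ}

/-- A homogeneous vector field which is an infinitesimal canonical transformation has a homogeneous
Hamilton function, by the Poincaré lemma. -/
theorem exists_poisson_X_eq {m : ℕ} {V : Fin n ⊕ Fin n → PhasePoly n}
    (hV : ∀ i, (V i).IsHomogeneous m)
    (h : ∀ i j, poisson (V i) (X j) + poisson (X i) (V j) = 0) :
    ∃ q : PhasePoly n, q.IsHomogeneous (m + 1) ∧ ∀ i, poisson q (X i) = V i := by
  let G : Fin n ⊕ Fin n → PhasePoly n := Sum.elim (fun j => -V (Sum.inr j)) fun j => V (Sum.inl j)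
  have hG : ∀ i, (G i).IsHomogeneous m := by
    rintro (j | j)
    · exact (hV _).neg
    · exact hV _
  have hclosed : ∀ i k, pderiv i (G k) = pderiv k (G i) := by
    have h' : ∀ i j, poisson (V i) (X j) = poisson (V j) (X i) := fun i j => by
      have := h i j
      rwa [poisson_antisymm (X i), ← sub_eq_add_neg, sub_eq_zero] at this
    rintro (i | i) (k | k)
    · simpa [G, poisson_X_inr] using h' (Sum.inr k) (Sum.inr i)
    · simpa [G, poisson_X_inr, poisson_X_inl, neg_eq_iff_eq_neg] using h' (Sum.inl k) (Sum.inr i)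
    · simpa [G, poisson_X_inr, poisson_X_inl, neg_eq_iff_eq_neg] using h' (Sum.inr k) (Sum.inl i)
    · simpa [G, poisson_X_inl] using h' (Sum.inl k) (Sum.inl i)
  let q : PhasePoly n := ((m : ℝ) + 1)⁻¹ • ∑ k, X k * G k
  have hm : (m : ℝ) + 1 ≠ 0 := by positivity
  have hq : ∀ i, pderiv i q = G i := fun i => by
    have e : pderiv i (∑ k, X k * G k) = G i + ∑ k, X k * pderiv k (G i) := by
      simp only [map_sum, pderiv_mul, pderiv_X, Finset.sum_add_distrib, hclosed i]
      congr 1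
      simp [Pi.single_apply, ite_mul, -Fintype.sum_sum_type]
    rw [Derivation.map_smul, e, (hG i).sum_X_mul_pderiv, ← Nat.cast_smul_eq_nsmul ℝ]
    rw [← one_smul ℝ (G i), smul_smul, ← add_smul, smul_smul]
    congr 1
    field_simp
    ring
  refine ⟨q, ?_, ?_⟩
  · rw [← mem_homogeneousSubmodule]
    refine Submodule.smul_mem _ _ (Submodule.sum_mem _ fun k _ => ?_)
    rw [mem_homogeneousSubmodule, add_comm]
    exact (isHomogeneous_X ℝ k).mul (hG k)
  · rintro (j | j)
    · rw [poisson_X_inl, hq]; rfl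
    · rw [poisson_X_inr, hq]; simp [G]

theorem sum_smul_sum_smul {ι M : Type*} [Fintype ι] [AddCommGroup M] [Module ℝ M]
    (A A' : Matrix ι ι ℝ) (W : ι → M) (i : ι) :
    ∑ k, A i k • ∑ l, A' k l • W l = ∑ l, (A * A') i l • W l := by
  simp only [Finset.smul_sum, smul_smul, Matrix.mul_apply, Finset.sum_smul]
  exact Finset.sum_comm

theorem sum_one_smul {ι M : Type*} [Fintype ι] [DecidableEq ι] [AddCommGroup M] [Module ℝ M]
    (W : ι → M) (i : ι) : ∑ l, (1 : Matrix ι ι ℝ) i l • W l = W i := by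
  rw [Finset.sum_eq_single i]
  · simp
  · intro j _ hj; simp [Matrix.one_apply_ne hj.symm]
  · simp

/-- The version of `exists_poisson_X_eq` for the linear coordinates with coefficient matrix `A`. -/
theorem exists_poisson_linForm_eq {A A' : Matrix (Fin n ⊕ Fin n) (Fin n ⊕ Fin n) ℝ}
    (hA : A' * A = 1) {m : ℕ} {W : Fin n ⊕ Fin n → PhasePoly n} (hW : ∀ i, (W i).IsHomogeneous m)
    (h : ∀ i j, poisson (W i) (linForm (A j)) + poisson (linForm (A i)) (W j) = 0) :
    ∃ q : PhasePoly n, q.IsHomogeneous (m + 1) ∧ ∀ i, poisson q (linForm (A i)) = W i := by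
  have hX : ∀ i, X i = ∑ l, A' i l • linForm (A l) := fun i => by
    simp only [linForm]
    rw [sum_smul_sum_smul, hA, sum_one_smul]
  obtain ⟨q, hq, hqV⟩ := exists_poisson_X_eq (V := fun i => ∑ k, A' i k • W k) (m := m)
    (fun i => by
      rw [← mem_homogeneousSubmodule]
      exact Submodule.sum_mem _ fun k _ => Submodule.smul_mem _ _ (hW k))
    (fun i j => by
      rw [hX i, hX j]
      simp only [poisson_sum_left, poisson_smul_left, map_sum, Derivation.map_smul]
      rw [← Finset.sum_add_distrib]
      refine Finset.sum_eq_zero fun k _ => ?_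
      rw [← smul_add, ← Finset.sum_add_distrib]
      refine smul_eq_zero_of_right _ (Finset.sum_eq_zero fun l _ => ?_)
      rw [← smul_add, h, smul_zero])
  refine ⟨q, hq, fun i => ?_⟩
  rw [linForm, map_sum]
  simp only [Derivation.map_smul, hqV]
  rw [sum_smul_sum_smul, mul_eq_one_comm.1 hA, sum_one_smul]

theorem eq_zero_of_poisson_linForm_eq_zero {A A' : Matrix (Fin n ⊕ Fin n) (Fin n ⊕ Fin n) ℝ}
    (hA : A' * A = 1) {m : ℕ} {q : PhasePoly n} (hq : q.IsHomogeneous (m + 1))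
    (h : ∀ i, poisson q (linForm (A i)) = 0) : q = 0 := by
  have hX : ∀ i, poisson q (X i) = 0 := fun i => by
    have e : X i = ∑ l, A' i l • linForm (A l) := by
      simp only [linForm]
      rw [sum_smul_sum_smul, hA, sum_one_smul]
    rw [e, map_sum]
    exact Finset.sum_eq_zero fun l _ => by rw [Derivation.map_smul, h, smul_zero]
  have hd : ∀ i, pderiv i q = 0 := by
    rintro (j | j)
    · simpa [poisson_X_inr] using hX (Sum.inr j)
    · simpa [poisson_X_inl] using hX (Sum.inl j)
  have := hq.sum_X_mul_pderiv
  simp only [hd, mul_zero, Finset.sum_const_zero] at this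
  exact (smul_eq_zero.1 this.symm).resolve_left (Nat.succ_ne_zero m)

end Hamiltonian

section Generators

variable {n : ℕ} {p₀ : PhasePoly n} {B A' : Matrix (Fin n ⊕ Fin n) (Fin n ⊕ Fin n) ℝ}
  {C : ℝ → Matrix (Fin n ⊕ Fin n) (Fin n ⊕ Fin n) ℝ}

/-- Up to terms of order `N`, the time-one map of the formal Hamilton flow of `p` has the components
`K i`. -/
def GeneratesJet (p : PhasePoly n) (K : Fin n ⊕ Fin n → PhasePoly n) (N : ℕ) : Prop :=
  ∀ i F, IsJetFlow p N (X i) F → F 1 - K i ∈ vanishingIdeal _ N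

theorem IsJetFlow.sub_mem {p f : PhasePoly n} (hp : p ∈ vanishingIdeal _ 2) {M N : ℕ} (h : M ≤ N)
    {F G : ℝ → PhasePoly n} (hF : IsJetFlow p M f F) (hG : IsJetFlow p N f G) (t : ℝ) :
    F t - G t ∈ vanishingIdeal _ M := by
  refine mem_vanishingIdeal_of_hasPolyDeriv hp (hF.deriv.sub hG.deriv) (fun t => ?_)
    (by simp [hF.init, hG.init]) t
  have e : trunc M (poisson p (F t)) - trunc N (poisson p (G t)) - poisson p (F t - G t) =
      (trunc M (poisson p (F t)) - poisson p (F t)) -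
        (trunc N (poisson p (G t)) - poisson p (G t)) := by
    rw [map_sub]; abel
  rw [e]
  exact Ideal.sub_mem _ (trunc_sub_mem _ _) (vanishingIdeal_mono h (trunc_sub_mem _ _))

theorem mem_vanishingIdeal_two (hp₀ : p₀.IsHomogeneous 2) {p : PhasePoly n}
    (hp : p - p₀ ∈ vanishingIdeal _ 3) : p ∈ vanishingIdeal (Fin n ⊕ Fin n) 2 := by
  simpa using Ideal.add_mem _ (vanishingIdeal_mono (by omega) hp) hp₀.mem_vanishingIdeal

/-- The inductive step in the construction of `p`: a generator of the jet of order `m` is corrected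
by a homogeneous polynomial of degree `m + 1`. The error of order `m` is an infinitesimal canonical
transformation, since both the flow and `K` preserve the Poisson bracket, and its Hamilton
function is `∫ e ^ (t H) s dt` for a suitable `s`, by the absence of resonances. -/
theorem GeneratesJet.exists_succ (hp₀ : p₀.IsHomogeneous 2)
    (hB : ∀ i, poisson p₀ (X i) = linForm (B i)) (hC0 : C 0 = 1)
    (hC : ∀ i k t, HasDerivAt (fun t => C t i k) ((C t * B) i k) t) (hA : A' * C 1 = 1)
    {Γ : AddSubgroup ℂ}
    (hΓ : ∀ γ, Module.End.HasEigenvalue (Matrix.toLin' (B.map Complex.ofReal).transpose) γ → γ ∈ Γ)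
    (hexp : ∀ γ ∈ Γ, Complex.exp γ = 1 → γ = 0) {p : PhasePoly n} {m : ℕ} (hm : 2 ≤ m)
    (hp : p - p₀ ∈ vanishingIdeal _ 3) {K : Fin n ⊕ Fin n → PhasePoly n}
    (hK : ∀ i j, poisson (K i) (K j) - poisson (X i) (X j) ∈ vanishingIdeal _ m)
    (h : GeneratesJet p K m) :
    ∃ s : PhasePoly n, s.IsHomogeneous (m + 1) ∧ GeneratesJet (p + s) K (m + 1) := by
  have hp2 := mem_vanishingIdeal_two hp₀ hp
  choose F hF using fun i : Fin n ⊕ Fin n => exists_isJetFlow p (m + 1) (X i)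
  set R := fun i => K i - F i 1 with hRdef
  have hR : ∀ i, R i ∈ vanishingIdeal _ m := fun i => by
    obtain ⟨F', hF'⟩ := exists_isJetFlow p m (X i)
    have e : R i = -((F' 1 - K i) - (F' 1 - F i 1)) := by simp only [hRdef]; abel
    rw [e]
    exact neg_mem (Ideal.sub_mem _ (h i F' hF') (hF'.sub_mem hp2 m.le_succ (hF i) 1))
  set W := fun i => homogeneousComponent m (R i) with hWdef
  have hWh : ∀ i, (W i).IsHomogeneous m := fun i => homogeneousComponent_isHomogeneous m _
  have hRW : ∀ i, R i - W i ∈ vanishingIdeal _ (m + 1) := fun i =>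
    sub_homogeneousComponent_mem (hR i)
  have hF1 : ∀ i, F i 1 ∈ vanishingIdeal _ 1 := fun i =>
    (hF i).mem_vanishingIdeal_one hp2 (by omega) 1
  have hFy : ∀ i, F i 1 - linForm (C 1 i) ∈ vanishingIdeal _ 2 := fun i =>
    (hF i).sub_linForm_mem hp₀ hB hC0 hC hp (by omega) 1
  have hy : ∀ i, linForm (C 1 i) ∈ vanishingIdeal _ 1 := fun i =>
    (linForm_isHomogeneous _).mem_vanishingIdeal
  have hWeq : ∀ i j, poisson (W i) (linForm (C 1 j)) + poisson (linForm (C 1 i)) (W j) = 0 := by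
    intro i j
    have hhom : (poisson (W i) (linForm (C 1 j)) +
        poisson (linForm (C 1 i)) (W j)).IsHomogeneous (m - 1) := by
      obtain ⟨k, rfl⟩ := Nat.exists_eq_add_of_le' (by omega : 1 ≤ m)
      refine IsHomogeneous.add ?_ ?_
      · exact poisson_isHomogeneous (hWh i) (linForm_isHomogeneous (C 1 j))
      · rw [show k + 1 - 1 = 0 + k by omega]
        exact poisson_isHomogeneous (linForm_isHomogeneous (C 1 i)) (hWh j)
    refine hhom.eq_zero_of_mem (N := m) ?_ (by omega)
    have hFF : poisson (F i 1) (F j 1) - poisson (X i) (X j) ∈ vanishingIdeal _ m :=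
      (hF i).poisson_sub_mem hp2 (by omega) (hF j) 1
    have hKF : ∀ i, K i = F i 1 + R i := fun i => by simp [hRdef]
    have e : poisson (W i) (linForm (C 1 j)) + poisson (linForm (C 1 i)) (W j) =
        (poisson (K i) (K j) - poisson (X i) (X j)) -
        (poisson (F i 1) (F j 1) - poisson (X i) (X j)) - poisson (R i) (R j) -
        poisson (R i) (F j 1 - linForm (C 1 j)) - poisson (F i 1 - linForm (C 1 i)) (R j) -
        poisson (R i - W i) (linForm (C 1 j)) - poisson (linForm (C 1 i)) (R j - W j) := by
      simp only [hKF, map_add, map_sub, poisson_add_left, poisson_sub_left]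
      abel
    rw [e]
    refine Ideal.sub_mem _ (Ideal.sub_mem _ (Ideal.sub_mem _ (Ideal.sub_mem _ (Ideal.sub_mem _
      (Ideal.sub_mem _ (hK i j) hFF) ?_) ?_) ?_) ?_) ?_
    · exact poisson_mem_vanishingIdeal (hR i) (hR j) (by omega)
    · exact poisson_mem_vanishingIdeal (hR i) (hFy j) (by omega)
    · exact poisson_mem_vanishingIdeal (hFy i) (hR j) (by omega)
    · exact poisson_mem_vanishingIdeal (hRW i) (hy j) (by omega)
    · exact poisson_mem_vanishingIdeal (hy i) (hRW j) (by omega)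
  obtain ⟨q, hq, hqW⟩ := exists_poisson_linForm_eq hA hWh hWeq
  obtain ⟨T, hT, hTQ⟩ := exists_bijective_poisson_integral hp₀ hB hΓ hexp m
  obtain ⟨s, hs⟩ := hT.2 ⟨q, hq⟩
  obtain ⟨Q, hQ, hQ0, hQh, hQ1⟩ := hTQ s
  rw [hs] at hQ1
  refine ⟨s, s.2, fun i G hG => ?_⟩
  have hvar := IsJetFlow.variation hp₀ hB hC0 hC hm hp s.2 (q := p + s) (by simp) hQ hQ0 hQh le_rfl
    (hF i) hG 1
  rw [hQ1, hqW] at hvar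
  have e : G 1 - K i = (G 1 - F i 1 - W i) - (R i - W i) := by simp only [hRdef]; abel
  rw [e]
  exact Ideal.sub_mem _ hvar (hRW i)

theorem GeneratesJet.mono (hp₀ : p₀.IsHomogeneous 2) {p : PhasePoly n}
    (hp : p - p₀ ∈ vanishingIdeal _ 3) {K K' : Fin n ⊕ Fin n → PhasePoly n} {M N : ℕ} (hMN : M ≤ N)
    (hK : ∀ i, K i - K' i ∈ vanishingIdeal _ M) (h : GeneratesJet p K N) :
    GeneratesJet p K' M := fun i F hF => by
  obtain ⟨G, hG⟩ := exists_isJetFlow p N (X i)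
  have e : F 1 - K' i = (F 1 - G 1) + (G 1 - K i) + (K i - K' i) := by abel
  rw [e]
  exact Ideal.add_mem _ (Ideal.add_mem _ (hF.sub_mem (mem_vanishingIdeal_two hp₀ hp) hMN hG 1)
    (vanishingIdeal_mono hMN (h i G hG))) (hK i)

/-- The quadratic part generates the linear part. -/
theorem generatesJet_two (hp₀ : p₀.IsHomogeneous 2)
    (hB : ∀ i, poisson p₀ (X i) = linForm (B i)) (hC0 : C 0 = 1)
    (hC : ∀ i k t, HasDerivAt (fun t => C t i k) ((C t * B) i k) t)
    {K : Fin n ⊕ Fin n → PhasePoly n}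
    (hK : ∀ i, K i - linForm (C 1 i) ∈ vanishingIdeal _ 2) : GeneratesJet p₀ K 2 := fun i F hF => by
  have h := hF.sub_linForm_mem hp₀ hB hC0 hC (by simp) le_rfl 1
  rw [← sub_sub_sub_cancel_right _ _ (linForm (C 1 i))]
  exact Ideal.sub_mem _ h (hK i)

/-- Solution of the formal problem, given the jets `K m` of a formal canonical transformation. -/
theorem exists_generatesJet (hp₀ : p₀.IsHomogeneous 2)
    (hB : ∀ i, poisson p₀ (X i) = linForm (B i)) (hC0 : C 0 = 1)
    (hC : ∀ i k t, HasDerivAt (fun t => C t i k) ((C t * B) i k) t) (hA : A' * C 1 = 1)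
    {Γ : AddSubgroup ℂ}
    (hΓ : ∀ γ, Module.End.HasEigenvalue (Matrix.toLin' (B.map Complex.ofReal).transpose) γ → γ ∈ Γ)
    (hexp : ∀ γ ∈ Γ, Complex.exp γ = 1 → γ = 0) {K : ℕ → Fin n ⊕ Fin n → PhasePoly n}
    (hK2 : ∀ i, K 2 i - linForm (C 1 i) ∈ vanishingIdeal _ 2)
    (hK : ∀ m i j, poisson (K (m + 1) i) (K (m + 1) j) - poisson (X i) (X j) ∈ vanishingIdeal _ m)
    (hKK : ∀ m i, K m i - K (m + 1) i ∈ vanishingIdeal _ m) :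
    ∃ s : ℕ → PhasePoly n, (∀ m, (s m).IsHomogeneous (m + 3)) ∧
      ∀ m, GeneratesJet (p₀ + ∑ k ∈ Finset.range m, s k) (K (m + 2)) (m + 2) := by
  have step : ∀ m (p : {p : PhasePoly n //
      p - p₀ ∈ vanishingIdeal _ 3 ∧ GeneratesJet p (K (m + 2)) (m + 2)}),
      ∃ s : PhasePoly n, s.IsHomogeneous (m + 3) ∧
        GeneratesJet (p.1 + s) (K (m + 3)) (m + 3) := fun m p =>
    GeneratesJet.exists_succ hp₀ hB hC0 hC hA hΓ hexp (by omega) p.2.1 (hK (m + 2))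
      (p.2.2.mono hp₀ p.2.1 le_rfl (hKK (m + 2)))
  choose s hs hgen using step
  let P : ∀ m, {p : PhasePoly n //
      p - p₀ ∈ vanishingIdeal _ 3 ∧ GeneratesJet p (K (m + 2)) (m + 2)} := fun m =>
    Nat.rec ⟨p₀, by simp, generatesJet_two hp₀ hB hC0 hC hK2⟩
      (fun m p => ⟨p.1 + s m p, by
        rw [add_sub_right_comm]
        exact Ideal.add_mem _ p.2.1 (vanishingIdeal_mono (by omega) (hs m p).mem_vanishingIdeal),
        hgen m p⟩) m
  refine ⟨fun m => s m (P m), fun m => hs m _, fun m => ?_⟩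
  have hP : ∀ m, (P m).1 = p₀ + ∑ k ∈ Finset.range m, s k (P k) := fun m => by
    induction m with
    | zero => simp [P]
    | succ m ih => rw [Finset.sum_range_succ, ← add_assoc, ← ih]
  rw [← hP]
  exact (P m).2.2

/-- Uniqueness in the formal problem. -/
theorem GeneratesJet.sub_mem (hp₀ : p₀.IsHomogeneous 2)
    (hB : ∀ i, poisson p₀ (X i) = linForm (B i)) (hC0 : C 0 = 1)
    (hC : ∀ i k t, HasDerivAt (fun t => C t i k) ((C t * B) i k) t) (hA : A' * C 1 = 1)
    {Γ : AddSubgroup ℂ}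
    (hΓ : ∀ γ, Module.End.HasEigenvalue (Matrix.toLin' (B.map Complex.ofReal).transpose) γ → γ ∈ Γ)
    (hexp : ∀ γ ∈ Γ, Complex.exp γ = 1 → γ = 0) {p q : PhasePoly n}
    (hp : p - p₀ ∈ vanishingIdeal _ 3) (hq : q - p₀ ∈ vanishingIdeal _ 3)
    {K : Fin n ⊕ Fin n → PhasePoly n} {N : ℕ} (hpK : GeneratesJet p K N) (hqK : GeneratesJet q K N) :
    q - p ∈ vanishingIdeal _ (N + 1) := by
  have h3 : q - p ∈ vanishingIdeal _ 3 := by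
    rw [← sub_sub_sub_cancel_right _ _ p₀]; exact Ideal.sub_mem _ hq hp
  have key : ∀ k, k ≤ N + 1 → q - p ∈ vanishingIdeal _ k := fun k => by
    induction k with
    | zero => exact fun _ => mem_vanishingIdeal_zero _
    | succ k ih =>
      intro hk
      rcases Nat.lt_or_ge k 3 with hk3 | hk3
      · exact vanishingIdeal_mono (by omega) h3
      obtain ⟨m, rfl⟩ := Nat.exists_eq_add_of_le' (by omega : 1 ≤ k)
      have hmem := ih (by omega)
      set s := homogeneousComponent (m + 1) (q - p) with hs
      have hsh : s.IsHomogeneous (m + 1) := homogeneousComponent_isHomogeneous _ _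
      have hrem : q - p - s ∈ vanishingIdeal _ (m + 2) := sub_homogeneousComponent_mem hmem
      obtain ⟨T, hT, hTQ⟩ := exists_bijective_poisson_integral hp₀ hB hΓ hexp m
      obtain ⟨Q, hQ, hQ0, hQh, hQ1⟩ := hTQ ⟨s, hsh⟩
      have hQ1' : Q 1 = 0 := eq_zero_of_poisson_linForm_eq_zero hA (hQh 1) fun i => by
        obtain ⟨F, hF⟩ := exists_isJetFlow p N (X i)
        obtain ⟨G, hG⟩ := exists_isJetFlow q N (X i)
        have hvar := IsJetFlow.variation hp₀ hB hC0 hC (by omega) hp hsh hrem hQ hQ0 hQh (by omega)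
          hF hG 1
        have hhom := poisson_isHomogeneous (hQh 1) (linForm_isHomogeneous (C 1 i))
        refine hhom.eq_zero_of_mem (N := m + 1) ?_ (by omega)
        have e : poisson (Q 1) (linForm (C 1 i)) =
            (G 1 - K i) - (F 1 - K i) - (G 1 - F 1 - poisson (Q 1) (linForm (C 1 i))) := by abel
        rw [e]
        exact Ideal.sub_mem _ (Ideal.sub_mem _ (vanishingIdeal_mono (by omega) (hqK i G hG))
          (vanishingIdeal_mono (by omega) (hpK i F hF))) hvar
      have hs0 : (⟨s, hsh⟩ : homogeneousSubmodule (Fin n ⊕ Fin n) ℝ (m + 1)) = 0 :=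
        hT.1 (by rw [map_zero]; exact Subtype.ext (hQ1.symm.trans hQ1'))
      have hs0' : s = 0 := congrArg Subtype.val hs0
      rwa [hs0', sub_zero] at hrem
  exact key _ le_rfl

end Generators

end LewisSternberg

/-! ### Smooth functions with a prescribed Taylor series -/

namespace LewisSternberg

open MvPolynomial Asymptotics Filter

/-- Borel's theorem: the Taylor series of a smooth function, which may be taken with compact
support, is arbitrary. The function is `∑ χ (l_d ρ) P_d (ρ)`, where `χ` is a cutoff function and
the `l_d` grow rapidly. -/
theorem exists_smooth_of_homogeneous {ι : Type*} [Fintype ι] (P : ℕ → MvPolynomial ι ℝ)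
    (hP : ∀ d, (P d).IsHomogeneous d) :
    ∃ f : (ι → ℝ) → ℝ, ContDiff ℝ ∞ f ∧ HasCompactSupport f ∧
      ∀ N, (fun ρ => f ρ - eval ρ (∑ d ∈ Finset.range N, P d)) =O[𝓝 0] fun ρ => ‖ρ‖ ^ N := by
  let χ : ContDiffBump (0 : ι → ℝ) := ⟨1, 2, one_pos, one_lt_two⟩
  let φ : ℕ → (ι → ℝ) → ℝ := fun d ρ => χ ρ * eval ρ (P d)
  have hφ : ∀ d, ContDiff ℝ ∞ (φ d) := fun d => χ.contDiff.mul (contDiff_eval _)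
  have hφc : ∀ d, HasCompactSupport (φ d) := fun d => χ.hasCompactSupport.mul_right
  have hM : ∀ d k, ∃ M, ∀ x, ‖iteratedFDeriv ℝ k (φ d) x‖ ≤ M := fun d k =>
    ((hφ d).continuous_iteratedFDeriv (by exact_mod_cast le_top)).bounded_above_of_compact_support
      ((hφc d).iteratedFDeriv k)
  choose M hM using hM
  have hM0 : ∀ d k, 0 ≤ M d k := fun d k => (norm_nonneg _).trans (hM d k 0)
  choose c hc0 hc using fun d => exists_abs_eval_le (hP d).mem_vanishingIdeal
  let l : ℕ → ℝ := fun d => 1 + 2 ^ d * ∑ k ∈ Finset.range d, M d k + 4 ^ d * c d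
  have hS0 : ∀ d, 0 ≤ (2 : ℝ) ^ d * ∑ k ∈ Finset.range d, M d k := fun d =>
    mul_nonneg (by positivity) (Finset.sum_nonneg fun k _ => hM0 d k)
  have hC0 : ∀ d, 0 ≤ 4 ^ d * c d := fun d => mul_nonneg (by positivity) (hc0 d)
  have hl1 : ∀ d, 1 ≤ l d := fun d => by simp only [l]; linarith [hS0 d, hC0 d]
  have hlM : ∀ d k, k < d → 2 ^ d * M d k ≤ l d := fun d k hk => by
    have : M d k ≤ ∑ k ∈ Finset.range d, M d k :=
      Finset.single_le_sum (fun k _ => hM0 d k) (Finset.mem_range.2 hk)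
    have := mul_le_mul_of_nonneg_left this (by positivity : (0:ℝ) ≤ 2 ^ d)
    simp only [l]; linarith [hS0 d, hC0 d]
  have hlc : ∀ d, 4 ^ d * c d ≤ l d := fun d => by simp only [l]; linarith [hS0 d]
  have hl0 : ∀ d, 0 < l d := fun d => one_pos.trans_le (hl1 d)
  let f : ℕ → (ι → ℝ) → ℝ := fun d ρ => χ (l d • ρ) * eval ρ (P d)
  have hfφ : ∀ d, f d = fun ρ => ((l d) ^ d)⁻¹ • φ d (l d • ρ) := fun d => by
    funext ρ
    have := (hl0 d).ne'
    simp only [f, φ, eval_smul_of_isHomogeneous (hP d), smul_eq_mul]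
    field_simp
  have hf : ∀ d, ContDiff ℝ ∞ (f d) := fun d =>
    (χ.contDiff.comp (contDiff_const_smul (l d))).mul (contDiff_eval _)
  have hbound : ∀ k d, k < d → ∀ x, ‖iteratedFDeriv ℝ k (f d) x‖ ≤ (1 / 2) ^ d := by
    intro k d hk x
    have hk' : (k : WithTop ℕ∞) ≤ ∞ := by exact_mod_cast le_top
    have h1 : ContDiff ℝ k fun ρ => φ d (l d • ρ) :=
      ((hφ d).of_le hk').comp (contDiff_const_smul (l d))
    rw [hfφ, iteratedFDeriv_const_smul_apply' h1.contDiffAt,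
      iteratedFDeriv_comp_const_smul (l d) ((hφ d).of_le hk'), norm_smul, norm_smul, norm_inv,
      norm_pow, norm_pow, Real.norm_of_nonneg (hl0 d).le]
    have h2 : ((l d) ^ d)⁻¹ * (l d) ^ k ≤ (l d)⁻¹ := by
      rw [inv_mul_le_iff₀ (pow_pos (hl0 d) _), ← div_eq_mul_inv, le_div_iff₀ (hl0 d), ← pow_succ]
      exact pow_le_pow_right₀ (hl1 d) hk
    calc ((l d) ^ d)⁻¹ * ((l d) ^ k * ‖iteratedFDeriv ℝ k (φ d) (l d • x)‖)
        = ((l d) ^ d)⁻¹ * (l d) ^ k * ‖iteratedFDeriv ℝ k (φ d) (l d • x)‖ := by ring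
      _ ≤ (l d)⁻¹ * M d k :=
          mul_le_mul h2 (hM _ _ _) (norm_nonneg _) (inv_nonneg.2 (hl0 d).le)
      _ ≤ (1 / 2) ^ d := by
          rw [inv_mul_le_iff₀ (hl0 d), one_div, inv_pow, ← div_eq_mul_inv,
            le_div_iff₀ (by positivity), mul_comm]
          exact hlM d k hk
  have hgeom : Summable fun d : ℕ => (1 / 2 : ℝ) ^ d :=
    summable_geometric_of_lt_one (by norm_num) (by norm_num)
  have hzero : ∀ d ρ, 2 ≤ ‖l d • ρ‖ → f d ρ = 0 := fun d ρ hρ => by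
    have : χ (l d • ρ) = 0 := χ.zero_of_le_dist (by simpa using hρ)
    simp [f, this]
  have hsmooth : ContDiff ℝ ∞ fun ρ => ∑' d, f d ρ :=
    contDiff_tsum_of_eventually (v := fun _ d => (1 / 2 : ℝ) ^ d) (N := ⊤) hf (fun _ _ => hgeom)
      fun k _ => by
        rw [Nat.cofinite_eq_atTop]
        filter_upwards [eventually_gt_atTop k] with d hd x using hbound k d hd x
  refine ⟨fun ρ => ∑' d, f d ρ, hsmooth, ?_, fun N => ?_⟩
  · refine HasCompactSupport.intro (isCompact_closedBall (0 : ι → ℝ) 2) fun ρ hρ => ?_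
    rw [mem_closedBall_zero_iff, not_le] at hρ
    have : ∀ d, f d ρ = 0 := fun d => hzero d ρ (by
      rw [norm_smul, Real.norm_of_nonneg (hl0 d).le]
      nlinarith [hl1 d, norm_nonneg ρ])
    simp [this]
  have hone : ∀ᶠ ρ : ι → ℝ in 𝓝 0, ∀ d ∈ Finset.range (N + 1), f d ρ = eval ρ (P d) := by
    rw [eventually_all_finset]
    intro d _
    filter_upwards [eventually_norm_le (inv_pos.2 (hl0 d))] with ρ hρ
    have : χ (l d • ρ) = 1 := χ.one_of_mem_closedBall (by
      rw [mem_closedBall_zero_iff, norm_smul, Real.norm_of_nonneg (hl0 d).le]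
      exact (mul_le_mul_of_nonneg_left hρ (hl0 d).le).trans (mul_inv_cancel₀ (hl0 d).ne').le)
    simp [f, this]
  refine IsBigO.of_bound (c N + ∑' i : ℕ, (1 / 2 : ℝ) ^ (i + (N + 1))) ?_
  filter_upwards [hone, eventually_norm_le one_pos] with ρ h1 hρ
  have hsum : Summable fun d => f d ρ := by
    refine (summable_nat_add_iff 1).1 (Summable.of_norm_bounded
      ((summable_nat_add_iff 1).2 hgeom) fun d => ?_)
    simpa using hbound 0 (d + 1) (Nat.succ_pos d) ρ
  rw [← hsum.sum_add_tsum_nat_add (N + 1), Finset.sum_congr rfl h1, map_sum,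
    Finset.sum_range_succ, add_assoc, add_sub_cancel_left, add_mul]
  rw [Real.norm_of_nonneg (by positivity : 0 ≤ ‖ρ‖ ^ N)]
  refine (norm_add_le _ _).trans (add_le_add (hc N ρ hρ) ?_)
  refine tsum_of_norm_bounded (((summable_nat_add_iff (N + 1)).2 hgeom).hasSum.mul_right _)
    fun i => ?_
  set d := i + (N + 1) with hd
  rcases le_or_gt 2 ‖l d • ρ‖ with h2 | h2
  · rw [hzero d ρ h2, norm_zero]; positivity
  rw [norm_smul, Real.norm_of_nonneg (hl0 d).le] at h2
  have h3 : ‖ρ‖ ≤ 2 / l d := by rw [le_div_iff₀ (hl0 d)]; linarith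
  have h4 : ‖ρ‖ ^ (i + 1) ≤ 2 ^ d / l d := calc
    ‖ρ‖ ^ (i + 1) ≤ (2 / l d) ^ (i + 1) := pow_le_pow_left₀ (norm_nonneg _) h3 _
    _ = 2 ^ (i + 1) / l d ^ (i + 1) := div_pow _ _ _
    _ ≤ 2 ^ d / l d := by
      refine div_le_div₀ (by positivity) (pow_le_pow_right₀ one_le_two (by omega)) (hl0 d) ?_
      exact le_self_pow₀ (hl1 d) (Nat.succ_ne_zero i)
  have h5 : c d * ‖ρ‖ ^ (i + 1) ≤ (1 / 2) ^ d := by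
    refine (mul_le_mul_of_nonneg_left h4 (hc0 d)).trans ?_
    rw [one_div, inv_pow, mul_div_assoc', div_le_iff₀ (hl0 d), inv_mul_eq_div,
      le_div_iff₀ (by positivity), mul_assoc, ← mul_pow, mul_comm,
      show (2 * 2 : ℝ) = 4 by norm_num]
    exact hlc d
  have hχ : |χ (l d • ρ)| ≤ 1 := by rw [abs_of_nonneg χ.nonneg]; exact χ.le_one
  calc ‖f d ρ‖ = |χ (l d • ρ)| * |eval ρ (P d)| := abs_mul _ _
    _ ≤ 1 * (c d * ‖ρ‖ ^ d) :=
        mul_le_mul hχ (hc d ρ hρ) (abs_nonneg _) zero_le_one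
    _ = c d * ‖ρ‖ ^ (i + 1) * ‖ρ‖ ^ N := by rw [hd]; ring
    _ ≤ (1 / 2) ^ d * ‖ρ‖ ^ N := mul_le_mul_of_nonneg_right h5 (by positivity)

end LewisSternberg

/-! ### Integral curves of Hamilton fields -/

namespace LewisSternberg

open MvPolynomial Asymptotics Filter

section Curves

variable {n : ℕ}

theorem contDiff_hamiltonField {p : PhaseSpace n → ℝ} (hp : ContDiff ℝ ∞ p) :
    ContDiff ℝ ∞ (hamiltonField p) := by
  have h : ∀ v, ContDiff ℝ ∞ fun ρ => fderiv ℝ p ρ v := fun v =>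
    (hp.fderiv_right (m := ∞) le_rfl).clm_apply contDiff_const
  refine contDiff_pi.2 ?_
  rintro (j | j)
  · exact h _
  · exact (h _).neg

theorem hasCompactSupport_hamiltonField {p : PhaseSpace n → ℝ} (hp : HasCompactSupport p) :
    HasCompactSupport (hamiltonField p) := by
  have h := (hp.fderiv (𝕜 := ℝ)).comp_left (g := fun φ : PhaseSpace n →L[ℝ] ℝ =>
    (Sum.elim (fun j => φ (Pi.single (Sum.inr j) 1)) fun j => -φ (Pi.single (Sum.inl j) 1) :
      PhaseSpace n)) (by ext (j | j) <;> simp)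
  exact h

/-- The Hamilton flow of a compactly supported function is complete. -/
theorem exists_isExpHamilton {p : PhaseSpace n → ℝ} (hp : ContDiff ℝ ∞ p)
    (hc : HasCompactSupport p) : ∃ Φ, IsExpHamilton p Set.univ Φ := by
  have hV := contDiff_hamiltonField hp
  have hVc := hasCompactSupport_hamiltonField hc
  obtain ⟨K, hK⟩ := hV.lipschitzWith_of_hasCompactSupport hVc (by simp)
  obtain ⟨L, hL⟩ := hV.continuous.bounded_above_of_compact_support hVc
  have hL0 : 0 ≤ L := (norm_nonneg _).trans (hL 0)
  have key : ∀ ρ : PhaseSpace n, ∃ γ : ℝ → PhaseSpace n, γ 0 = ρ ∧ ∀ t ∈ Set.Icc (0 : ℝ) 1,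
      HasDerivWithinAt γ (hamiltonField p (γ t)) (Set.Icc 0 1) t := fun ρ => by
    have hPL : IsPicardLindelof (fun _ => hamiltonField p) (tmin := 0) (tmax := 1)
        ⟨0, Set.left_mem_Icc.2 zero_le_one⟩ ρ ⟨L, hL0⟩ 0 ⟨L, hL0⟩ K :=
      { lipschitzOnWith := fun t _ => hK.lipschitzOnWith
        continuousOn := fun x _ => continuousOn_const
        norm_le := fun t _ x _ => hL x
        mul_max_le := by simp }
    exact hPL.exists_eq_forall_mem_Icc_hasDerivWithinAt₀
  choose γ h0 hγ using key
  exact ⟨fun ρ => γ ρ 1, Eventually.of_forall fun ρ =>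
    ⟨γ ρ, h0 ρ, rfl, fun t ht => ⟨trivial, hγ ρ t ht⟩⟩⟩

/-- A solution of an equation `x' = V x` with `V x = O (x)` that starts close to `0` remains close
to `0`. -/
theorem norm_le_of_hasDerivWithinAt {E : Type*} [NormedAddCommGroup E] [NormedSpace ℝ E]
    {V : E → E} {C δ : ℝ} (hC : 0 ≤ C) (hV : ∀ x, ‖x‖ < δ → ‖V x‖ ≤ C * ‖x‖) {γ : ℝ → E}
    (hγ : ∀ t ∈ Set.Icc (0 : ℝ) 1, HasDerivWithinAt γ (V (γ t)) (Set.Icc 0 1) t)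
    (h0 : ‖γ 0‖ * Real.exp (C + 1) < δ) {t : ℝ} (ht : t ∈ Set.Icc (0 : ℝ) 1) :
    ‖γ t‖ ≤ ‖γ 0‖ * Real.exp (C + 1) := by
  refine le_of_forall_gt_imp_ge_of_dense fun b hb => ?_
  -- a bound strictly above `‖γ 0‖`, as the fencing theorem needs a strict inequality, which fails
  -- for the curve `γ = 0`
  set a := min b ((‖γ 0‖ * Real.exp (C + 1) + δ) / 2) * (Real.exp (C + 1))⁻¹ with ha
  have hexp : 0 < Real.exp (C + 1) := Real.exp_pos _
  have hab : a * Real.exp (C + 1) = min b ((‖γ 0‖ * Real.exp (C + 1) + δ) / 2) := by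
    rw [ha, inv_mul_cancel_right₀ hexp.ne']
  have haδ : a * Real.exp (C + 1) < δ := by
    rw [hab]; exact (min_le_right _ _).trans_lt (by linarith)
  have hγa : ‖γ 0‖ < a := by
    refine lt_of_mul_lt_mul_right ?_ hexp.le
    rw [hab]; exact lt_min hb (by linarith)
  have ha0 : 0 < a := (norm_nonneg _).trans_lt hγa
  have hmono : ∀ s ∈ Set.Icc (0 : ℝ) 1, a * Real.exp ((C + 1) * s) ≤ a * Real.exp (C + 1) :=
    fun s hs => mul_le_mul_of_nonneg_left (Real.exp_le_exp.2 (by nlinarith [hs.2])) ha0.le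
  have h := image_norm_le_of_norm_deriv_right_lt_deriv_boundary (f := γ) (a := 0) (b := 1)
    (f' := fun t => V (γ t)) (fun t ht => (hγ t ht).continuousWithinAt)
    (fun t ht => (hγ t ⟨ht.1, ht.2.le⟩).mono_of_mem_nhdsWithin
      (Icc_mem_nhdsGE_of_mem ht))
    (B := fun s => a * Real.exp ((C + 1) * s))
    (B' := fun s => a * (Real.exp ((C + 1) * s) * (C + 1))) (by simpa using hγa.le)
    (fun s => by
      have := (((hasDerivAt_id s).const_mul (C + 1)).exp).const_mul a
      simpa using this)
    (fun s hs heq => by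
      have hs' : s ∈ Set.Icc (0 : ℝ) 1 := ⟨hs.1, hs.2.le⟩
      refine (hV _ (heq ▸ (hmono s hs').trans_lt haδ)).trans_lt ?_
      rw [heq]
      have : 0 < a * Real.exp ((C + 1) * s) := mul_pos ha0 (Real.exp_pos _)
      nlinarith) ht
  exact h.trans ((hmono t ht).trans (hab ▸ min_le_left _ _))

theorem sum_poisson_X_mul_pderiv (P f : PhasePoly n) :
    ∑ k, poisson P (X k) * pderiv k f = poisson P f := by
  rw [Fintype.sum_sum_type, poisson_apply, Finset.sum_sub_distrib, sub_eq_add_neg,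
    ← Finset.sum_neg_distrib]
  simp only [poisson_X_inl, poisson_X_inr, neg_mul]

theorem isBigO_fderiv_sub_pderiv {p : PhaseSpace n → ℝ} {U : Set (PhaseSpace n)} (hU : IsOpen U)
    (h0 : 0 ∈ U) (hp : ContDiffOn ℝ ∞ p U) {P : PhasePoly n} {m : ℕ}
    (h : (fun ρ => p ρ - eval ρ P) =O[𝓝 0] fun ρ => ‖ρ‖ ^ (2 * m)) (k : Fin n ⊕ Fin n) :
    (fun ρ => fderiv ℝ p ρ (Pi.single k 1) - eval ρ (pderiv k P)) =O[𝓝 0] fun ρ => ‖ρ‖ ^ m := by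
  have hd := isBigO_fderiv hU h0 (hp.sub (contDiff_eval P).contDiffOn) h
  refine IsBigO.trans (IsBigO.of_bound ‖(Pi.single k 1 : PhaseSpace n)‖ ?_) hd
  filter_upwards [hU.mem_nhds h0] with ρ hρ
  have hpd : DifferentiableAt ℝ p ρ :=
    (hp.contDiffAt (hU.mem_nhds hρ)).differentiableAt (by simp)
  have e : fderiv ℝ (fun ρ => p ρ - eval ρ P) ρ =
      fderiv ℝ p ρ - fderiv ℝ (fun ρ => eval ρ P) ρ :=
    fderiv_fun_sub hpd (hasFDerivAt_eval P ρ).differentiableAt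
  rw [← fderiv_eval_single, mul_comm, e]
  exact (fderiv ℝ p ρ - fderiv ℝ (fun ρ => eval ρ P) ρ).le_opNorm (Pi.single k 1)

theorem isBigO_hamiltonField_sub {p : PhaseSpace n → ℝ} {U : Set (PhaseSpace n)} (hU : IsOpen U)
    (h0 : 0 ∈ U) (hp : ContDiffOn ℝ ∞ p U) {P : PhasePoly n} {m : ℕ}
    (h : (fun ρ => p ρ - eval ρ P) =O[𝓝 0] fun ρ => ‖ρ‖ ^ (2 * m)) (i : Fin n ⊕ Fin n) :
    (fun ρ => hamiltonField p ρ i - eval ρ (poisson P (X i))) =O[𝓝 0] fun ρ => ‖ρ‖ ^ m := by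
  have hcomp := isBigO_fderiv_sub_pderiv hU h0 hp h
  rcases i with j | j
  · exact (hcomp (Sum.inr j)).congr_left fun ρ => by rw [poisson_X_inl]; rfl
  · refine (hcomp (Sum.inl j)).neg_left.congr_left fun ρ => ?_
    rw [poisson_X_inr, map_neg]
    simp only [hamiltonField, Sum.elim_inr]
    ring

/-- The jet of the time-one map of a Hamilton flow is given by the formal flow. The proof
differentiates `F_{1 - t} (γ t)` along an integral curve `γ`. -/
theorem IsExpHamilton.isBigO_sub_eval {p : PhaseSpace n → ℝ} {U : Set (PhaseSpace n)}
    {Φ : PhaseSpace n → PhaseSpace n} (hΦ : IsExpHamilton p U Φ) {P : PhasePoly n}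
    (hP : P ∈ vanishingIdeal _ 2) {m : ℕ} (hm : 1 ≤ m)
    (hp : ∀ i, (fun ρ => hamiltonField p ρ i - eval ρ (poisson P (X i))) =O[𝓝 0]
      fun ρ => ‖ρ‖ ^ m) {i : Fin n ⊕ Fin n} {F : ℝ → PhasePoly n} (hF : IsJetFlow P m (X i) F) :
    (fun ρ => Φ ρ i - eval ρ (F 1)) =O[𝓝 0] fun ρ => ‖ρ‖ ^ m := by
  obtain ⟨D, hD⟩ := hF.bounded
  set S := (Finsupp.finite_of_degree_le (σ := Fin n ⊕ Fin n) (max D m)).toFinset with hS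
  have hle : ∀ {d}, d ≤ max D m → restrictTotalDegree (Fin n ⊕ Fin n) ℝ d ≤
      restrictTotalDegree (Fin n ⊕ Fin n) ℝ (max D m) := fun hd g hg => by
    rw [mem_restrictTotalDegree] at hg ⊢
    exact hg.trans hd
  have hsum : ∀ (ψ : PhasePoly n →ₗ[ℝ] ℝ) t,
      ψ (F t) = ∑ l ∈ S, coeff l (F t) * ψ (monomial l 1) := fun ψ t =>
    linear_apply_eq_sum (hle (le_max_left _ _) (hD t)) ψ
  let ev : PhaseSpace n → PhasePoly n →ₗ[ℝ] ℝ := fun x => (aeval x).toLinearMap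
  have hev : ∀ x f, ev x f = eval x f := fun x f => by
    simp [ev]
  let b : (Fin n ⊕ Fin n →₀ ℕ) → PhaseSpace n → ℝ := fun l x =>
    ∑ k, hamiltonField p x k * eval x (pderiv k (monomial l (1 : ℝ))) -
      eval x (trunc m (poisson P (monomial l 1)))
  have hb : ∀ l, (b l) =O[𝓝 0] fun x => ‖x‖ ^ m := fun l => by
    have e : b l = fun x => ∑ k, (hamiltonField p x k - eval x (poisson P (X k))) *
        eval x (pderiv k (monomial l (1 : ℝ))) +
        eval x (poisson P (monomial l 1) - trunc m (poisson P (monomial l 1))) := by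
      funext x
      simp only [b, sub_mul, Finset.sum_sub_distrib]
      have e1 : eval x (poisson P (monomial l (1 : ℝ))) =
          ∑ k, eval x (poisson P (X k)) * eval x (pderiv k (monomial l (1 : ℝ))) := by
        rw [← sum_poisson_X_mul_pderiv, map_sum]
        simp only [map_mul]
      rw [map_sub, e1]
      ring
    rw [e]
    refine IsBigO.add (IsBigO.fun_sum fun k _ => ?_) (isBigO_eval (sub_trunc_mem _ _))
    have h1 : (fun x : PhaseSpace n => eval x (pderiv k (monomial l (1 : ℝ)))) =O[𝓝 0]
        fun _ => (1 : ℝ) := by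
      simpa using isBigO_eval (mem_vanishingIdeal_zero (pderiv k (monomial l (1 : ℝ))))
    simpa using (hp k).mul h1
  have hV : (hamiltonField p) =O[𝓝 0] fun x => ‖x‖ := by
    refine isBigO_pi.2 fun k => ?_
    have h1 : poisson P (X k) ∈ vanishingIdeal _ 1 :=
      poisson_mem_vanishingIdeal hP (X_mem_vanishingIdeal k) le_rfl
    have h2 := ((hp k).trans (isBigO_norm_pow_of_le hm)).add (isBigO_eval h1)
    simpa using h2
  obtain ⟨C, hC, hCV⟩ := hV.exists_nonneg
  choose K hK using fun l => (hb l).exists_nonneg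
  have hbS : ∀ᶠ x in 𝓝 (0 : PhaseSpace n), ∀ l ∈ S, ‖b l x‖ ≤ K l * ‖‖x‖ ^ m‖ := by
    rw [eventually_all_finset]
    exact fun l _ => (hK l).2.bound
  obtain ⟨δ, hδ, hball⟩ := Metric.eventually_nhds_iff_ball.1 (hCV.bound.and hbS)
  have hM : ∀ l, ∃ M, ∀ t ∈ Set.Icc (0 : ℝ) 1, ‖coeff l (F t)‖ ≤ M := fun l =>
    isCompact_Icc.exists_bound_of_continuousOn fun t _ =>
      (hF.deriv l t).continuousAt.continuousWithinAt
  choose M hM using hM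
  have hM0 : ∀ l, 0 ≤ M l := fun l =>
    (norm_nonneg _).trans (hM l 0 (Set.left_mem_Icc.2 zero_le_one))
  refine IsBigO.of_bound (∑ l ∈ S, M l * (K l * Real.exp (C + 1) ^ m)) ?_
  have hsmall : ∀ᶠ ρ : PhaseSpace n in 𝓝 0, ‖ρ‖ * Real.exp (C + 1) < δ := by
    have : Tendsto (fun ρ : PhaseSpace n => ‖ρ‖ * Real.exp (C + 1)) (𝓝 0) (𝓝 0) :=
      (continuous_norm.mul continuous_const).tendsto' _ _ (by simp)
    exact this.eventually (gt_mem_nhds hδ)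
  filter_upwards [hΦ, hsmall] with ρ ⟨γ, hγ0, hγ1, hγ⟩ hρ
  have hγd : ∀ t ∈ Set.Icc (0 : ℝ) 1, HasDerivWithinAt γ (hamiltonField p (γ t)) (Set.Icc 0 1) t :=
    fun t ht => (hγ t ht).2
  have hgrow : ∀ t ∈ Set.Icc (0 : ℝ) 1, ‖γ t‖ ≤ ‖ρ‖ * Real.exp (C + 1) := fun t ht => by
    have := norm_le_of_hasDerivWithinAt hC (V := hamiltonField p) (δ := δ) (fun x hx => by
      simpa using (hball x (by simpa using hx)).1) hγd (by rwa [hγ0]) ht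
    rwa [hγ0] at this
  let h : ℝ → ℝ := fun t => eval (γ t) (F (1 - t))
  have hh : ∀ t, h t = ∑ l ∈ S, coeff l (F (1 - t)) * eval (γ t) (monomial l (1 : ℝ)) := fun t => by
    have := hsum (ev (γ t)) (1 - t)
    simpa only [hev] using this
  have hderiv : ∀ t ∈ Set.Icc (0 : ℝ) 1,
      HasDerivWithinAt h (∑ l ∈ S, coeff l (F (1 - t)) * b l (γ t)) (Set.Icc 0 1) t := by
    intro t ht
    have e : ∑ l ∈ S, coeff l (F (1 - t)) * b l (γ t) =
        ∑ l ∈ S, (-coeff l (trunc m (poisson P (F (1 - t)))) * eval (γ t) (monomial l (1 : ℝ)) +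
          coeff l (F (1 - t)) * ∑ k, eval (γ t) (pderiv k (monomial l (1 : ℝ))) *
            hamiltonField p (γ t) k) := by
      have h1 := hsum (ev (γ t) ∘ₗ trunc m ∘ₗ (poisson P : PhasePoly n →ₗ[ℝ] PhasePoly n)) (1 - t)
      have h2 := linear_apply_eq_sum (hle (le_max_right D m)
        (trunc_mem_restrictTotalDegree m (poisson P (F (1 - t))))) (ev (γ t))
      simp only [LinearMap.comp_apply, hev, Derivation.coeFn_coe] at h1 h2
      rw [h1] at h2
      simp only [b, mul_sub, Finset.sum_sub_distrib, Finset.sum_add_distrib, neg_mul,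
        Finset.sum_neg_distrib, ← hS] at h2 ⊢
      rw [h2, neg_add_eq_sub]
      simp only [mul_comm (hamiltonField p (γ t) _)]
    rw [e, funext hh]
    refine HasDerivWithinAt.fun_sum fun l _ => ?_
    have h1 : HasDerivAt (fun t => coeff l (F (1 - t)))
        (-coeff l (trunc m (poisson P (F (1 - t))))) t := by
      have := (hF.deriv l (1 - t)).scomp t ((hasDerivAt_id t).const_sub 1)
      simpa [Function.comp_def] using this
    have h2 := (hasFDerivAt_eval (monomial l (1 : ℝ)) (γ t)).comp_hasDerivWithinAt t (hγd t ht)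
    simp only [_root_.sum_apply, _root_.smul_apply,
      ContinuousLinearMap.proj_apply, smul_eq_mul] at h2
    exact h1.hasDerivWithinAt.fun_mul h2
  have hfin := norm_image_sub_le_of_norm_deriv_le_segment_01' hderiv
    (C := ∑ l ∈ S, M l * (K l * Real.exp (C + 1) ^ m) * ‖ρ‖ ^ m) fun t ht => by
      have ht' : t ∈ Set.Icc (0 : ℝ) 1 := ⟨ht.1, ht.2.le⟩
      refine (norm_sum_le _ _).trans (Finset.sum_le_sum fun l hl => ?_)
      rw [norm_mul, mul_assoc]
      refine mul_le_mul (hM l _ ⟨by linarith [ht'.2], by linarith [ht'.1]⟩) ?_ (norm_nonneg _)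
        (hM0 l)
      have h1 := (hball (γ t) (by
        rw [mem_ball_zero_iff]; exact (hgrow t ht').trans_lt hρ)).2 l hl
      refine h1.trans ?_
      rw [Real.norm_of_nonneg (by positivity), mul_assoc, ← mul_pow, mul_comm (Real.exp _)]
      exact mul_le_mul_of_nonneg_left (pow_le_pow_left₀ (norm_nonneg _) (hgrow t ht') _) (hK l).1
  have e1 : h 1 = Φ ρ i := by simp [h, hF.init, hγ1]
  have e0 : h 0 = eval ρ (F 1) := by simp [h, hγ0]
  rwa [e1, e0, ← Finset.sum_mul, ← Real.norm_of_nonneg (by positivity : 0 ≤ ‖ρ‖ ^ m)] at hfin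

end Curves

end LewisSternberg

/-! ### Jets of canonical transformations -/

namespace LewisSternberg

open MvPolynomial Asymptotics Filter

section Symplectic

variable {n : ℕ}

theorem sympForm_eq_dotProduct (u v : PhaseSpace n) :
    sympForm u v = dotProduct u ((Matrix.J (Fin n) ℝ).mulVec v) := by
  rw [Matrix.J, Matrix.fromBlocks_mulVec, dotProduct, Fintype.sum_sum_type, sympForm,
    Finset.sum_sub_distrib, sub_eq_neg_add, ← Finset.sum_neg_distrib]
  simp [Matrix.neg_mulVec]

theorem transpose_mul_J_mul_eq {M : Matrix (Fin n ⊕ Fin n) (Fin n ⊕ Fin n) ℝ}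
    (h : ∀ u v, sympForm (M.mulVec u) (M.mulVec v) = sympForm u v) :
    M.transpose * Matrix.J (Fin n) ℝ * M = Matrix.J (Fin n) ℝ := by
  ext i j
  have := h (Pi.single i 1) (Pi.single j 1)
  rw [sympForm_eq_dotProduct, sympForm_eq_dotProduct, Matrix.dotProduct_mulVec,
    Matrix.dotProduct_mulVec, Matrix.dotProduct_mulVec, ← Matrix.vecMul_transpose] at this
  simp only [Matrix.vecMul_vecMul, Matrix.single_one_vecMul, dotProduct_single_one] at this
  rw [Matrix.mul_assoc]
  exact this

theorem poisson_eq_sum_J (f g : PhasePoly n) :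
    poisson f g = ∑ k, ∑ l, Matrix.J (Fin n) ℝ k l • (pderiv k f * pderiv l g) := by
  rw [poisson_apply, Finset.sum_sub_distrib]
  simp only [Fintype.sum_sum_type, Matrix.J, Matrix.fromBlocks_apply₁₁, Matrix.fromBlocks_apply₁₂,
    Matrix.fromBlocks_apply₂₁, Matrix.fromBlocks_apply₂₂, Matrix.zero_apply, zero_smul,
    Finset.sum_const_zero, zero_add, add_zero, Matrix.neg_apply, neg_smul, Finset.sum_neg_distrib,
    sum_one_smul]
  abel

theorem poisson_X_X (i j : Fin n ⊕ Fin n) :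
    poisson (X i : PhasePoly n) (X j) = C (Matrix.J (Fin n) ℝ i j) := by
  rw [poisson_eq_sum_J, Finset.sum_eq_single i, Finset.sum_eq_single j]
  · simp [MvPolynomial.smul_eq_C_mul]
  · intro l _ hl; simp [pderiv_X_of_ne hl.symm]
  · simp
  · intro k _ hk; simp [pderiv_X_of_ne hk.symm]
  · simp

/-- The quadratic form `½ σ (ρ, B ρ)` as a polynomial. -/
noncomputable def quadPoly (B : Matrix (Fin n ⊕ Fin n) (Fin n ⊕ Fin n) ℝ) : PhasePoly n :=
  (1 / 2 : ℝ) • ∑ i, X i * linForm ((Matrix.J (Fin n) ℝ * B) i)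

theorem quadPoly_isHomogeneous (B : Matrix (Fin n ⊕ Fin n) (Fin n ⊕ Fin n) ℝ) :
    (quadPoly B).IsHomogeneous 2 := by
  rw [← mem_homogeneousSubmodule]
  refine Submodule.smul_mem _ _ (Submodule.sum_mem _ fun i _ => ?_)
  rw [mem_homogeneousSubmodule]
  exact (isHomogeneous_X ℝ i).mul (linForm_isHomogeneous _)

theorem eval_linForm (c : Fin n ⊕ Fin n → ℝ) (ρ : PhaseSpace n) :
    eval ρ (linForm c) = dotProduct c ρ := by
  simp [linForm, dotProduct, smul_eval, -Fintype.sum_sum_type]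

theorem eval_quadPoly (B : Matrix (Fin n ⊕ Fin n) (Fin n ⊕ Fin n) ℝ) (ρ : PhaseSpace n) :
    eval ρ (quadPoly B) = quadForm B ρ := by
  rw [quadPoly, smul_eval, map_sum, quadForm, sympForm_eq_dotProduct, Matrix.mulVec_mulVec]
  simp only [map_mul, eval_X, eval_linForm]
  rfl

theorem poisson_quadPoly_X {B : Matrix (Fin n ⊕ Fin n) (Fin n ⊕ Fin n) ℝ}
    (hB : B.transpose * Matrix.J (Fin n) ℝ + Matrix.J (Fin n) ℝ * B = 0) (i : Fin n ⊕ Fin n) :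
    poisson (quadPoly B) (X i) = linForm (B i) := by
  set S := Matrix.J (Fin n) ℝ * B with hS
  have hsymm : S.transpose = S := by
    rw [hS, Matrix.transpose_mul, Matrix.J_transpose, Matrix.mul_neg]
    exact neg_eq_of_add_eq_zero_right hB
  have hd : ∀ k, pderiv k (quadPoly B) = linForm (S k) := fun k => by
    have e : ∑ i, X i * pderiv k (linForm (S i)) = linForm (S k) := by
      simp only [linForm, map_sum, Derivation.map_smul]
      refine Finset.sum_congr rfl fun i _ => ?_
      rw [Finset.sum_eq_single k]
      · have : S i k = S k i := congrFun (congrFun hsymm k) i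
        rw [pderiv_X_self, this, mul_smul_comm, mul_one]
      · intro l _ hl; simp [pderiv_X_of_ne hl]
      · simp
    have e2 : ∑ i, pderiv k (X i) * linForm (S i) = linForm (S k) := by
      rw [Finset.sum_eq_single k]
      · simp
      · intro l _ hl; simp [pderiv_X_of_ne hl]
      · simp
    rw [quadPoly, Derivation.map_smul, map_sum]
    simp only [pderiv_mul, Finset.sum_add_distrib]
    rw [e, e2, ← two_smul ℝ, smul_smul]
    norm_num
  have hentry : ∀ j, S (Sum.inr j) = B (Sum.inl j) ∧ S (Sum.inl j) = -B (Sum.inr j) := fun j => by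
    constructor <;> ext k <;>
      simp [hS, Matrix.mul_apply, Matrix.J, Fintype.sum_sum_type, Matrix.one_apply]
  rcases i with j | j
  · rw [poisson_X_inl, hd, (hentry j).1]
  · rw [poisson_X_inr, hd, (hentry j).2]
    simp [linForm, -Fintype.sum_sum_type]

end Symplectic

section CanonicalJets

variable {n : ℕ} {κ : PhaseSpace n → PhaseSpace n} {U : Set (PhaseSpace n)}

theorem sub_linForm_linearization_mem (h0 : κ 0 = 0) (hd : DifferentiableAt ℝ κ 0)
    {i : Fin n ⊕ Fin n} {K : PhasePoly n}
    (hK : (fun ρ => κ ρ i - eval ρ K) =O[𝓝 0] fun ρ => ‖ρ‖ ^ 2) :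
    K - linForm (linearization κ i) ∈ vanishingIdeal _ 2 := by
  refine mem_vanishingIdeal_of_isLittleO (N := 1) ?_
  have h1 := hasFDerivAt_iff_isLittleO_nhds_zero.1 (hasFDerivAt_pi'.1 hd.hasFDerivAt i)
  have h2 := h1.norm_right.sub (hK.trans_isLittleO
    (by simpa using isLittleO_norm_pow (E := PhaseSpace n) one_lt_two))
  simp only [pow_one]
  refine h2.congr_left fun ρ => ?_
  have e : fderiv ℝ κ 0 ρ i = dotProduct (linearization κ i) ρ := by
    have := congrFun (LinearMap.toMatrix'_mulVec
      (fderiv ℝ κ 0 : PhaseSpace n →ₗ[ℝ] PhaseSpace n) ρ) i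
    exact this.symm
  rw [map_sub, eval_linForm, ← e]
  simp [h0]

theorem poisson_taylor_sub_mem (hU : IsOpen U) (h0 : 0 ∈ U) (hκ : ContDiffOn ℝ ∞ κ U)
    (hsymp : ∀ ρ ∈ U, ∀ u v : PhaseSpace n,
      sympForm (fderiv ℝ κ ρ u) (fderiv ℝ κ ρ v) = sympForm u v)
    {m : ℕ} {K : Fin n ⊕ Fin n → PhasePoly n}
    (hK : ∀ i, (fun ρ => κ ρ i - eval ρ (K i)) =O[𝓝 0] fun ρ => ‖ρ‖ ^ (2 * m))
    (i j : Fin n ⊕ Fin n) : poisson (K i) (K j) - poisson (X i) (X j) ∈ vanishingIdeal _ m := by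
  refine mem_vanishingIdeal_of_isBigO ?_
  have hκi : ∀ i, ContDiffOn ℝ ∞ (fun ρ => κ ρ i) U := fun i => contDiffOn_pi.1 hκ i
  have hd : ∀ i k, (fun ρ => fderiv ℝ (fun ρ => κ ρ i) ρ (Pi.single k 1) -
      eval ρ (pderiv k (K i))) =O[𝓝 0] fun ρ => ‖ρ‖ ^ m := fun i k =>
    isBigO_fderiv_sub_pderiv hU h0 (hκi i) (hK i) k
  have hb : ∀ f : PhasePoly n, (fun ρ => eval ρ f) =O[𝓝 0] fun _ => (1 : ℝ) := fun f => by
    simpa using isBigO_eval (mem_vanishingIdeal_zero f)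
  have hb' : ∀ i k, (fun ρ => fderiv ℝ (fun ρ => κ ρ i) ρ (Pi.single k 1)) =O[𝓝 0]
      fun _ => (1 : ℝ) := fun i k => by
    have := ((hd i k).trans (isBigO_norm_pow_of_le (Nat.zero_le m))).add
      ((hb (pderiv k (K i))).trans (by simp [isBigO_refl]))
    simpa using this
  have hsum : (fun ρ => ∑ k, ∑ l, Matrix.J (Fin n) ℝ k l *
      (fderiv ℝ (fun ρ => κ ρ i) ρ (Pi.single k 1) * fderiv ℝ (fun ρ => κ ρ j) ρ (Pi.single l 1) -
        eval ρ (pderiv k (K i)) * eval ρ (pderiv l (K j)))) =O[𝓝 0] fun ρ => ‖ρ‖ ^ m := by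
    refine IsBigO.fun_sum fun k _ => IsBigO.fun_sum fun l _ => IsBigO.const_mul_left ?_ _
    have h1 := (hd i k).mul (hb' j l)
    have h2 := (hb (pderiv k (K i))).mul (hd j l)
    simp only [mul_one, one_mul] at h1 h2
    refine (h1.add h2).congr_left fun ρ => ?_
    ring
  refine hsum.neg_left.congr' ?_ EventuallyEq.rfl
  filter_upwards [hU.mem_nhds h0] with ρ hρ
  set M := LinearMap.toMatrix' (fderiv ℝ κ ρ : PhaseSpace n →ₗ[ℝ] PhaseSpace n) with hM
  have hMJ : M * Matrix.J (Fin n) ℝ * M.transpose = Matrix.J (Fin n) ℝ := by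
    rw [← SymplecticGroup.mem_iff, SymplecticGroup.mem_iff']
    refine transpose_mul_J_mul_eq fun u v => ?_
    rw [hM, LinearMap.toMatrix'_mulVec, LinearMap.toMatrix'_mulVec]
    exact hsymp ρ hρ u v
  have hdiff : DifferentiableAt ℝ κ ρ :=
    (hκ.contDiffAt (hU.mem_nhds hρ)).differentiableAt (by simp)
  have hMe : ∀ i k, fderiv ℝ (fun ρ => κ ρ i) ρ (Pi.single k 1) = M i k := fun i k => by
    rw [(hasFDerivAt_pi'.1 hdiff.hasFDerivAt i).fderiv, hM, LinearMap.toMatrix'_apply]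
    rfl
  have hJ : ∑ k, ∑ l, Matrix.J (Fin n) ℝ k l * (M i k * M j l) = Matrix.J (Fin n) ℝ i j := by
    rw [← congrFun (congrFun hMJ i) j, Matrix.mul_apply]
    simp only [Matrix.mul_apply, Finset.sum_mul, Matrix.transpose_apply]
    rw [Finset.sum_comm]
    exact Finset.sum_congr rfl fun l _ => Finset.sum_congr rfl fun k _ => by ring
  have hp : eval ρ (poisson (K i) (K j)) = ∑ k, ∑ l, Matrix.J (Fin n) ℝ k l *
      (eval ρ (pderiv k (K i)) * eval ρ (pderiv l (K j))) := by
    rw [poisson_eq_sum_J]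
    simp only [map_sum, smul_eval, map_mul]
  simp only [hMe, mul_sub, Finset.sum_sub_distrib]
  rw [hJ, ← hp, map_sub, poisson_X_X, eval_C]
  ring

/-- The analytic problem modulo `O (ρ ^ m)` is the formal problem for the Taylor polynomials. -/
theorem generatesJet_iff {p : PhaseSpace n → ℝ} (hU : IsOpen U) (h0 : 0 ∈ U)
    (hp : ContDiffOn ℝ ∞ p U) {Φ : PhaseSpace n → PhaseSpace n} {V : Set (PhaseSpace n)}
    (hΦ : IsExpHamilton p V Φ) {P : PhasePoly n} (hP : P ∈ vanishingIdeal _ 2) {m : ℕ} (hm : 1 ≤ m)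
    (hpP : (fun ρ => p ρ - eval ρ P) =O[𝓝 0] fun ρ => ‖ρ‖ ^ (2 * m))
    {K : Fin n ⊕ Fin n → PhasePoly n}
    (hK : ∀ i, (fun ρ => κ ρ i - eval ρ (K i)) =O[𝓝 0] fun ρ => ‖ρ‖ ^ m) :
    GeneratesJet P K m ↔ (fun ρ => κ ρ - Φ ρ) =O[𝓝 0] fun ρ => ‖ρ‖ ^ m := by
  have hF : ∀ i F, IsJetFlow P m (X i) F →
      (fun ρ => Φ ρ i - eval ρ (F 1)) =O[𝓝 0] fun ρ => ‖ρ‖ ^ m := fun i F hF =>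
    hΦ.isBigO_sub_eval hP hm (isBigO_hamiltonField_sub hU h0 hp hpP) hF
  rw [isBigO_pi]
  constructor
  · intro h i
    obtain ⟨F, hFi⟩ := exists_isJetFlow P m (X i)
    refine (((hK i).sub (isBigO_eval (h i F hFi))).sub (hF i F hFi)).congr_left fun ρ => ?_
    rw [map_sub, Pi.sub_apply]; ring
  · intro h i F hFi
    refine mem_vanishingIdeal_of_isBigO ((((hK i).sub (h i)).sub (hF i F hFi)).congr_left
      fun ρ => ?_)
    rw [map_sub, Pi.sub_apply]; ring

end CanonicalJets

end LewisSternberg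

/-! ### Existence and uniqueness of the Hamilton function -/

namespace LewisSternberg

open MvPolynomial Asymptotics Filter

variable {n r : ℕ} {κ : PhaseSpace n → PhaseSpace n} {lam μ : Fin r → ℂ}
  {B : Matrix (Fin n ⊕ Fin n) (Fin n ⊕ Fin n) ℝ}

/-- The data of the formal problem attached to a canonical germ and a logarithm of its
linearization. -/
theorem exists_formal_data (hκ : IsCanonicalGerm κ) (hexp : ∀ j, Complex.exp (μ j) = lam j)
    (hres : ∀ k : Fin r → ℤ,
      (∃ m : ℤ, ∑ j, (k j : ℂ) * μ j = 2 * (Real.pi : ℂ) * Complex.I * (m : ℂ)) →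
        ∑ j, (k j : ℂ) * μ j = 0)
    (hspec : ∀ z, (complexAction (linearization κ)).HasEigenvalue z → ∃ w, IsLogValue lam μ z w)
    (hB : IsLogarithm (linearization κ) lam μ B) :
    (∀ i, poisson (quadPoly B) (X i) = linForm (B i)) ∧
      ∃ (C : ℝ → Matrix (Fin n ⊕ Fin n) (Fin n ⊕ Fin n) ℝ)
        (A' : Matrix (Fin n ⊕ Fin n) (Fin n ⊕ Fin n) ℝ), C 0 = 1 ∧
        (∀ i k t, HasDerivAt (fun t => C t i k) ((C t * B) i k) t) ∧ C 1 = linearization κ ∧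
        A' * C 1 = 1 := by
  obtain ⟨h0, U, hU, h0U, hκU, hsymp⟩ := hκ
  have hJ : (linearization κ).transpose * Matrix.J (Fin n) ℝ * linearization κ =
      Matrix.J (Fin n) ℝ := transpose_mul_J_mul_eq fun u v => by
    rw [linearization, LinearMap.toMatrix'_mulVec, LinearMap.toMatrix'_mulVec]
    exact hsymp 0 h0U u v
  obtain ⟨C, hC0, hC, hC'⟩ := exists_matrix_flow B
  have hC1 := flow_one_eq hC0 hC' hexp hspec hB
  refine ⟨poisson_quadPoly_X (transpose_mul_add_mul_eq_zero hexp hres hspec hB hJ), C,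
    -(Matrix.J (Fin n) ℝ * (linearization κ).transpose * Matrix.J (Fin n) ℝ), hC0, hC, hC1, ?_⟩
  rw [hC1, Matrix.neg_mul]
  exact SymplecticGroup.inv_left_mul_aux (SymplecticGroup.mem_iff'.2 hJ)

theorem exists_isHamiltonianLog (hκ : IsCanonicalGerm κ) (hexp : ∀ j, Complex.exp (μ j) = lam j)
    (hres : ∀ k : Fin r → ℤ,
      (∃ m : ℤ, ∑ j, (k j : ℂ) * μ j = 2 * (Real.pi : ℂ) * Complex.I * (m : ℂ)) →
        ∑ j, (k j : ℂ) * μ j = 0)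
    (hspec : ∀ z, (complexAction (linearization κ)).HasEigenvalue z → ∃ w, IsLogValue lam μ z w)
    (hB : IsLogarithm (linearization κ) lam μ B) : ∃ p, IsHamiltonianLog κ (quadForm B) p := by
  obtain ⟨hX, C, A', hC0, hC, hC1, hA⟩ := exists_formal_data hκ hexp hres hspec hB
  obtain ⟨h0, U, hU, h0U, hκU, hsymp⟩ := hκ
  have hp₀ := quadPoly_isHomogeneous B
  choose K hK using fun (m : ℕ) (i : Fin n ⊕ Fin n) =>
    exists_taylor_polynomial hU h0U (contDiffOn_pi.1 hκU i) (2 * m)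
  have hK' : ∀ {M m}, M ≤ 2 * m → ∀ i, (fun ρ => κ ρ i - eval ρ (K m i)) =O[𝓝 0]
      fun ρ => ‖ρ‖ ^ M := fun h i => (hK _ i).trans (isBigO_norm_pow_of_le h)
  have hKK : ∀ {m m'}, m ≤ m' → ∀ i, K m' i - K m i ∈ vanishingIdeal _ m := fun {m m'} h i => by
    refine mem_vanishingIdeal_of_isBigO (((hK' (by omega : m ≤ 2 * m) i).sub
      (hK' (by omega : m ≤ 2 * m') i)).congr_left fun ρ => ?_)
    rw [map_sub]; ring
  obtain ⟨s, hs, hgen⟩ := exists_generatesJet hp₀ hX hC0 hC hA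
    (hasEigenvalue_transpose_log_mem hspec hB)
    (fun γ hγ h => eq_zero_of_mem_closure_of_exp_eq_one hres hγ h) (K := K)
    (fun i => by
      rw [hC1]
      exact sub_linForm_linearization_mem h0
        ((hκU.contDiffAt (hU.mem_nhds h0U)).differentiableAt (by simp)) (hK' (by norm_num) i))
    (fun m i j => poisson_taylor_sub_mem hU h0U hκU hsymp (hK' (by omega)) i j)
    (fun m i => by
      rw [← Ideal.neg_mem_iff, neg_sub]
      exact hKK m.le_succ i)
  let P : ℕ → PhasePoly n := fun d => d.casesOn 0 fun d => d.casesOn 0 fun d =>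
    d.casesOn (quadPoly B) s
  have hP : ∀ d, (P d).IsHomogeneous d := by
    rintro (_ | _ | _ | d)
    · exact isHomogeneous_zero _ _ _
    · exact isHomogeneous_zero _ _ _
    · exact hp₀
    · exact hs d
  have hPsum : ∀ m, ∑ d ∈ Finset.range (m + 3), P d = quadPoly B + ∑ k ∈ Finset.range m, s k := by
    intro m
    rw [Finset.sum_range_succ', Finset.sum_range_succ', Finset.sum_range_succ']
    change ∑ k ∈ Finset.range m, s k + quadPoly B + 0 + 0 = _
    rw [add_zero, add_zero, add_comm]
  have hS3 : ∀ m, ∑ k ∈ Finset.range m, s k ∈ vanishingIdeal (Fin n ⊕ Fin n) 3 := fun m =>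
    Ideal.sum_mem _ fun k _ => vanishingIdeal_mono (by omega) (hs k).mem_vanishingIdeal
  obtain ⟨p, hp, hpc, hpP⟩ := exists_smooth_of_homogeneous P hP
  obtain ⟨Φ, hΦ⟩ := exists_isExpHamilton hp hpc
  refine ⟨p, Set.univ, isOpen_univ, trivial, hp.contDiffOn, ?_, Φ, hΦ, fun N => ?_⟩
  · have := hpP 3
    rw [hPsum 0] at this
    simpa [eval_quadPoly] using this
  · -- a Taylor polynomial of order `2 (N + 2)`, so that the Hamilton field is known to order `N + 2`
    have hpN := hpP (2 * N + 1 + 3)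
    rw [hPsum] at hpN
    have hg := (hgen (2 * N + 1)).mono hp₀ (by simpa using hS3 (2 * N + 1))
      (by omega : N + 2 ≤ 2 * N + 1 + 2) (hKK (by omega : N + 2 ≤ 2 * N + 1 + 2))
    exact ((generatesJet_iff isOpen_univ trivial hp.contDiffOn hΦ
      (mem_vanishingIdeal_two hp₀ (by simpa using hS3 (2 * N + 1))) (by omega) hpN
      (hK' (by omega))).1 hg).trans (isBigO_norm_pow_of_le (by omega))

theorem IsHamiltonianLog.vanishesToInfiniteOrder_sub (hκ : IsCanonicalGerm κ)
    (hexp : ∀ j, Complex.exp (μ j) = lam j)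
    (hres : ∀ k : Fin r → ℤ,
      (∃ m : ℤ, ∑ j, (k j : ℂ) * μ j = 2 * (Real.pi : ℂ) * Complex.I * (m : ℂ)) →
        ∑ j, (k j : ℂ) * μ j = 0)
    (hspec : ∀ z, (complexAction (linearization κ)).HasEigenvalue z → ∃ w, IsLogValue lam μ z w)
    (hB : IsLogarithm (linearization κ) lam μ B) {p q : PhaseSpace n → ℝ}
    (hp : IsHamiltonianLog κ (quadForm B) p) (hq : IsHamiltonianLog κ (quadForm B) q) :
    VanishesToInfiniteOrder (fun ρ => p ρ - q ρ) := fun N => by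
  obtain ⟨hX, C, A', hC0, hC, hC1, hA⟩ := exists_formal_data hκ hexp hres hspec hB
  obtain ⟨h0, U, hU, h0U, hκU, hsymp⟩ := hκ
  have hp₀ := quadPoly_isHomogeneous B
  choose K hK using fun i : Fin n ⊕ Fin n =>
    exists_taylor_polynomial hU h0U (contDiffOn_pi.1 hκU i) (N + 2)
  have key : ∀ p, IsHamiltonianLog κ (quadForm B) p → ∃ P : PhasePoly n,
      P - quadPoly B ∈ vanishingIdeal _ 3 ∧ GeneratesJet P K (N + 2) ∧
      (fun ρ => p ρ - eval ρ P) =O[𝓝 0] fun ρ => ‖ρ‖ ^ N := by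
    rintro p ⟨V, hV, h0V, hpV, hp3, Φ, hΦ, hκΦ⟩
    obtain ⟨P, hP⟩ := exists_taylor_polynomial hV h0V hpV (2 * (N + 2))
    have hP3 : P - quadPoly B ∈ vanishingIdeal _ 3 := by
      refine mem_vanishingIdeal_of_isBigO ((hp3.sub
        (hP.trans (isBigO_norm_pow_of_le (by omega)))).congr_left fun ρ => ?_)
      rw [map_sub, eval_quadPoly]; ring
    exact ⟨P, hP3, (generatesJet_iff hV h0V hpV hΦ (mem_vanishingIdeal_two hp₀ hP3) (by omega) hP
      hK).2 (hκΦ _), hP.trans (isBigO_norm_pow_of_le (by omega))⟩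
  obtain ⟨P, hP3, hPK, hpP⟩ := key p hp
  obtain ⟨Q, hQ3, hQK, hqQ⟩ := key q hq
  have hQP := GeneratesJet.sub_mem hp₀ hX hC0 hC hA (hasEigenvalue_transpose_log_mem hspec hB)
    (fun γ hγ h => eq_zero_of_mem_closure_of_exp_eq_one hres hγ h) hP3 hQ3 hPK hQK
  refine ((hpP.sub hqQ).sub (isBigO_eval (vanishingIdeal_mono
    (by omega : N ≤ N + 2 + 1) hQP))).congr_left fun ρ => ?_
  rw [map_sub]; ring

end LewisSternberg

theorem theorem1p3 (n : ℕ) (κ : LewisSternberg.PhaseSpace n → LewisSternberg.PhaseSpace n)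
    (hκ : LewisSternberg.IsCanonicalGerm κ)
    -- `dκ(0)` has no negative eigenvalues
    (hneg : ∀ x : ℝ, x < 0 →
      ¬ (LewisSternberg.complexAction (LewisSternberg.linearization κ)).HasEigenvalue (x : ℂ))
    -- the distinct eigenvalues of `dκ(0)` are `1` (possibly absent) and the `λ_j`, `λ_j⁻¹`
    (r : ℕ) (lam : Fin r → ℂ) (hinj : Function.Injective lam)
    (hhalf : ∀ j, 1 < ‖lam j‖ ∨ (‖lam j‖ = 1 ∧ 0 < (lam j).arg ∧ (lam j).arg < Real.pi))
    (hspec : ∀ z : ℂ, z ≠ 1 →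
      ((LewisSternberg.complexAction (LewisSternberg.linearization κ)).HasEigenvalue z ↔
        ∃ j, z = lam j ∨ z = (lam j)⁻¹))
    -- the choice of logarithms, compatible with complex conjugation
    (μ : Fin r → ℂ) (hexp : ∀ j, Complex.exp (μ j) = lam j)
    (hconj : ∀ i j, lam i = (starRingEnd ℂ) (lam j) → μ i = (starRingEnd ℂ) (μ j))
    -- the arithmetic condition
    (hres : ∀ k : Fin r → ℤ,
      (∃ m : ℤ, ∑ j, (k j : ℂ) * μ j = 2 * (Real.pi : ℂ) * Complex.I * (m : ℂ)) →
        ∑ j, (k j : ℂ) * μ j = 0) :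
    (∃! B : Matrix (Fin n ⊕ Fin n) (Fin n ⊕ Fin n) ℝ,
      LewisSternberg.IsLogarithm (LewisSternberg.linearization κ) lam μ B) ∧
    ∀ B : Matrix (Fin n ⊕ Fin n) (Fin n ⊕ Fin n) ℝ,
      LewisSternberg.IsLogarithm (LewisSternberg.linearization κ) lam μ B →
      (∃ p : LewisSternberg.PhaseSpace n → ℝ,
        LewisSternberg.IsHamiltonianLog κ (LewisSternberg.quadForm B) p) ∧
      ∀ p q : LewisSternberg.PhaseSpace n → ℝ,
        LewisSternberg.IsHamiltonianLog κ (LewisSternberg.quadForm B) p →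
        LewisSternberg.IsHamiltonianLog κ (LewisSternberg.quadForm B) q →
        LewisSternberg.VanishesToInfiniteOrder (fun ρ => p ρ - q ρ) := by
  have hhalf' : ∀ j, 1 < ‖lam j‖ ∨ (‖lam j‖ = 1 ∧ 0 < (lam j).im) := fun j =>
    (hhalf j).imp_right fun h => ⟨h.1, LewisSternberg.im_pos_of_arg h.2.1 h.2.2⟩
  have hspec' : ∀ z, (LewisSternberg.complexAction (LewisSternberg.linearization κ)).HasEigenvalue z →
      ∃ w, LewisSternberg.IsLogValue lam μ z w :=
    fun z hz => LewisSternberg.exists_isLogValue hspec hz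
  obtain ⟨B, hB⟩ := LewisSternberg.exists_isLogarithm hinj hhalf' hexp hconj hspec
  exact ⟨⟨B, hB, fun B' hB' => hB'.unique hspec' hB⟩, fun B hB =>
    ⟨LewisSternberg.exists_isHamiltonianLog hκ hexp hres hspec' hB,
      fun p q hp hq => hp.vanishesToInfiniteOrder_sub hκ hexp hres hspec' hB hq⟩⟩
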